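/- **Setting.** Let $T>0$, $\eta>0$, and let the following conditions (A1)–(A12) hold. (A1) $V$, $H$ are real Hilbert spaces, $V\subset H$ with dense, continuous and compact embedding; $H$ is identified with its dual, so that $V\subset H\subset V^*$. (A2) $L:H\to H$ is bounded, linear, symmetric, and $(Lw,w)_H\ge c_L\|w\|_H^2$ for all $w\in H$, with a constant $c_L>0$. (A3) $A_j:D(A_j)\subset H\to H$ ($j=1,2$) are linear maximal monotone selfadjoint operators with $D(A_j)\subset V$. There are bounded linear monotone symmetric operators $A_j^*:V\to V^*$ with $A_j^*w=A_jw$ for $w\in D(A_j)$, and for every $\alpha>0$ there is $\omega_{j,\alpha}>0$ with $\langle A_j^*w,w\rangle_{V^*,V}+\alpha\|w\|_H^2\ge\omega_{j,\alpha}\|w\|_V^2$ for all $w\in V$. (A4) $B_j:D(B_j)\subset H\to H$ ($j=1,2$) are linear maximal monotone selfadjoint operators, $D(A_1)\subset D(B_2)$, $D(B_1)\cap D(A_2)\ne\emptyset$, $(B_1w,A_2w)_H\ge0$ and $(B_1w,A_2z)_H=(B_1z,A_2w)_H$ for $w,z\in D(B_1)\cap D(A_2)$, and $(B_2w,A_1w)_H\ge0$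 for $w\in D(A_1)$. (A5) $\|B_2\theta\|_H\le C_{A_1,B_2}(\|A_1\theta\|_H+\|\theta\|_H)$ for $\theta\in D(A_1)$, with a constant $C_{A_1,B_2}>0$. (A6) $\Phi:D(\Phi)\subset H\to H$ is a single-valued maximal monotone operator, $\Phi(0)=0$, $V\subset D(\Phi)$, and $\|\Phi w-\Phi z\|_H\le C_\Phi(1+\|w\|_V^p+\|z\|_V^q)\|w-z\|_V$ for $w,z\in V$, with constants $p,q,C_\Phi>0$. (A7) There is a lower semicontinuous convex $i:V\to[0,\infty)$ with $(\Phi w,w-z)_H\ge i(w)-i(z)$ for $w,z\in V$. (A8) For every $\lambda>0$ the Yosida approximation $\Phi_\lambda$ of $\Phi$ satisfies $\Phi_\lambda(0)=0$, $(\Phi_\lambda w,B_1w)_H\ge0$ for $w\in D(B_1)$ and $(\Phi_\lambda w,A_2w)_H\ge0$ for $w\in D(A_2)$. (A9) $B_j^*:V\to V^*$ ($j=1,2$) are bounded linear monotone symmetric operators with $B_j^*w=B_jw$ for $w\in D(B_j)\cap V$. (A10) With ${\cal L}$ as in (A11), for every step size $h=T/N$, $N\in\mathbb N$, all $g\in H$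 and all $a,b,c,d,d',\lambda>0$: if $w\in V$ satisfies $Lw+aB_1^*w+bA_2^*w+c\Phi_\lambda w+d{\cal L}w+d'B_2(I+hA_1)^{-1}w=g$ in $V^*$, then $w\in D(B_1)\cap D(A_2)$ and $Lw+aB_1w+bA_2w+c\Phi_\lambda w+d{\cal L}w+d'B_2(I+hA_1)^{-1}w=g$ in $H$. (A11) ${\cal L}:H\to H$ is Lipschitz continuous with constant $C_{\cal L}>0$. (A12) $\theta_0\in D(A_1)$, $A_1\theta_0\in V$, $\varphi_0\in D(B_1)\cap D(A_2)$, $v_0\in D(B_1)\cap V$. **Exact solution.** A solution of (P) is a pair $(\theta,\varphi)$ with $\theta\in H^1(0,T;V)\cap L^\infty(0,T;V)\cap L^\infty(0,T;D(A_1))$, $\varphi\in W^{2,\infty}(0,T;H)\cap W^{1,\infty}(0,T;V)\cap L^2(0,T;D(A_2))$, $\frac{d\varphi}{dt}\in L^2(0,T;D(B_1))$, $\Phi\varphi\in L^\infty(0,T;H)$, such that in $H$, a.e. on $(0,T)$, $$\frac{d\theta}{dt}+\eta\frac{d\varphi}{dt}+A_1\theta=0,\qquad L\frac{d^2\varphi}{dt^2}+B_1\frac{d\varphi}{dt}+A_2\varphi+\Phi\varphi+{\cal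 L}\varphi=B_2\theta,$$ and $\theta(0)=\theta_0$, $\varphi(0)=\varphi_0$, $\frac{d\varphi}{dt}(0)=v_0$. Put $v=\frac{d\varphi}{dt}$. **Discrete solution.** Let $N\in\mathbb N$, $N\ge1$, $h=T/N$ and $\delta_hu_n=(u_{n+1}-u_n)/h$. A solution of (P)$_n$ consists of $\theta_{n+1}\in D(A_1)$ and $\varphi_{n+1}\in D(B_1)\cap D(A_2)$, $n=0,\dots,N-1$, such that, with the given $\theta_0,\varphi_0,v_0$ and with $v_{n+1}=\delta_h\varphi_n$, $z_{n+1}=\delta_hv_n$, $$\delta_h\theta_n+\eta\,\delta_h\varphi_n+A_1\theta_{n+1}=0,\qquad Lz_{n+1}+B_1v_{n+1}+A_2\varphi_{n+1}+\Phi\varphi_{n+1}+{\cal L}\varphi_{n+1}=B_2\theta_{n+1}$$ for $n=0,\dots,N-1$. For $t\in(nh,(n+1)h)$ put $\widehat u_h(t)=u_n+(t-nh)\delta_hu_n$ and $\overline u_h(t)=u_{n+1}$, for $u=\theta,\varphi,v$. **Theorem 1.3.** Let (A1)–(A12) hold and let $h_0>0$. Then there are $h_{00}\in(0,h_0)$ and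 $M=M(T)>0$ such that, for every $h=T/N$ in $(0,h_{00})$, every solution $(\theta_{n+1},\varphi_{n+1})_{n=0}^{N-1}$ of (P)$_n$ and every solution $(\theta,\varphi)$ of (P), all the norms and the integral below are well defined and finite, and $$\begin{aligned}&\|L^{1/2}(\widehat v_h-v)\|_{L^\infty(0,T;H)}+\|B_1^{1/2}(\overline v_h-v)\|_{L^2(0,T;H)}+\|\widehat\varphi_h-\varphi\|_{L^\infty(0,T;V)}\\&+\|\widehat\theta_h-\theta\|_{L^\infty(0,T;H)}+\|\overline\theta_h-\theta\|_{L^2(0,T;V)}+\|B_2^{1/2}(\widehat\theta_h-\theta)\|_{L^\infty(0,T;H)}\\&+\int_0^T\big(B_2(\overline\theta_h(t)-\theta(t)),A_1(\overline\theta_h(t)-\theta(t))\big)_H\,dt\ \le\ M\,h^{1/2}.\end{aligned}$$ ($L^{1/2}$, $B_j^{1/2}$ are the nonnegative selfadjoint square roots. $M$ and $h_{00}$ may depend on the spaces, the operators, the initial data, $\eta$ and $T$, but not on $h$ or on the solutions.) -/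

import Mathlib

open MeasureTheory Set Filter
open scoped ContDiff ENNReal NNReal

noncomputable section

namespace AbstractSoundHeat

/-! ### Monotone operators, resolvents, Yosida approximations, square roots -/

section Operators

variable {H : Type*} [NormedAddCommGroup H] [InnerProductSpace ℝ H]

/-- A (possibly multivalued, possibly nonlinear) operator, given by its graph, is maximal
monotone: it is monotone, and no pair can be added to the graph without destroying this. -/
def IsMaximalMonotone (G : Set (H × H)) : Prop :=
  (∀ p ∈ G, ∀ q ∈ G, 0 ≤ inner ℝ (p.2 - q.2) (p.1 - q.1)) ∧
    ∀ p : H × H, (∀ q ∈ G, 0 ≤ inner ℝ (p.2 - q.2) (p.1 - q.1)) → p ∈ G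

/-- The graph of a single-valued operator `F` with domain `D`. -/
def graphOn (D : Set H) (F : H → H) : Set (H × H) := {p | p.1 ∈ D ∧ p.2 = F p.1}

open Classical in
/-- The resolvent `(I + lam G)⁻¹ x`: the `u` with `u + lam y = x` for some `(u, y) ∈ G`.
For a maximal monotone `G` and `lam > 0` it exists and is unique for every `x`. -/
def resolventOp (G : Set (H × H)) (lam : ℝ) (x : H) : H :=
  if h : ∃ u y : H, (u, y) ∈ G ∧ u + lam • y = x then h.choose else 0

/-- The Yosida approximation `(x - (I + lam G)⁻¹ x) / lam`. -/
def yosida (G : Set (H × H)) (lam : ℝ) (x : H) : H := lam⁻¹ • (x - resolventOp G lam x)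

open Classical in
/-- The value `A x` of a linear operator with domain; the value `0` outside the domain is
never used: membership in the domain is always required, or guaranteed, next to it. -/
def ev (A : H →ₗ.[ℝ] H) (x : H) : H := if h : x ∈ A.domain then A ⟨x, h⟩ else 0

variable [CompleteSpace H]

/-- `S` is a nonnegative selfadjoint operator with `S ∘ S = B`, domains included. -/
def IsPosSqrt (B S : H →ₗ.[ℝ] H) : Prop :=
  IsSelfAdjoint S ∧ (∀ x : S.domain, 0 ≤ inner ℝ (S x) (x : H)) ∧
    ∀ x y : H, (x, y) ∈ B.graph ↔ ∃ u : H, (x, u) ∈ S.graph ∧ (u, y) ∈ S.graph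

open Classical in
/-- The square root `B^{1/2}`: the nonnegative selfadjoint operator whose square is `B`.
For a nonnegative selfadjoint `B` there is exactly one. -/
def posSqrt (B : H →ₗ.[ℝ] H) : H →ₗ.[ℝ] H :=
  if h : ∃ S : H →ₗ.[ℝ] H, IsPosSqrt B S then h.choose else 0

end Operators

/-! ### Vector-valued function spaces on `(0, T)` -/

section Spaces

variable {X : Type*} [NormedAddCommGroup X]

/-- `f ∈ L^p(0, T; X)`. -/
def InLp (T : ℝ) (p : ℝ≥0∞) (f : ℝ → X) : Prop := MemLp f p (volume.restrict (Ioo 0 T))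

/-- The norm of `L^p(0, T; X)`. -/
def normLp (T : ℝ) (p : ℝ≥0∞) (f : ℝ → X) : ℝ :=
  (eLpNorm f p (volume.restrict (Ioo 0 T))).toReal

/-- The value at `0` of the representative of `f` that is continuous on `[0, T]` is `x`. -/
def HasInitialValue (T : ℝ) (f : ℝ → X) (x : X) : Prop :=
  ∃ g : ℝ → X, ContinuousOn g (Icc 0 T) ∧ g =ᵐ[volume.restrict (Ioo 0 T)] f ∧ g 0 = x

variable [NormedSpace ℝ X]

/-- `g` is the derivative of `f` on `(0, T)` in the sense of distributions. -/
def HasWeakDeriv (T : ℝ) (f g : ℝ → X) : Prop :=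
  ∀ ψ : ℝ → ℝ, ContDiff ℝ ∞ ψ → HasCompactSupport ψ → tsupport ψ ⊆ Ioo 0 T →
    ∫ t in Ioo 0 T, deriv ψ t • f t = - ∫ t in Ioo 0 T, ψ t • g t

/-- `f ∈ W^{1,p}(0, T; X)` with derivative `g`. -/
def InW1p (T : ℝ) (p : ℝ≥0∞) (f g : ℝ → X) : Prop :=
  InLp T p f ∧ InLp T p g ∧ HasWeakDeriv T f g

/-- `f ∈ L^p(0, T; D(A))`, where `D(A)` carries the graph norm. -/
def InLpDomain {H : Type*} [NormedAddCommGroup H] [InnerProductSpace ℝ H]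
    (T : ℝ) (p : ℝ≥0∞) (A : H →ₗ.[ℝ] H) (f : ℝ → H) : Prop :=
  (∀ᵐ t ∂(volume.restrict (Ioo 0 T)), f t ∈ A.domain) ∧ InLp T p f ∧
    InLp T p (fun t => ev A (f t))

end Spaces

/-! ### The data of the problem and the standing assumptions -/

section Problem

variable {V H : Type*} [NormedAddCommGroup V] [InnerProductSpace ℝ V] [CompleteSpace V]
  [NormedAddCommGroup H] [InnerProductSpace ℝ H] [CompleteSpace H]

/-- The data. `V` is regarded as a subspace of `H` through `emb`, the dual of `V` is
`StrongDual ℝ V`, and `x : H` acts on `V` as `w ↦ (x, emb w)_H`. The operators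
`A₁s, A₂s, B₁s, B₂s : V → V*` are the ones that extend `A₁, A₂, B₁, B₂`. The operator `Φ` has
the domain `domΦ` (its values elsewhere are irrelevant), and `ell` is the Lipschitz
perturbation. All requirements on the data are in `Assumptions`. -/
structure Data (V H : Type*) [NormedAddCommGroup V] [InnerProductSpace ℝ V]
    [NormedAddCommGroup H] [InnerProductSpace ℝ H] where
  T : ℝ
  η : ℝ
  emb : V →L[ℝ] H
  L : H →L[ℝ] H
  A₁ : H →ₗ.[ℝ] H
  A₂ : H →ₗ.[ℝ] H
  B₁ : H →ₗ.[ℝ] H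
  B₂ : H →ₗ.[ℝ] H
  A₁s : V →L[ℝ] StrongDual ℝ V
  A₂s : V →L[ℝ] StrongDual ℝ V
  B₁s : V →L[ℝ] StrongDual ℝ V
  B₂s : V →L[ℝ] StrongDual ℝ V
  domΦ : Set H
  Φ : H → H
  ell : H → H
  θ₀ : V
  φ₀ : V
  v₀ : V

/-- `As : V → V*` is monotone and symmetric and agrees with `A` on `D(A) ∩ V`. -/
def IsDualExtension (emb : V →L[ℝ] H) (A : H →ₗ.[ℝ] H) (As : V →L[ℝ] StrongDual ℝ V) : Prop :=
  (∀ w : V, 0 ≤ As w w) ∧ (∀ w z : V, As w z = As z w) ∧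
    ∀ w : V, emb w ∈ A.domain → ∀ z : V, As w z = inner ℝ (ev A (emb w)) (emb z)

/-- `⟨As w, w⟩ + α ‖w‖_H² ≥ κ ‖w‖_V²` with some `κ = κ(α) > 0`, for every `α > 0`. -/
def IsWeaklyCoercive (emb : V →L[ℝ] H) (As : V →L[ℝ] StrongDual ℝ V) : Prop :=
  ∀ α : ℝ, 0 < α → ∃ κ : ℝ, 0 < κ ∧ ∀ w : V, κ * ‖w‖ ^ 2 ≤ As w w + α * ‖emb w‖ ^ 2

/-- The graph of `Φ`. -/
def Data.graphΦ (D : Data V H) : Set (H × H) := graphOn D.domΦ D.Φ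

/-- The standing assumptions on the data. -/
structure Assumptions (D : Data V H) : Prop where
  T_pos : 0 < D.T
  η_pos : 0 < D.η
  -- `V ⊂ H` with dense, continuous and compact embedding
  emb_injective : Function.Injective D.emb
  emb_dense : DenseRange D.emb
  emb_compact : IsCompactOperator D.emb
  -- `L` is bounded, symmetric and coercive
  L_symm : ∀ w z : H, inner ℝ (D.L w) z = inner ℝ w (D.L z)
  L_coercive : ∃ c : ℝ, 0 < c ∧ ∀ w : H, c * ‖w‖ ^ 2 ≤ inner ℝ (D.L w) w
  -- `A₁` and `A₂`
  A₁_maxMonotone : IsMaximalMonotone (D.A₁.graph : Set (H × H))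
  A₂_maxMonotone : IsMaximalMonotone (D.A₂.graph : Set (H × H))
  A₁_selfAdjoint : IsSelfAdjoint D.A₁
  A₂_selfAdjoint : IsSelfAdjoint D.A₂
  A₁_domain : ∀ x ∈ D.A₁.domain, x ∈ range D.emb
  A₂_domain : ∀ x ∈ D.A₂.domain, x ∈ range D.emb
  A₁_ext : IsDualExtension D.emb D.A₁ D.A₁s
  A₂_ext : IsDualExtension D.emb D.A₂ D.A₂s
  A₁_coercive : IsWeaklyCoercive D.emb D.A₁s
  A₂_coercive : IsWeaklyCoercive D.emb D.A₂s
  -- `B₁` and `B₂`, and their relations to `A₁` and `A₂`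
  B₁_maxMonotone : IsMaximalMonotone (D.B₁.graph : Set (H × H))
  B₂_maxMonotone : IsMaximalMonotone (D.B₂.graph : Set (H × H))
  B₁_selfAdjoint : IsSelfAdjoint D.B₁
  B₂_selfAdjoint : IsSelfAdjoint D.B₂
  A₁_le_B₂ : D.A₁.domain ≤ D.B₂.domain
  B₁_A₂_nonempty : ((D.B₁.domain : Set H) ∩ D.A₂.domain).Nonempty
  B₁_A₂_nonneg : ∀ w ∈ D.B₁.domain, w ∈ D.A₂.domain → 0 ≤ inner ℝ (ev D.B₁ w) (ev D.A₂ w)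
  B₂_A₁_nonneg : ∀ w ∈ D.A₁.domain, 0 ≤ inner ℝ (ev D.B₂ w) (ev D.A₁ w)
  B₁_A₂_symm : ∀ w ∈ D.B₁.domain, w ∈ D.A₂.domain → ∀ z ∈ D.B₁.domain, z ∈ D.A₂.domain →
    inner ℝ (ev D.B₁ w) (ev D.A₂ z) = inner ℝ (ev D.B₁ z) (ev D.A₂ w)
  B₂_bound : ∃ C : ℝ, 0 < C ∧ ∀ x ∈ D.A₁.domain, ‖ev D.B₂ x‖ ≤ C * (‖ev D.A₁ x‖ + ‖x‖)
  B₁_ext : IsDualExtension D.emb D.B₁ D.B₁s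
  B₂_ext : IsDualExtension D.emb D.B₂ D.B₂s
  -- the nonlinear operator `Φ`
  Φ_maxMonotone : IsMaximalMonotone D.graphΦ
  Φ_zero : D.Φ 0 = 0
  Φ_domain : ∀ w : V, D.emb w ∈ D.domΦ
  Φ_growth : ∃ p q C : ℝ, 0 < p ∧ 0 < q ∧ 0 < C ∧ ∀ w z : V,
    ‖D.Φ (D.emb w) - D.Φ (D.emb z)‖ ≤ C * (1 + ‖w‖ ^ p + ‖z‖ ^ q) * ‖w - z‖
  Φ_potential : ∃ i : V → ℝ, LowerSemicontinuous i ∧ ConvexOn ℝ univ i ∧ (∀ w, 0 ≤ i w) ∧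
    ∀ w z : V, i w - i z ≤ inner ℝ (D.Φ (D.emb w)) (D.emb w - D.emb z)
  Φ_yosida_zero : ∀ lam : ℝ, 0 < lam → yosida D.graphΦ lam 0 = 0
  Φ_yosida_B₁ : ∀ lam : ℝ, 0 < lam → ∀ w ∈ D.B₁.domain,
    0 ≤ inner ℝ (yosida D.graphΦ lam w) (ev D.B₁ w)
  Φ_yosida_A₂ : ∀ lam : ℝ, 0 < lam → ∀ w ∈ D.A₂.domain,
    0 ≤ inner ℝ (yosida D.graphΦ lam w) (ev D.A₂ w)
  -- elliptic regularity: a solution in `V*` is a solution in `H`; `h` is any step size `T / N`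
  regularity : ∀ N : ℕ, 0 < N → ∀ h : ℝ, h = D.T / N →
    ∀ (g : H) (a b c d e lam : ℝ), 0 < a → 0 < b → 0 < c → 0 < d → 0 < e → 0 < lam →
    ∀ w : V,
      (∀ z : V, inner ℝ (D.L (D.emb w)) (D.emb z) + a * D.B₁s w z + b * D.A₂s w z
        + c * inner ℝ (yosida D.graphΦ lam (D.emb w)) (D.emb z)
        + d * inner ℝ (D.ell (D.emb w)) (D.emb z)
        + e * inner ℝ (ev D.B₂ (resolventOp (D.A₁.graph : Set (H × H)) h (D.emb w))) (D.emb z)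
        = inner ℝ g (D.emb z)) →
      D.emb w ∈ D.B₁.domain ∧ D.emb w ∈ D.A₂.domain ∧
        D.L (D.emb w) + a • ev D.B₁ (D.emb w) + b • ev D.A₂ (D.emb w)
          + c • yosida D.graphΦ lam (D.emb w) + d • D.ell (D.emb w)
          + e • ev D.B₂ (resolventOp (D.A₁.graph : Set (H × H)) h (D.emb w)) = g
  -- the Lipschitz perturbation
  ell_lipschitz : ∃ C : ℝ≥0, 0 < C ∧ LipschitzWith C D.ell
  -- the initial data
  θ₀_mem : D.emb D.θ₀ ∈ D.A₁.domain
  A₁_θ₀_mem : ev D.A₁ (D.emb D.θ₀) ∈ range D.emb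
  φ₀_mem_B₁ : D.emb D.φ₀ ∈ D.B₁.domain
  φ₀_mem_A₂ : D.emb D.φ₀ ∈ D.A₂.domain
  v₀_mem : D.emb D.v₀ ∈ D.B₁.domain

/-! ### The continuous problem -/

/-- `(θ, φ)` is a solution of the continuous problem; the further arguments are the derivatives
`dθ/dt = θt`, `dφ/dt = v` and `d²φ/dt² = z`. -/
structure IsSolution (D : Data V H) (θ φ θt v : ℝ → V) (z : ℝ → H) : Prop where
  -- `θ ∈ H¹(0,T;V) ∩ L^∞(0,T;V) ∩ L^∞(0,T;D(A₁))`
  θ_H1 : InW1p D.T 2 θ θt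
  θ_Linfty : InLp D.T ∞ θ
  θ_A₁ : InLpDomain D.T ∞ D.A₁ (fun t => D.emb (θ t))
  -- `φ ∈ W^{2,∞}(0,T;H) ∩ W^{1,∞}(0,T;V) ∩ L²(0,T;D(A₂))`
  φ_W1V : InW1p D.T ∞ φ v
  φ_W1H : InW1p D.T ∞ (fun t => D.emb (φ t)) (fun t => D.emb (v t))
  v_W1H : InW1p D.T ∞ (fun t => D.emb (v t)) z
  φ_A₂ : InLpDomain D.T 2 D.A₂ (fun t => D.emb (φ t))
  -- `dφ/dt ∈ L²(0,T;D(B₁))` and `Φφ ∈ L^∞(0,T;H)`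
  v_B₁ : InLpDomain D.T 2 D.B₁ (fun t => D.emb (v t))
  Φφ : InLp D.T ∞ (fun t => D.Φ (D.emb (φ t)))
  -- the equations in `H`, a.e. on `(0,T)`
  eq₁ : ∀ᵐ t ∂(volume.restrict (Ioo 0 D.T)),
    D.emb (θt t) + D.η • D.emb (v t) + ev D.A₁ (D.emb (θ t)) = 0
  eq₂ : ∀ᵐ t ∂(volume.restrict (Ioo 0 D.T)),
    D.L (z t) + ev D.B₁ (D.emb (v t)) + ev D.A₂ (D.emb (φ t)) + D.Φ (D.emb (φ t))
      + D.ell (D.emb (φ t)) = ev D.B₂ (D.emb (θ t))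
  -- the initial conditions in `H`
  θ_init : HasInitialValue D.T (fun t => D.emb (θ t)) (D.emb D.θ₀)
  φ_init : HasInitialValue D.T (fun t => D.emb (φ t)) (D.emb D.φ₀)
  v_init : HasInitialValue D.T (fun t => D.emb (v t)) (D.emb D.v₀)

/-! ### The discrete problem and the interpolants -/

/-- The difference quotient `(u (n+1) - u n) / h`. -/
def diffQuot (h : ℝ) (u : ℕ → V) (n : ℕ) : V := h⁻¹ • (u (n + 1) - u n)

/-- The discrete velocity: `v 0 = v₀` and `v (n+1) = (φ (n+1) - φ n) / h`. -/
def discreteV (h : ℝ) (v₀ : V) (φ : ℕ → V) : ℕ → V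
  | 0 => v₀
  | n + 1 => diffQuot h φ n

/-- The discrete acceleration: `z 0 = z 1` and `z (n+1) = (v (n+1) - v n) / h`. -/
def discreteZ (h : ℝ) (v₀ : V) (φ : ℕ → V) : ℕ → V
  | 0 => diffQuot h (discreteV h v₀ φ) 0
  | n + 1 => diffQuot h (discreteV h v₀ φ) n

/-- `(θ n, φ n)`, `n = 0, …, N`, solves the time discrete problem with `N` steps of size
`h = T / N`; terms with index beyond `N` are irrelevant. -/
structure IsDiscreteSolution (D : Data V H) (N : ℕ) (h : ℝ) (θ φ : ℕ → V) : Prop where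
  step : h = D.T / N
  θ_zero : θ 0 = D.θ₀
  φ_zero : φ 0 = D.φ₀
  θ_mem : ∀ n < N, D.emb (θ (n + 1)) ∈ D.A₁.domain
  φ_mem_B₁ : ∀ n < N, D.emb (φ (n + 1)) ∈ D.B₁.domain
  φ_mem_A₂ : ∀ n < N, D.emb (φ (n + 1)) ∈ D.A₂.domain
  eq₁ : ∀ n < N, D.emb (diffQuot h θ n) + D.η • D.emb (diffQuot h φ n)
    + ev D.A₁ (D.emb (θ (n + 1))) = 0
  eq₂ : ∀ n < N, D.L (D.emb (discreteZ h D.v₀ φ (n + 1)))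
    + ev D.B₁ (D.emb (discreteV h D.v₀ φ (n + 1))) + ev D.A₂ (D.emb (φ (n + 1)))
    + D.Φ (D.emb (φ (n + 1))) + D.ell (D.emb (φ (n + 1))) = ev D.B₂ (D.emb (θ (n + 1)))

/-- The piecewise affine interpolant: it equals `u n` at `t = n h` and has the derivative
`(u (n+1) - u n) / h` on `(n h, (n+1) h)`. -/
def hatInterp (h : ℝ) (u : ℕ → V) (t : ℝ) : V :=
  u ⌊t / h⌋₊ + (t - ⌊t / h⌋₊ * h) • diffQuot h u ⌊t / h⌋₊

/-- The piecewise constant interpolant: it equals `u (n+1)` on `(n h, (n+1) h)`. -/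
def barInterp (h : ℝ) (u : ℕ → V) (t : ℝ) : V := u (⌊t / h⌋₊ + 1)

end Problem

end AbstractSoundHeat

end

/-!
The exact solution is compared with the discrete one by sampling: its values at the grid points
`n h`, together with its mean values over the cells `(n h, (n + 1) h)`, satisfy the equations of the
implicit scheme exactly, because a selfadjoint operator commutes with taking means
(`integral_mem_graph`). What is not exact is the agreement of the mean values with the values at
the right endpoints. They differ by `O(h)`, and for the temperature, whose derivative is only
square integrable in time, by `O(h)` in the sum of the squares. Both the discrete and the exact
solution are thus approximate solutions (`IsApproxSolution`).

Two approximate solutions are `O(h)` close in the squared energy norm (`Assumptions.stability`).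
The wave equation is tested with the velocity and the heat equation with `B₂ θ / η`, so that the
coupling terms cancel, and also with `θ` itself (`Assumptions.energy_increment`). The residuals
enter through their own energy only, since the implicit scheme dissipates the energy of the
increments. The remaining terms are handled by a discrete Gronwall inequality. Since `Φ` is
Lipschitz only on bounded sets of `V`, an a priori bound for the discrete displacement is needed
(`Assumptions.discrete_bound`); it comes from the same energy balance and the potential of `Φ`.

This yields the bounds at the grid points (`IsSolution.exists_nodalBounds`). To pass to the
interpolants one needs the oscillation of the exact solution on a cell, which is `O(h)` in the
squared norms in question. For `B₁^{1/2} (v̄ - v)` and for the mixed term the time regularity of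
`v` and of `A₁ θ` is too low for this. There the part of the deviation from the mean value that is
linear integrates to zero, and the quadratic part is estimated by means of `B₁ v ∈ L²(0, T; H)`
and of `A₁ θ = -(dθ/dt + η v) ∈ L²(0, T; V)`, respectively.

The constants obtained in this way depend on the exact solution. But the exact solution is unique
(`IsSolution.unique`): two of them are approximate solutions for every step size, hence they agree
in the limit `h → 0`. The square roots of the operators are constructed in `exists_isPosSqrt`.
-/

namespace AbstractSoundHeat

/-! ### Nonnegative selfadjoint operators and their square roots -/

section SelfAdjoint

variable {H : Type*} [NormedAddCommGroup H] [InnerProductSpace ℝ H]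

theorem ev_of_mem {A : H →ₗ.[ℝ] H} {x : H} (h : x ∈ A.domain) : ev A x = A ⟨x, h⟩ := dif_pos h

theorem mem_graph_iff_ev {A : H →ₗ.[ℝ] H} {x y : H} :
    (x, y) ∈ A.graph ↔ x ∈ A.domain ∧ ev A x = y := by
  constructor
  · intro h
    obtain ⟨z, hz, hy⟩ := (LinearPMap.mem_graph_iff A).1 h
    simp only at hz hy
    subst hz
    exact ⟨z.2, by rw [ev_of_mem z.2]; exact hy⟩
  · rintro ⟨h, rfl⟩
    rw [ev_of_mem h]
    exact A.mem_graph ⟨x, h⟩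

theorem ev_mem_graph {A : H →ₗ.[ℝ] H} {x : H} (h : x ∈ A.domain) : (x, ev A x) ∈ A.graph :=
  mem_graph_iff_ev.2 ⟨h, rfl⟩

theorem ev_add {A : H →ₗ.[ℝ] H} {x y : H} (hx : x ∈ A.domain) (hy : y ∈ A.domain) :
    ev A (x + y) = ev A x + ev A y :=
  (mem_graph_iff_ev.1 (A.graph.add_mem (ev_mem_graph hx) (ev_mem_graph hy))).2

theorem ev_sub {A : H →ₗ.[ℝ] H} {x y : H} (hx : x ∈ A.domain) (hy : y ∈ A.domain) :
    ev A (x - y) = ev A x - ev A y :=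
  (mem_graph_iff_ev.1 (A.graph.sub_mem (ev_mem_graph hx) (ev_mem_graph hy))).2

theorem ev_smul {A : H →ₗ.[ℝ] H} {x : H} (c : ℝ) (hx : x ∈ A.domain) :
    ev A (c • x) = c • ev A x :=
  (mem_graph_iff_ev.1 (A.graph.smul_mem c (ev_mem_graph hx))).2

theorem inner_ev_nonneg {A : H →ₗ.[ℝ] H} (hA : IsMaximalMonotone (A.graph : Set (H × H))) {x : H}
    (hx : x ∈ A.domain) : 0 ≤ inner ℝ (ev A x) x := by
  have := hA.1 (x, ev A x) (ev_mem_graph hx) (0, 0) A.graph.zero_mem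
  simpa using this

theorem norm_le_norm_add_of_inner_nonneg {x y : H} (h : 0 ≤ inner ℝ y x) :
    ‖x‖ ≤ ‖x + y‖ ∧ ‖y‖ ≤ ‖x + y‖ := by
  have h1 := norm_add_sq_real x y
  rw [real_inner_comm] at h1
  constructor
  · nlinarith [norm_nonneg (x + y), norm_nonneg x, sq_nonneg ‖y‖]
  · nlinarith [norm_nonneg (x + y), norm_nonneg y, sq_nonneg ‖x‖]

theorem eq_of_add_ev_eq {A : H →ₗ.[ℝ] H} (hpos : ∀ x ∈ A.domain, 0 ≤ inner ℝ (ev A x) x) {x y : H}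
    (hx : x ∈ A.domain) (hy : y ∈ A.domain) (h : x + ev A x = y + ev A y) : x = y := by
  have h1 := (norm_le_norm_add_of_inner_nonneg (hpos _ (A.domain.sub_mem hx hy))).1
  rw [ev_sub hx hy] at h1
  have h2 : x - y + (ev A x - ev A y) = 0 := by
    rw [show x - y + (ev A x - ev A y) = (x + ev A x) - (y + ev A y) by abel, h, sub_self]
  rw [h2, norm_zero] at h1
  exact sub_eq_zero.1 (norm_le_zero_iff.1 h1)

theorem ev_toPMap_top (L : H →L[ℝ] H) (x : H) : ev ((L : H →ₗ[ℝ] H).toPMap ⊤) x = L x := by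
  rw [ev_of_mem (Submodule.mem_top : x ∈ ((L : H →ₗ[ℝ] H).toPMap ⊤).domain)]
  rfl

variable [CompleteSpace H]

/-- A selfadjoint operator coincides with its adjoint, at the level of graphs. -/
theorem mem_graph_iff_of_isSelfAdjoint {A : H →ₗ.[ℝ] H} (hA : IsSelfAdjoint A) {x y : H} :
    (x, y) ∈ A.graph ↔ ∀ a ∈ A.domain, inner ℝ (ev A a) x = inner ℝ a y := by
  have h1 : A.graph = A.graph.adjoint := by
    conv_lhs => rw [← (LinearPMap.isSelfAdjoint_def.1 hA)]
    exact LinearPMap.adjoint_graph_eq_graph_adjoint hA.dense_domain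
  rw [h1, Submodule.mem_adjoint_iff]
  constructor
  · intro h a ha
    exact sub_eq_zero.1 (h a _ (ev_mem_graph ha))
  · intro h a b hab
    obtain ⟨ha, rfl⟩ := mem_graph_iff_ev.1 hab
    exact sub_eq_zero.2 (h a ha)

theorem inner_ev_symm {A : H →ₗ.[ℝ] H} (hA : IsSelfAdjoint A) {x y : H} (hx : x ∈ A.domain)
    (hy : y ∈ A.domain) : inner ℝ (ev A x) y = inner ℝ x (ev A y) :=
  (mem_graph_iff_of_isSelfAdjoint hA).1 (ev_mem_graph hy) x hx

/-- A nonnegative selfadjoint operator `A` has an everywhere defined resolvent: `I + A` is onto. -/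
theorem exists_add_ev_eq {A : H →ₗ.[ℝ] H} (hA : IsSelfAdjoint A)
    (hpos : ∀ x ∈ A.domain, 0 ≤ inner ℝ (ev A x) x) (z : H) :
    ∃ x ∈ A.domain, x + ev A x = z := by
  have hcl : _root_.IsClosed (A.graph : Set (H × H)) := hA.isClosed
  have : CompleteSpace A.graph := hcl.completeSpace_coe
  let f : A.graph →L[ℝ] H :=
    (ContinuousLinearMap.fst ℝ H H + ContinuousLinearMap.snd ℝ H H).comp A.graph.subtypeL
  have hf : AntilipschitzWith 1 f := by
    refine f.antilipschitz_of_bound fun p => ?_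
    obtain ⟨⟨x, y⟩, hp⟩ := p
    obtain ⟨hx, rfl⟩ := mem_graph_iff_ev.1 hp
    have := norm_le_norm_add_of_inner_nonneg (hpos x hx)
    simpa [f] using max_le this.1 this.2
  have hcr : _root_.IsClosed (f.range : Set H) := by
    have h := hf.isClosed_range f.uniformContinuous
    exact h
  have : CompleteSpace f.range := hcr.completeSpace_coe
  have htop : f.range = ⊤ := by
    rw [← Submodule.orthogonal_eq_bot_iff, Submodule.eq_bot_iff]
    intro u hu
    rw [Submodule.mem_orthogonal] at hu
    have h1 : (u, -u) ∈ A.graph := by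
      rw [mem_graph_iff_of_isSelfAdjoint hA]
      intro a ha
      have := hu (a + ev A a) ⟨⟨(a, ev A a), ev_mem_graph ha⟩, by simp [f]⟩
      rw [inner_add_left] at this
      rw [inner_neg_right]; linarith
    obtain ⟨h2, h3⟩ := mem_graph_iff_ev.1 h1
    have h4 := hpos u h2
    rw [h3, inner_neg_left, real_inner_self_eq_norm_sq] at h4
    have : ‖u‖ = 0 := by nlinarith [norm_nonneg u]
    simpa using this
  have hz : z ∈ f.range := htop ▸ Submodule.mem_top
  obtain ⟨⟨⟨x, y⟩, hp⟩, hxy⟩ := hz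
  obtain ⟨hx, rfl⟩ := mem_graph_iff_ev.1 hp
  exact ⟨x, hx, by simpa [f] using hxy⟩

/-- If `C` is bounded relative to a nonnegative selfadjoint `A`, then `C (I + A)⁻¹` is a bounded
operator. This reduces measurability of `t ↦ C (f t)` to that of `f` and of `t ↦ A (f t)`. -/
theorem exists_clm_ev_eq {A : H →ₗ.[ℝ] H} (hA : IsSelfAdjoint A)
    (hpos : ∀ x ∈ A.domain, 0 ≤ inner ℝ (ev A x) x) {C : H →ₗ.[ℝ] H} (hAC : A.domain ≤ C.domain)
    {M : ℝ} (hM : ∀ x ∈ A.domain, ‖ev C x‖ ≤ M * ‖x + ev A x‖) :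
    ∃ T : H →L[ℝ] H, ∀ x ∈ A.domain, T (x + ev A x) = ev C x := by
  choose R hR hRz using exists_add_ev_eq hA hpos
  have hadd : ∀ y z, R (y + z) = R y + R z := fun y z => by
    refine eq_of_add_ev_eq hpos (hR _) (A.domain.add_mem (hR _) (hR _)) ?_
    rw [hRz, ev_add (hR _) (hR _), add_add_add_comm, hRz, hRz]
  have hsmul : ∀ (c : ℝ) z, R (c • z) = c • R z := fun c z => by
    refine eq_of_add_ev_eq hpos (hR _) (A.domain.smul_mem c (hR _)) ?_
    rw [hRz, ev_smul c (hR _), ← smul_add, hRz]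
  let T : H →ₗ[ℝ] H :=
    { toFun := fun z => ev C (R z)
      map_add' := fun y z => by rw [hadd, ev_add (hAC (hR _)) (hAC (hR _))]
      map_smul' := fun c z => by rw [hsmul, ev_smul c (hAC (hR _))]; rfl }
  refine ⟨T.mkContinuous M fun z => ?_, fun x hx => ?_⟩
  · have := hM (R z) (hR z)
    rwa [hRz] at this
  · have : R (x + ev A x) = x := eq_of_add_ev_eq hpos (hR _) hx (hRz _)
    change ev C (R (x + ev A x)) = _
    rw [this]

/-- The square root of `1 - X` for a symmetric contraction `X`, as `1 - Y` with `Y` the limit of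
the iteration `Y ↦ (X + Y²) / 2`; it converges in norm because it is dominated by the same
iteration for the number `1`. The square root commutes with every operator that commutes with
`X`, because the iterates do. -/
theorem exists_sqrt_one_sub (X : H →L[ℝ] H) (hX : ‖X‖ ≤ 1)
    (hs : ∀ x y, inner ℝ (X x) y = inner ℝ x (X y)) :
    ∃ P : H →L[ℝ] H, (∀ x y, inner ℝ (P x) y = inner ℝ x (P y)) ∧ (∀ x, 0 ≤ inner ℝ (P x) x) ∧
      ‖1 - P‖ ≤ 1 ∧ P * P = 1 - X ∧ ∀ C : H →L[ℝ] H, C * X = X * C → C * P = P * C := by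
  let Y : ℕ → (H →L[ℝ] H) := fun n => Nat.rec 0 (fun _ Z => (2⁻¹ : ℝ) • (X + Z * Z)) n
  let y : ℕ → ℝ := fun n => Nat.rec 0 (fun _ z => 2⁻¹ * (1 + z * z)) n
  have hY0 : Y 0 = 0 := rfl
  have hY : ∀ n, Y (n + 1) = (2⁻¹ : ℝ) • (X + Y n * Y n) := fun n => rfl
  have hy0 : y 0 = 0 := rfl
  have hy : ∀ n, y (n + 1) = 2⁻¹ * (1 + y n * y n) := fun n => rfl
  have hy1 : ∀ n, 0 ≤ y n ∧ y n ≤ 1 := by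
    intro n
    induction n with
    | zero => simp [hy0]
    | succ k ih =>
      rw [hy]
      constructor <;> nlinarith [ih.1, ih.2]
  have hn : ∀ n, ‖Y n‖ ≤ y n := by
    intro n
    induction n with
    | zero => simp [hY0, hy0]
    | succ k ih =>
      rw [hY, hy, norm_smul, Real.norm_of_nonneg (by norm_num : (0:ℝ) ≤ 2⁻¹)]
      gcongr
      have h0 := (hy1 k).1
      refine (norm_add_le _ _).trans (add_le_add hX ((norm_mul_le _ _).trans ?_))
      gcongr
  have hd : ∀ n, ‖Y (n + 1) - Y n‖ ≤ y (n + 1) - y n := by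
    intro n
    induction n with
    | zero =>
      rw [hY, hy, hY0, hy0]
      simp only [mul_zero, add_zero, sub_zero, mul_one, norm_smul]
      norm_num
      linarith
    | succ k ih =>
      have e1 : Y (k + 1 + 1) - Y (k + 1) = (2⁻¹ : ℝ) •
          (Y (k + 1) * (Y (k + 1) - Y k) + (Y (k + 1) - Y k) * Y k) := by
        rw [hY (k + 1)]
        conv_lhs => rw [hY k]
        rw [← smul_sub]
        congr 1
        rw [← hY k]
        noncomm_ring
      have e2 : y (k + 1 + 1) - y (k + 1) = 2⁻¹ *
          (y (k + 1) * (y (k + 1) - y k) + (y (k + 1) - y k) * y k) := by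
        rw [hy (k + 1)]
        conv_lhs => rw [hy k]
        rw [← hy k]
        rw [hy k]; ring
      rw [e1, e2, norm_smul, Real.norm_of_nonneg (by norm_num : (0:ℝ) ≤ 2⁻¹)]
      have h1 := hn k
      have h2 := hn (k + 1)
      have h3 := (hy1 k).1
      have h4 := (hy1 (k + 1)).1
      have h5 : 0 ≤ y (k + 1) - y k := (norm_nonneg _).trans ih
      gcongr
      refine (norm_add_le _ _).trans (add_le_add ((norm_mul_le _ _).trans ?_)
        ((norm_mul_le _ _).trans ?_)) <;> gcongr
  have hsum : Summable fun n => y (n + 1) - y n := by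
    refine summable_of_sum_range_le (c := 1) (fun n => (norm_nonneg _).trans (hd n)) fun n => ?_
    rw [Finset.sum_range_sub, hy0, sub_zero]
    exact (hy1 n).2
  have hc : CauchySeq Y := by
    refine cauchySeq_of_dist_le_of_summable _ (fun n => ?_) hsum
    rw [dist_comm, dist_eq_norm]
    exact hd n
  obtain ⟨Z, hZ⟩ := cauchySeq_tendsto_of_complete hc
  have hZn : ‖Z‖ ≤ 1 :=
    le_of_tendsto hZ.norm (Eventually.of_forall fun n => (hn n).trans (hy1 n).2)
  have hZe : Z = (2⁻¹ : ℝ) • (X + Z * Z) :=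
    tendsto_nhds_unique (hZ.comp (tendsto_add_atTop_nat 1))
      ((tendsto_const_nhds.add (hZ.mul hZ)).const_smul (2⁻¹ : ℝ))
  have hap : ∀ x, Tendsto (fun n => Y n x) atTop (nhds (Z x)) := fun x =>
    ((ContinuousLinearMap.apply ℝ H x).continuous.tendsto Z).comp hZ
  have hYs : ∀ n x w, inner ℝ (Y n x) w = inner ℝ x (Y n w) := by
    intro n
    induction n with
    | zero => intro x w; simp [hY0]
    | succ k ih =>
      intro x w
      rw [hY]
      simp only [smul_apply, add_apply,
        mul_apply_eq_comp, inner_smul_left, inner_smul_right, inner_add_left,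
        inner_add_right, hs, ih]
      simp
  have hZs : ∀ x w, inner ℝ (Z x) w = inner ℝ x (Z w) := fun x w =>
    tendsto_nhds_unique ((hap x).inner tendsto_const_nhds)
      ((tendsto_const_nhds.inner (hap w)).congr fun n => (hYs n x w).symm)
  have h2 : X + Z * Z = (2 : ℝ) • Z := by
    conv_rhs => rw [hZe]
    rw [smul_smul]; norm_num
  refine ⟨1 - Z, fun x w => ?_, fun x => ?_, ?_, ?_, fun C hC => ?_⟩
  · simp only [sub_apply, one_apply_eq_self, inner_sub_left,
      inner_sub_right, hZs]
  · simp only [sub_apply, one_apply_eq_self, inner_sub_left]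
    have h3 := real_inner_le_norm (Z x) x
    have h4 := Z.le_opNorm x
    rw [real_inner_self_eq_norm_sq]
    nlinarith [norm_nonneg x]
  · simpa using hZn
  · have : (1 - Z) * (1 - Z) = 1 - (2 : ℝ) • Z + Z * Z := by
      rw [two_smul]; noncomm_ring
    rw [this, ← h2]; abel
  · have hCY : ∀ n, C * Y n = Y n * C := by
      intro n
      induction n with
      | zero => simp [hY0]
      | succ k ih =>
        rw [hY, mul_smul_comm, smul_mul_assoc, mul_add, add_mul, hC, ← mul_assoc, ih, mul_assoc,
          ih, mul_assoc]
    have : C * Z = Z * C :=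
      tendsto_nhds_unique (hZ.const_mul C) ((hZ.mul_const C).congr fun n => (hCY n).symm)
    rw [mul_sub, sub_mul, this, mul_one, one_mul]

/-- A nonnegative selfadjoint operator `B` has a nonnegative selfadjoint square root: with
`R = (I + B)⁻¹`, `P = R^{1/2}` and `Q = (I - R)^{1/2}` it is the operator with the
graph `{(P u, Q u)}`. Thus `posSqrt` never takes its default value here. -/
theorem exists_isPosSqrt {B : H →ₗ.[ℝ] H} (hB : IsSelfAdjoint B)
    (hpos : ∀ x ∈ B.domain, 0 ≤ inner ℝ (ev B x) x) : ∃ S : H →ₗ.[ℝ] H, IsPosSqrt B S := by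
  -- `X = B (I + B)⁻¹` and `R = I - X = (I + B)⁻¹`
  obtain ⟨X, hXB⟩ := exists_clm_ev_eq hB hpos le_rfl (M := 1) fun x hx => by
    rw [one_mul]; exact (norm_le_norm_add_of_inner_nonneg (hpos x hx)).2
  set R : H →L[ℝ] H := 1 - X with hRdef
  have hRB : ∀ x ∈ B.domain, R (x + ev B x) = x := fun x hx => by
    simp [hRdef, hXB x hx, -map_add]
  have hrep := exists_add_ev_eq hB hpos
  have hXn : ‖X‖ ≤ 1 := by
    refine X.opNorm_le_bound zero_le_one fun z => ?_
    obtain ⟨x, hx, rfl⟩ := hrep z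
    rw [hXB x hx, one_mul]; exact (norm_le_norm_add_of_inner_nonneg (hpos x hx)).2
  have hRn : ‖R‖ ≤ 1 := by
    refine R.opNorm_le_bound zero_le_one fun z => ?_
    obtain ⟨x, hx, rfl⟩ := hrep z
    rw [hRB x hx, one_mul]; exact (norm_le_norm_add_of_inner_nonneg (hpos x hx)).1
  have hXs : ∀ x y, inner ℝ (X x) y = inner ℝ x (X y) := fun z w => by
    obtain ⟨x, hx, rfl⟩ := hrep z
    obtain ⟨y, hy, rfl⟩ := hrep w
    rw [hXB x hx, hXB y hy, inner_add_left, inner_add_right, inner_ev_symm hB hx hy]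
  have hRs : ∀ x y, inner ℝ (R x) y = inner ℝ x (R y) := fun z w => by
    simp [hRdef, inner_sub_left, inner_sub_right, hXs]
  obtain ⟨P, hPs, hP0, -, hPP, hPc⟩ := exists_sqrt_one_sub X hXn hXs
  obtain ⟨Q, hQs, -, hQn, hQQ, hQc⟩ := exists_sqrt_one_sub R hRn hRs
  have hPX : P * X = X * P := (hPc X rfl).symm
  have hPQ : P * Q = Q * P := hQc P (by rw [hRdef, mul_sub, sub_mul, hPX, mul_one, one_mul])
  -- a square root `Z` of `Q` that commutes with `P`: then `(Q u, P u) = (P (Z u), Z u) ≥ 0`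
  obtain ⟨Z, hZs, -, -, hZZ, hZc⟩ := exists_sqrt_one_sub (1 - Q) hQn
    (fun x y => by simp [inner_sub_left, inner_sub_right, hQs])
  have hPZ : P * Z = Z * P := hZc P (by rw [mul_sub, sub_mul, hPQ, mul_one, one_mul])
  have hQQ' : Q * Q = X := by rw [hQQ, hRdef]; abel
  have hZZ' : Z * Z = Q := by rw [hZZ]; abel
  have aPP : ∀ x, P (P x) = R x := fun x => by
    rw [← mul_apply_eq_comp, hPP]
  have aQQ : ∀ x, Q (Q x) = X x := fun x => by rw [← mul_apply_eq_comp, hQQ']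
  have aPQ : ∀ x, P (Q x) = Q (P x) := fun x => by
    rw [← mul_apply_eq_comp, hPQ, mul_apply_eq_comp]
  have aZZ : ∀ x, Z (Z x) = Q x := fun x => by rw [← mul_apply_eq_comp, hZZ']
  have aPZ : ∀ x, P (Z x) = Z (P x) := fun x => by
    rw [← mul_apply_eq_comp, hPZ, mul_apply_eq_comp]
  have aRX : ∀ x, R x + X x = x := fun x => by simp [hRdef]
  -- hence `P` is injective, and the graph below is single-valued
  have hRinj : ∀ z, R z = 0 → z = 0 := fun z hz => by
    obtain ⟨x, hx, rfl⟩ := hrep z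
    rw [hRB x hx] at hz
    subst hz
    have : ev B 0 = 0 := by simpa using ev_smul (A := B) 0 B.domain.zero_mem
    rw [this, add_zero]
  let g : Submodule ℝ (H × H) := (P.prod Q : H →L[ℝ] H × H).range
  have hg : ∀ x y, (x, y) ∈ g ↔ ∃ u, P u = x ∧ Q u = y := fun x y => by
    simp [g, Prod.ext_iff]
  let S : H →ₗ.[ℝ] H := g.toLinearPMap
  have hSg : S.graph = g := by
    refine Submodule.toLinearPMap_graph_eq g ?_
    rintro ⟨x, y⟩ hxy h0
    simp only at h0 ⊢
    subst h0
    obtain ⟨u, hu, rfl⟩ := (hg _ _).1 hxy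
    rw [hRinj u (by rw [← aPP, hu, map_zero]), map_zero]
  -- a pair formally adjoint to all of `{(P u, Q u)}` belongs to it
  have key : ∀ y z, Q y = P z → P (P y + Q z) = y ∧ Q (P y + Q z) = z := fun y z h => by
    constructor
    · rw [map_add, aPP, aPQ, ← h, aQQ, aRX]
    · rw [map_add, aQQ, ← aPQ, h, aPP, aRX]
  have hdom : ∀ u, P u ∈ S.domain := fun u =>
    (mem_graph_iff_ev.1 (hSg ▸ (hg _ _).2 ⟨u, rfl, rfl⟩ : (P u, Q u) ∈ S.graph)).1
  have hdense : Dense (S.domain : Set H) := by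
    refine hB.dense_domain.mono fun x hx => ?_
    have := hdom (P (x + ev B x))
    rwa [aPP, hRB x hx] at this
  refine ⟨S, ?_, ?_, ?_⟩
  · rw [LinearPMap.isSelfAdjoint_def]
    apply LinearPMap.eq_of_eq_graph
    rw [LinearPMap.adjoint_graph_eq_graph_adjoint hdense, hSg]
    ext ⟨y, z⟩
    rw [Submodule.mem_adjoint_iff, hg]
    constructor
    · intro h
      refine ⟨P y + Q z, key y z ?_⟩
      refine ext_inner_left ℝ fun u => ?_
      have := h (P u) (Q u) ((hg _ _).2 ⟨u, rfl, rfl⟩)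
      rw [← hQs, ← hPs]
      exact sub_eq_zero.1 this
    · rintro ⟨u, rfl, rfl⟩ a b hab
      obtain ⟨w, rfl, rfl⟩ := (hg _ _).1 hab
      rw [sub_eq_zero, hQs, hPs, aPQ]
  · intro x
    have hx : ((x : H), S x) ∈ S.graph := S.mem_graph x
    rw [hSg] at hx
    obtain ⟨u, h1, h2⟩ := (hg _ _).1 hx
    rw [← h1, ← h2, ← aZZ, hZs, ← aPZ, real_inner_comm]
    exact hP0 _
  · intro x y
    rw [hSg]
    simp only [hg]
    constructor
    · intro h
      obtain ⟨hx, rfl⟩ := mem_graph_iff_ev.1 h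
      refine ⟨Q (P (x + ev B x)), ⟨P (x + ev B x), ?_, rfl⟩, ⟨Q (x + ev B x), ?_, ?_⟩⟩
      · rw [aPP, hRB x hx]
      · rw [aPQ]
      · rw [aQQ, hXB x hx]
    · rintro ⟨u, ⟨a, rfl, rfl⟩, ⟨b, hb, rfl⟩⟩
      obtain ⟨h1, h2⟩ := key a b hb.symm
      obtain ⟨w, hw, hwe⟩ := hrep (P a + Q b)
      have h3 : P a = w := by rw [← hRB w hw, hwe, ← aPP, h1]
      have h4 : Q b = ev B w := by rw [← hXB w hw, hwe, ← aQQ, h2]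
      rw [h3, h4]
      exact ev_mem_graph hw

theorem isPosSqrt_posSqrt {B : H →ₗ.[ℝ] H} (hB : IsSelfAdjoint B)
    (hpos : ∀ x ∈ B.domain, 0 ≤ inner ℝ (ev B x) x) : IsPosSqrt B (posSqrt B) := by
  have h := exists_isPosSqrt hB hpos
  rw [posSqrt, dif_pos h]
  exact h.choose_spec

/-- `D(B) ⊂ D(B^{1/2})` and `‖B^{1/2} x‖² = (B x, x)` on `D(B)`. -/
theorem norm_ev_posSqrt_sq {B : H →ₗ.[ℝ] H} (hB : IsSelfAdjoint B)
    (hpos : ∀ x ∈ B.domain, 0 ≤ inner ℝ (ev B x) x) {x : H} (hx : x ∈ B.domain) :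
    x ∈ (posSqrt B).domain ∧ ‖ev (posSqrt B) x‖ ^ 2 = inner ℝ (ev B x) x := by
  obtain ⟨h1, -, h3⟩ := isPosSqrt_posSqrt hB hpos
  obtain ⟨u, hu, hu'⟩ := (h3 x (ev B x)).1 (ev_mem_graph hx)
  obtain ⟨hxS, rfl⟩ := mem_graph_iff_ev.1 hu
  refine ⟨hxS, ?_⟩
  obtain ⟨hyS, h4⟩ := mem_graph_iff_ev.1 hu'
  rw [← h4, inner_ev_symm h1 hyS hxS, real_inner_self_eq_norm_sq]

/-- `B^{1/2} (I + B)⁻¹` is a bounded operator. -/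
theorem exists_clm_ev_posSqrt {B : H →ₗ.[ℝ] H} (hB : IsSelfAdjoint B)
    (hpos : ∀ x ∈ B.domain, 0 ≤ inner ℝ (ev B x) x) :
    ∃ T : H →L[ℝ] H, ∀ x ∈ B.domain, T (x + ev B x) = ev (posSqrt B) x := by
  refine exists_clm_ev_eq hB hpos (fun x hx => (norm_ev_posSqrt_sq hB hpos hx).1) (M := 1)
    fun x hx => ?_
  rw [one_mul]
  have h1 := (norm_ev_posSqrt_sq hB hpos hx).2
  obtain ⟨h2, h3⟩ := norm_le_norm_add_of_inner_nonneg (hpos x hx)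
  have h4 := real_inner_le_norm (ev B x) x
  refine abs_le_of_sq_le_sq' ?_ (norm_nonneg _) |>.2
  rw [h1]
  refine h4.trans ?_
  rw [sq]
  gcongr

/-- A bounded symmetric operator, regarded as an operator with domain `H`. -/
theorem isSelfAdjoint_toPMap_top {L : H →L[ℝ] H}
    (hL : ∀ x y, inner ℝ (L x) y = inner ℝ x (L y)) :
    IsSelfAdjoint ((L : H →ₗ[ℝ] H).toPMap ⊤) := by
  have h1 : L.adjoint = L := by
    refine ContinuousLinearMap.ext fun x => ext_inner_right ℝ fun y => ?_
    rw [ContinuousLinearMap.adjoint_inner_left, hL]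
  rw [LinearPMap.isSelfAdjoint_def,
    ContinuousLinearMap.toPMap_adjoint_eq_adjoint_toPMap_of_dense _ (by simp), h1]

end SelfAdjoint

/-! ### Distributional derivatives and primitives -/

section WeakDerivative

variable {X : Type*} [NormedAddCommGroup X]

theorem InLp.integrableOn {T : ℝ} {p : ℝ≥0∞} (hp : 1 ≤ p) {f : ℝ → X} (hf : InLp T p f) :
    IntegrableOn f (Ioo 0 T) :=
  MemLp.integrable hp hf

theorem eqOn_Icc_of_ae_eq {Y : Type*} [TopologicalSpace Y] [T2Space Y] {T : ℝ} (hT : 0 < T)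
    {f g : ℝ → Y} (hf : ContinuousOn f (Icc 0 T)) (hg : ContinuousOn g (Icc 0 T))
    (h : f =ᵐ[volume.restrict (Ioo 0 T)] g) : EqOn f g (Icc 0 T) := by
  refine Measure.eqOn_of_ae_eq (μ := volume) ?_ hf hg ?_
  · rwa [← Measure.restrict_congr_set Ioo_ae_eq_Icc]
  · rw [interior_Icc, closure_Ioo hT.ne]

/-- The initial value in the sense of continuous representatives is the constant of integration. -/
theorem HasInitialValue.eq_of_ae_eq {T : ℝ} (hT : 0 < T) {f F : ℝ → X}
    {x : X} (h : HasInitialValue T f x) (hF : ContinuousOn F (Icc 0 T))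
    (hfF : f =ᵐ[volume.restrict (Ioo 0 T)] F) : F 0 = x := by
  obtain ⟨G, hG, hGf, rfl⟩ := h
  exact (eqOn_Icc_of_ae_eq hT hG hF (hGf.trans hfF) ⟨le_rfl, hT.le⟩).symm

variable [NormedSpace ℝ X]

/-- The primitive of an integrable function has this function as its distributional derivative:
interchange the integrations over `{s ≤ t}`. -/
theorem integral_deriv_smul_primitive [CompleteSpace X] {T : ℝ} {g : ℝ → X}
    (hg : IntegrableOn g (Ioo 0 T)) {ψ : ℝ → ℝ} (hψ : ContDiff ℝ ∞ ψ) (hc : HasCompactSupport ψ)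
    (hs : tsupport ψ ⊆ Ioo 0 T) :
    ∫ t in Ioo 0 T, deriv ψ t • (∫ s in (0 : ℝ)..t, g s) = - ∫ t in Ioo 0 T, ψ t • g t := by
  have hdc : Continuous (deriv ψ) := hψ.continuous_deriv (by simp)
  have hdi : IntegrableOn (deriv ψ) (Ioo 0 T) :=
    (hdc.integrable_of_hasCompactSupport hc.deriv).integrableOn
  have hψT : ψ T = 0 := by
    by_contra h
    exact (lt_irrefl T) (hs (subset_tsupport ψ h)).2
  have h1 : ∀ t ∈ Ioo 0 T, deriv ψ t • (∫ s in (0 : ℝ)..t, g s) =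
      ∫ s in Ioo 0 T, {p : ℝ × ℝ | p.2 ≤ p.1}.indicator (fun p => deriv ψ p.1 • g p.2) (t, s) := by
    intro t ht
    have : (fun s => {p : ℝ × ℝ | p.2 ≤ p.1}.indicator (fun p => deriv ψ p.1 • g p.2) (t, s)) =
        (Iic t).indicator fun s => deriv ψ t • g s := by
      ext s; simp [indicator]
    rw [this, setIntegral_indicator measurableSet_Iic, integral_smul,
      intervalIntegral.integral_of_le ht.1.le]
    congr 3
    ext s
    simp only [mem_Ioc, mem_inter_iff, mem_Ioo, mem_Iic]
    constructor
    · rintro ⟨a, b⟩; exact ⟨⟨a, b.trans_lt ht.2⟩, b⟩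
    · rintro ⟨a, b⟩; exact ⟨a.1, b⟩
  have h2 : ∀ s ∈ Ioo 0 T,
      ∫ t in Ioo 0 T, {p : ℝ × ℝ | p.2 ≤ p.1}.indicator (fun p => deriv ψ p.1 • g p.2) (t, s)
        = -(ψ s • g s) := by
    intro s hs'
    have : (fun t => {p : ℝ × ℝ | p.2 ≤ p.1}.indicator (fun p => deriv ψ p.1 • g p.2) (t, s)) =
        (Ici s).indicator fun t => deriv ψ t • g s := by
      ext s; simp [indicator]
    rw [this, setIntegral_indicator measurableSet_Ici, integral_smul_const]
    have e : Ioo 0 T ∩ Ici s = Ico s T := by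
      ext t
      simp only [mem_Ico, mem_inter_iff, mem_Ioo, mem_Ici]
      constructor
      · rintro ⟨a, b⟩; exact ⟨b, a.2⟩
      · rintro ⟨a, b⟩; exact ⟨⟨hs'.1.trans_le a, b⟩, a⟩
    rw [e, integral_Ico_eq_integral_Ioc, ← intervalIntegral.integral_of_le hs'.2.le,
      intervalIntegral.integral_deriv_eq_sub
        (fun x _ => (hψ.differentiable (by simp)).differentiableAt) (hdc.intervalIntegrable _ _),
      hψT, zero_sub, neg_smul]
  rw [setIntegral_congr_fun measurableSet_Ioo h1, integral_integral_swap,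
    setIntegral_congr_fun measurableSet_Ioo h2, integral_neg]
  refine Integrable.indicator ?_ (measurableSet_le measurable_snd measurable_fst)
  exact Integrable.smul_prod hdi hg

/-- A function on an interval whose distributional derivative vanishes is constant (lemma of
du Bois-Reymond). -/
theorem ae_eq_const_of_integral_deriv_smul_eq_zero [CompleteSpace X] {T : ℝ} (hT : 0 < T)
    {f : ℝ → X} (hf : IntegrableOn f (Ioo 0 T))
    (h : ∀ ψ : ℝ → ℝ, ContDiff ℝ ∞ ψ → HasCompactSupport ψ → tsupport ψ ⊆ Ioo 0 T →
      ∫ t in Ioo 0 T, deriv ψ t • f t = 0) :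
    ∃ c : X, ∀ᵐ t ∂volume.restrict (Ioo 0 T), f t = c := by
  let b : ContDiffBump (T / 2) := ⟨T / 8, T / 4, by positivity, by linarith⟩
  set ψ₀ : ℝ → ℝ := b.normed volume with hψ₀
  have hψ₀s : ContDiff ℝ ∞ ψ₀ := b.contDiff_normed
  have hψ₀c : HasCompactSupport ψ₀ := b.hasCompactSupport_normed
  have hψ₀t : tsupport ψ₀ ⊆ Ioo 0 T := by
    rw [hψ₀, b.tsupport_normed_eq, Real.closedBall_eq_Icc]
    refine Icc_subset_Ioo ?_ ?_ <;> simp only [b] <;> linarith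
  have hψ₀i : ∫ t, ψ₀ t = 1 := b.integral_normed
  have hint : ∀ χ : ℝ → ℝ, ContDiff ℝ ∞ χ → HasCompactSupport χ →
      IntegrableOn (fun t => χ t • f t) (Ioo 0 T) := by
    intro χ h1 h2
    obtain ⟨C, hC⟩ := h2.exists_bound_of_continuous h1.continuous
    exact Integrable.bdd_smul hf C h1.continuous.aestronglyMeasurable
      (Eventually.of_forall hC)
  set c : X := ∫ t in Ioo 0 T, ψ₀ t • f t with hcdef
  refine ⟨c, ?_⟩
  have hloc : LocallyIntegrableOn (fun t => f t - c) (Ioo 0 T) := by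
    refine IntegrableOn.locallyIntegrableOn ?_
    exact Integrable.sub hf (integrableOn_const (by simp))
  have key : ∀ χ : ℝ → ℝ, ContDiff ℝ ∞ χ → HasCompactSupport χ → tsupport χ ⊆ Ioo 0 T →
      ∫ t, χ t • (f t - c) = 0 := by
    intro χ h1 h2 h3
    set κ : ℝ := ∫ t, χ t with hκ
    -- `χ` minus the multiple of the bump function that has the same integral
    let ρ : ℝ → ℝ := fun t => χ t - κ * ψ₀ t
    have hρs : ContDiff ℝ ∞ ρ := h1.sub (contDiff_const.mul hψ₀s)
    have hχi : Integrable χ := h1.continuous.integrable_of_hasCompactSupport h2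
    have hψi : Integrable ψ₀ := hψ₀s.continuous.integrable_of_hasCompactSupport hψ₀c
    have hρi : Integrable ρ := hχi.sub (hψi.const_mul κ)
    have hρ0 : ∫ t, ρ t = 0 := by
      simp only [ρ]
      rw [integral_sub hχi (hψi.const_mul κ), integral_const_mul, hψ₀i]; simp [hκ]
    -- the primitive of `ρ` is a test function
    let ψ : ℝ → ℝ := fun t => ∫ s in (0 : ℝ)..t, ρ s
    have hψd : ∀ t, HasDerivAt ψ (ρ t) t := fun t =>
      intervalIntegral.integral_hasDerivAt_right (hρs.continuous.intervalIntegrable _ _)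
        hρs.continuous.stronglyMeasurable.stronglyMeasurableAtFilter hρs.continuous.continuousAt
    have hψd' : deriv ψ = ρ := funext fun t => (hψd t).deriv
    have hψs : ContDiff ℝ ∞ ψ := by
      rw [contDiff_infty_iff_deriv, hψd']
      exact ⟨fun t => (hψd t).differentiableAt, hρs⟩
    let K := tsupport χ ∪ tsupport ψ₀
    have hK : IsCompact K := h2.isCompact.union hψ₀c.isCompact
    have hKne : K.Nonempty := by
      refine ⟨T / 2, Or.inr (subset_tsupport _ ?_)⟩
      rw [hψ₀, b.support_normed_eq]
      exact Metric.mem_ball_self b.rOut_pos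
    have hKI : K ⊆ Ioo 0 T := union_subset h3 hψ₀t
    have ha := hKI (hK.sInf_mem hKne)
    have hb := hKI (hK.sSup_mem hKne)
    have hρz : ∀ t, t ∉ Icc (sInf K) (sSup K) → ρ t = 0 := by
      intro t ht
      have htK : t ∉ K := fun h => ht ⟨csInf_le hK.bddBelow h, le_csSup hK.bddAbove h⟩
      have e1 : χ t = 0 := image_eq_zero_of_notMem_tsupport fun h => htK (Or.inl h)
      have e2 : ψ₀ t = 0 := image_eq_zero_of_notMem_tsupport fun h => htK (Or.inr h)
      simp [ρ, e1, e2]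
    have hψz : ∀ t, t ∉ Icc (sInf K) (sSup K) → ψ t = 0 := by
      intro t ht
      rw [mem_Icc, not_and_or, not_le, not_le] at ht
      rcases ht with ht | ht
      · have : ψ t = ∫ s in (0 : ℝ)..t, (0 : ℝ) := by
          refine intervalIntegral.integral_congr fun s hs => hρz s fun h' => ?_
          have : s ≤ max 0 t := hs.2
          have := max_lt ha.1 ht
          linarith [h'.1]
        simpa using this
      · have h0t : 0 ≤ t := (hb.1.trans ht).le
        have : ψ t = ∫ s, ρ s := by
          simp only [ψ]
          rw [intervalIntegral.integral_of_le h0t]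
          refine setIntegral_eq_integral_of_forall_compl_eq_zero fun s hs => hρz s fun h' => hs ?_
          exact ⟨ha.1.trans_le h'.1, h'.2.trans ht.le⟩
        rw [this, hρ0]
    have hψt : tsupport ψ ⊆ Icc (sInf K) (sSup K) :=
      closure_minimal (fun t ht => by_contra fun h' => ht (hψz t h')) isClosed_Icc
    have h4 := h ψ hψs (HasCompactSupport.intro isCompact_Icc hψz)
      (hψt.trans (Icc_subset_Ioo ha.1 hb.2))
    have h5 : ∫ t in Ioo 0 T, χ t = κ := setIntegral_eq_integral_of_forall_compl_eq_zero
      fun t ht => image_eq_zero_of_notMem_tsupport fun h' => ht (h3 h')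
    have h6 : ∫ t, χ t • (f t - c) = ∫ t in Ioo 0 T, χ t • (f t - c) := by
      symm
      refine setIntegral_eq_integral_of_forall_compl_eq_zero fun t ht => ?_
      rw [image_eq_zero_of_notMem_tsupport fun h' => ht (h3 h'), zero_smul]
    rw [h6]
    simp only [smul_sub]
    rw [integral_sub (hint χ h1 h2) (hχi.integrableOn.smul_const c), integral_smul_const, h5]
    rw [hψd'] at h4
    simp only [ρ, sub_smul, mul_smul] at h4
    rwa [integral_sub (hint χ h1 h2) (by exact (hint ψ₀ hψ₀s hψ₀c).smul κ), integral_smul] at h4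
  have := isOpen_Ioo.ae_eq_zero_of_integral_contDiff_smul_eq_zero hloc key
  rw [ae_restrict_iff' measurableSet_Ioo]
  filter_upwards [this] with t ht hm
  exact sub_eq_zero.1 (ht hm)

/-- A function in `W^{1,p}(0, T; X)` is the primitive of its derivative. -/
theorem InW1p.exists_ae_eq_primitive [CompleteSpace X] {T : ℝ} (hT : 0 < T) {p : ℝ≥0∞}
    (hp : 1 ≤ p) {f g : ℝ → X} (h : InW1p T p f g) :
    ∃ x : X, ∀ᵐ t ∂volume.restrict (Ioo 0 T), f t = x + ∫ s in (0 : ℝ)..t, g s := by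
  obtain ⟨hf, hg, hw⟩ := h
  have hfi := hf.integrableOn hp
  have hgi := hg.integrableOn hp
  have hgc : ContinuousOn (fun t => ∫ s in (0 : ℝ)..t, g s) (Icc 0 T) :=
    intervalIntegral.continuousOn_primitive_interval
      (by rw [uIcc_of_le hT.le, integrableOn_Icc_iff_integrableOn_Ioo]; exact hgi) |>.mono
      (by rw [uIcc_of_le hT.le])
  have hGi : IntegrableOn (fun t => ∫ s in (0 : ℝ)..t, g s) (Ioo 0 T) :=
    (hgc.integrableOn_Icc).mono_set Ioo_subset_Icc_self
  obtain ⟨c, hc⟩ := ae_eq_const_of_integral_deriv_smul_eq_zero hT (hfi.sub hGi)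
    (fun ψ h1 h2 h3 => by
      obtain ⟨C, hC⟩ := h2.deriv.exists_bound_of_continuous (h1.continuous_deriv (by simp))
      have hm : AEStronglyMeasurable (deriv ψ) (volume.restrict (Ioo 0 T)) :=
        (h1.continuous_deriv (by simp)).aestronglyMeasurable
      simp only [Pi.sub_apply, smul_sub]
      rw [integral_sub (by exact Integrable.bdd_smul hfi C hm (Eventually.of_forall hC))
        (by exact Integrable.bdd_smul hGi C hm (Eventually.of_forall hC)), hw ψ h1 h2 h3,
        integral_deriv_smul_primitive hgi h1 h2 h3, sub_self])
  refine ⟨c, ?_⟩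
  filter_upwards [hc] with t ht
  rw [← ht]; simp

theorem continuousOn_primitive {T : ℝ} (hT : 0 < T) {g : ℝ → X}
    (hg : IntegrableOn g (Ioo 0 T)) (x : X) :
    ContinuousOn (fun t => x + ∫ s in (0 : ℝ)..t, g s) (Icc 0 T) :=
  continuousOn_const.add <| intervalIntegral.continuousOn_primitive_interval
      (by rw [uIcc_of_le hT.le, integrableOn_Icc_iff_integrableOn_Ioo]; exact hg) |>.mono
      (by rw [uIcc_of_le hT.le])

end WeakDerivative

/-! ### Increments of quadratic forms, discrete Gronwall inequality -/

section Increments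

variable {E : Type*} [NormedAddCommGroup E]

/-- One implicit step with a perturbed test direction: for a nonnegative symmetric form the
numerical dissipation `b(x' - x, x' - x) / 2` absorbs the perturbation `s` up to `b(s, s) / 2`. -/
theorem form_increment [NormedSpace ℝ E] (b : E →L[ℝ] StrongDual ℝ E) (hb : ∀ x, 0 ≤ b x x)
    (hs : ∀ x y, b x y = b y x) (x x' s : E) :
    2⁻¹ * b x' x' - 2⁻¹ * b x x - 2⁻¹ * b s s ≤ b (x' + s) (x' - x) := by
  have h := hb (x' - x + s)
  simp only [map_add, map_sub, add_apply, sub_apply] at h ⊢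
  have h1 := hs x x'
  have h2 := hs x s
  have h3 := hs x' s
  linarith

theorem inner_increment [InnerProductSpace ℝ E] (L : E →L[ℝ] E) (hL : ∀ x, 0 ≤ inner ℝ (L x) x)
    (hs : ∀ x y, inner ℝ (L x) y = inner ℝ x (L y)) (x x' s : E) :
    2⁻¹ * inner ℝ (L x') x' - 2⁻¹ * inner ℝ (L x) x - 2⁻¹ * inner ℝ (L s) s
      ≤ inner ℝ (L (x' - x)) (x' + s) := by
  have h := hL (x' - x + s)
  simp only [map_add, map_sub, inner_add_left, inner_sub_left, inner_add_right,
    inner_sub_right] at h ⊢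
  have h1 : inner ℝ (L x) x' = inner ℝ (L x') x := by rw [hs, real_inner_comm]
  have h2 : inner ℝ (L x) s = inner ℝ (L s) x := by rw [hs, real_inner_comm]
  have h3 : inner ℝ (L x') s = inner ℝ (L s) x' := by rw [hs, real_inner_comm]
  linarith

/-- Discrete Gronwall inequality for an implicit scheme. -/
theorem discrete_gronwall {E D ρ : ℕ → ℝ} {a : ℝ} (ha : 0 ≤ a) (ha' : a ≤ 1 / 2) {N : ℕ}
    (hE : ∀ n, 0 ≤ E n) (hD : ∀ n < N, 0 ≤ D n) (hρ : ∀ n < N, 0 ≤ ρ n)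
    (h : ∀ n < N, E (n + 1) + D n ≤ E n + a * E (n + 1) + ρ n) (n : ℕ) (hn : n ≤ N) :
    E n + ∑ k ∈ Finset.range n, D k ≤
      Real.exp (2 * a * n) * (E 0 + ∑ k ∈ Finset.range n, ρ k) := by
  induction n with
  | zero => simp
  | succ k ih =>
    have hk : k < N := hn
    have ih := ih hk.le
    have hS : 0 ≤ ∑ j ∈ Finset.range k, D j :=
      Finset.sum_nonneg fun j hj => hD j ((Finset.mem_range.1 hj).trans hk)
    have h1 := h k hk
    have h2 := hE (k + 1)
    have h3 := hE k
    have h4 := hD k hk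
    have h5 := hρ k hk
    -- `(1 + 2 a) (1 - a) ≥ 1` since `0 ≤ a ≤ 1 / 2`
    have h6 : E (k + 1) + D k ≤ (1 + 2 * a) * (E k + ρ k) := by
      have : (1 + 2 * a) * ((1 - a) * E (k + 1) + D k) ≤ (1 + 2 * a) * (E k + ρ k) := by
        exact mul_le_mul_of_nonneg_left (by linarith) (by linarith)
      nlinarith [mul_nonneg ha h4, mul_nonneg (mul_nonneg ha (by linarith : 0 ≤ 1 - 2 * a)) h2]
    have h7 : E (k + 1) + ∑ j ∈ Finset.range (k + 1), D j ≤
        (1 + 2 * a) * (E k + ∑ j ∈ Finset.range k, D j + ρ k) := by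
      rw [Finset.sum_range_succ]
      nlinarith [mul_nonneg ha hS]
    have h8 : 1 + 2 * a ≤ Real.exp (2 * a) := by linarith [Real.add_one_le_exp (2 * a)]
    have h9 : 1 ≤ Real.exp (2 * a * k) := Real.one_le_exp (by positivity)
    calc _ ≤ (1 + 2 * a) * (E k + ∑ j ∈ Finset.range k, D j + ρ k) := h7
      _ ≤ Real.exp (2 * a) * (Real.exp (2 * a * k) * (E 0 + ∑ j ∈ Finset.range k, ρ j)
          + Real.exp (2 * a * k) * ρ k) := by
        refine mul_le_mul h8 (add_le_add ih ?_) (by positivity) (Real.exp_pos _).le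
        nlinarith
      _ = _ := by
        rw [Finset.sum_range_succ, ← mul_add, ← mul_assoc, ← Real.exp_add]
        push_cast
        ring_nf

end Increments

/-! ### The energy balance of one step -/

section Stability

variable {V H : Type*} [NormedAddCommGroup V] [InnerProductSpace ℝ V]
  [NormedAddCommGroup H] [InnerProductSpace ℝ H] [CompleteSpace H]

/-- The energy of a state with velocity `y`, displacement `e` and temperature `τ`. The weight `η⁻¹`
makes the coupling terms cancel; the squared norms in `H` are added because `A₂` is coercive only up
to such a term, and to control `τ` and not only `B₂ τ`. -/
noncomputable def energy (D : Data V H) (y : H) (e τ : V) : ℝ :=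
  2⁻¹ * (inner ℝ (D.L y) y + D.A₂s e e + D.η⁻¹ * D.B₂s τ τ + ‖D.emb τ‖ ^ 2 + ‖D.emb e‖ ^ 2)

theorem Assumptions.L_nonneg {D : Data V H} (hD : Assumptions D) (x : H) :
    0 ≤ inner ℝ (D.L x) x := by
  obtain ⟨c, hc, h⟩ := hD.L_coercive
  exact (by positivity : 0 ≤ c * ‖x‖ ^ 2).trans (h x)

theorem Assumptions.energy_coercive {D : Data V H} (hD : Assumptions D) :
    ∃ c : ℝ, 0 < c ∧ ∀ y e τ, c * (‖y‖ ^ 2 + ‖e‖ ^ 2 + ‖D.emb τ‖ ^ 2) ≤ energy D y e τ := by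
  obtain ⟨c, hc, h1⟩ := hD.L_coercive
  obtain ⟨κ, hκ, h2⟩ := hD.A₂_coercive 1 one_pos
  refine ⟨2⁻¹ * min c (min κ 1), by positivity, fun y e τ => ?_⟩
  have h3 := h1 y
  have h4 := h2 e
  have h5 : 0 ≤ D.η⁻¹ * D.B₂s τ τ :=
    mul_nonneg (inv_nonneg.2 hD.η_pos.le) (hD.B₂_ext.1 τ)
  have m1 : min c (min κ 1) ≤ c := min_le_left _ _
  have m2 : min c (min κ 1) ≤ κ := (min_le_right _ _).trans (min_le_left _ _)
  have m3 : min c (min κ 1) ≤ 1 := (min_le_right _ _).trans (min_le_right _ _)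
  set μ := min c (min κ 1)
  have k1 : μ * ‖y‖ ^ 2 ≤ c * ‖y‖ ^ 2 := by gcongr
  have k2 : μ * ‖e‖ ^ 2 ≤ κ * ‖e‖ ^ 2 := by gcongr
  have k3 : μ * ‖D.emb τ‖ ^ 2 ≤ 1 * ‖D.emb τ‖ ^ 2 := by gcongr
  unfold energy
  nlinarith

theorem Assumptions.energy_nonneg {D : Data V H} (hD : Assumptions D) (y : H) (e τ : V) :
    0 ≤ energy D y e τ := by
  obtain ⟨c, hc, h⟩ := hD.energy_coercive
  exact (by positivity : 0 ≤ c * (‖y‖ ^ 2 + ‖e‖ ^ 2 + ‖D.emb τ‖ ^ 2)).trans (h y e τ)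

theorem Assumptions.B₂s_le_energy {D : Data V H} (hD : Assumptions D) (y : H) (e τ : V) :
    D.B₂s τ τ ≤ 2 * D.η * energy D y e τ := by
  have h1 := hD.L_nonneg y
  have h2 := hD.A₂_ext.1 e
  have h3 : D.B₂s τ τ = D.η * (D.η⁻¹ * D.B₂s τ τ) := by
    rw [mul_inv_cancel_left₀ hD.η_pos.ne']
  rw [h3, mul_comm 2 D.η, mul_assoc]
  refine mul_le_mul_of_nonneg_left ?_ hD.η_pos.le
  unfold energy
  nlinarith [sq_nonneg ‖D.emb τ‖, sq_nonneg ‖D.emb e‖]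

theorem form_le (b : V →L[ℝ] StrongDual ℝ V) (x y : V) : b x y ≤ ‖b‖ * ‖x‖ * ‖y‖ :=
  (le_abs_self _).trans (b.le_opNorm₂ x y)

theorem Assumptions.energy_le {D : Data V H} (hD : Assumptions D) :
    ∃ C : ℝ, 0 < C ∧ ∀ y e τ, energy D y e τ ≤ C * (‖y‖ ^ 2 + ‖e‖ ^ 2 + ‖τ‖ ^ 2) := by
  have hη : 0 ≤ D.η⁻¹ := inv_nonneg.2 hD.η_pos.le
  refine ⟨‖D.L‖ + ‖D.A₂s‖ + D.η⁻¹ * ‖D.B₂s‖ + ‖D.emb‖ ^ 2 + 1, by positivity, fun y e τ => ?_⟩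
  have h1 : inner ℝ (D.L y) y ≤ ‖D.L‖ * ‖y‖ ^ 2 := by
    refine (real_inner_le_norm _ _).trans ?_
    rw [sq, ← mul_assoc]
    gcongr
    exact D.L.le_opNorm y
  have h2 : D.A₂s e e ≤ ‖D.A₂s‖ * ‖e‖ ^ 2 := (form_le _ e e).trans_eq (by ring)
  have h3 : D.η⁻¹ * D.B₂s τ τ ≤ D.η⁻¹ * (‖D.B₂s‖ * ‖τ‖ ^ 2) := by
    gcongr
    exact (form_le _ τ τ).trans_eq (by ring)
  have h4 : ‖D.emb τ‖ ^ 2 ≤ ‖D.emb‖ ^ 2 * ‖τ‖ ^ 2 := by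
    rw [← mul_pow]; gcongr; exact D.emb.le_opNorm τ
  have h5 : ‖D.emb e‖ ^ 2 ≤ ‖D.emb‖ ^ 2 * ‖e‖ ^ 2 := by
    rw [← mul_pow]; gcongr; exact D.emb.le_opNorm e
  have n1 := norm_nonneg D.L
  have n2 := norm_nonneg D.A₂s
  have n3 := mul_nonneg hη (norm_nonneg D.B₂s)
  have n4 := sq_nonneg ‖D.emb‖
  have p1 := sq_nonneg ‖y‖
  have p2 := sq_nonneg ‖e‖
  have p3 := sq_nonneg ‖τ‖
  have q1 := mul_nonneg n1 p1
  have q2 := mul_nonneg n1 p2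
  have q3 := mul_nonneg n1 p3
  have q4 := mul_nonneg n2 p1
  have q5 := mul_nonneg n2 p2
  have q6 := mul_nonneg n2 p3
  have q7 := mul_nonneg n3 p1
  have q8 := mul_nonneg n3 p2
  have q9 := mul_nonneg n3 p3
  have q10 := mul_nonneg n4 p1
  have q11 := mul_nonneg n4 p2
  have q12 := mul_nonneg n4 p3
  unfold energy
  nlinarith

/-- The quantity controlled in time mean by one step of the scheme: the dissipation of the
wave part and of the heat part. -/
noncomputable def dissipation (D : Data V H) (w ε : V) : ℝ :=
  D.B₁s w w + D.η⁻¹ * inner ℝ (ev D.B₂ (D.emb ε)) (ev D.A₁ (D.emb ε)) + D.A₁s ε ε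

theorem Assumptions.dissipation_terms_nonneg {D : Data V H} (hD : Assumptions D) (w : V) {ε : V}
    (hε : D.emb ε ∈ D.A₁.domain) :
    0 ≤ D.B₁s w w ∧ 0 ≤ inner ℝ (ev D.B₂ (D.emb ε)) (ev D.A₁ (D.emb ε)) ∧ 0 ≤ D.A₁s ε ε :=
  ⟨hD.B₁_ext.1 w, hD.B₂_A₁_nonneg _ hε, hD.A₁_ext.1 ε⟩

theorem Assumptions.dissipation_nonneg {D : Data V H} (hD : Assumptions D) (w : V) {ε : V}
    (hε : D.emb ε ∈ D.A₁.domain) : 0 ≤ dissipation D w ε := by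
  obtain ⟨h1, h2, h3⟩ := hD.dissipation_terms_nonneg w hε
  have := mul_nonneg (inv_nonneg.2 hD.η_pos.le) h2
  unfold dissipation
  linarith

/-- Energy balance of one implicit step. The wave equation is tested with the velocity
increment `w`, the heat equation with `B₂ ε / η`, which cancels the coupling term, and with `ε`.
The residuals `emb w - y'`, `p - e'`, `ε - τ'` enter only through their own energy. -/
theorem Assumptions.energy_increment {D : Data V H} (hD : Assumptions D) {h : ℝ} (hh : 0 < h)
    {τ τ' e e' w ε p : V} {y y' f : H} (hw : w = h⁻¹ • (e' - e)) (hε : D.emb ε ∈ D.A₁.domain)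
    (h1 : D.emb (h⁻¹ • (τ' - τ) + D.η • w) + ev D.A₁ (D.emb ε) = 0)
    (h2 : inner ℝ (D.L (h⁻¹ • (y' - y))) (D.emb w) + D.B₁s w w + D.A₂s p w
      + inner ℝ f (D.emb w) = D.B₂s ε w) :
    energy D y' e' τ' + h * dissipation D w ε + h * inner ℝ f (D.emb w) ≤ energy D y e τ
      + energy D (D.emb w - y') (p - e') (ε - τ')
      + h * (‖D.emb w‖ * (D.η * ‖D.emb ε‖ + ‖D.emb e'‖)) := by
  have hη := hD.η_pos
  have hwe : e' - e = h • w := by rw [hw, smul_inv_smul₀ hh.ne']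
  have a1 : h * inner ℝ (D.L (h⁻¹ • (y' - y))) (D.emb w) = inner ℝ (D.L (y' - y)) (D.emb w) := by
    rw [map_smul, real_inner_smul_left, mul_inv_cancel_left₀ hh.ne']
  have b1 := inner_increment D.L hD.L_nonneg hD.L_symm y y' (D.emb w - y')
  rw [add_sub_cancel] at b1
  have a2 : h * D.A₂s p w = D.A₂s p (e' - e) := by rw [hwe, map_smul, smul_eq_mul]
  have b2 := form_increment D.A₂s hD.A₂_ext.1 hD.A₂_ext.2.1 e e' (p - e')
  rw [add_sub_cancel] at b2
  have h3 : D.emb (τ' - τ + (h * D.η) • w) = -(h • ev D.A₁ (D.emb ε)) := by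
    rw [← smul_neg, ← eq_neg_of_add_eq_zero_left h1, ← map_smul, smul_add, smul_inv_smul₀ hh.ne',
      smul_smul]
  have a3 : D.B₂s ε (τ' - τ) + h * D.η * D.B₂s ε w =
      -(h * inner ℝ (ev D.B₂ (D.emb ε)) (ev D.A₁ (D.emb ε))) := by
    rw [← smul_eq_mul (h * D.η), ← map_smul, ← map_add,
      hD.B₂_ext.2.2 ε (hD.A₁_le_B₂ hε), h3, inner_neg_right, real_inner_smul_right]
  have a3' : h * D.B₂s ε w = -(h * (D.η⁻¹ * inner ℝ (ev D.B₂ (D.emb ε)) (ev D.A₁ (D.emb ε))))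
      - D.η⁻¹ * D.B₂s ε (τ' - τ) := by
    field_simp
    linarith
  have b3 := form_increment D.B₂s hD.B₂_ext.1 hD.B₂_ext.2.1 τ τ' (ε - τ')
  rw [add_sub_cancel] at b3
  have b3' := mul_le_mul_of_nonneg_left b3 (inv_nonneg.2 hη.le)
  have a4 : h * D.A₁s ε ε + inner ℝ (D.emb (τ' - τ)) (D.emb ε)
      + h * (D.η * inner ℝ (D.emb w) (D.emb ε)) = 0 := by
    have : h • ev D.A₁ (D.emb ε) = -(D.emb (τ' - τ + (h * D.η) • w)) := by rw [h3, neg_neg]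
    rw [hD.A₁_ext.2.2 ε hε, ← real_inner_smul_left, this, map_add, map_smul, neg_add,
      inner_add_left, inner_neg_left, inner_neg_left, real_inner_smul_left]
    ring
  have b4 := inner_increment (ContinuousLinearMap.id ℝ H) (fun x => real_inner_self_nonneg)
    (fun x y => rfl) (D.emb τ) (D.emb τ') (D.emb (ε - τ'))
  simp only [ContinuousLinearMap.id_apply, real_inner_self_eq_norm_sq] at b4
  rw [← map_add, add_sub_cancel, ← map_sub] at b4
  have b5 := inner_increment (ContinuousLinearMap.id ℝ H) (fun x => real_inner_self_nonneg)
    (fun x y => rfl) (D.emb e) (D.emb e') 0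
  simp only [ContinuousLinearMap.id_apply, real_inner_self_eq_norm_sq, norm_zero, add_zero] at b5
  rw [← map_sub, hwe, map_smul, real_inner_smul_left] at b5
  have c1 : -(h * (D.η * inner ℝ (D.emb w) (D.emb ε))) ≤ h * (D.η * (‖D.emb w‖ * ‖D.emb ε‖)) := by
    have : -inner ℝ (D.emb w) (D.emb ε) ≤ ‖D.emb w‖ * ‖D.emb ε‖ :=
      (neg_le_abs _).trans (abs_real_inner_le_norm _ _)
    rw [← mul_neg, ← mul_neg]
    gcongr
  have c2 : h * inner ℝ (D.emb w) (D.emb e') ≤ h * (‖D.emb w‖ * ‖D.emb e'‖) := by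
    gcongr
    exact real_inner_le_norm _ _
  have h2' := congrArg (fun x => h * x) h2
  simp only [mul_add] at h2'
  have c3 := sq_nonneg ‖D.emb (p - e')‖
  unfold energy dissipation
  rw [a1, a2, a3'] at h2'
  linarith

end Stability

/-! ### Approximate solutions of the scheme -/

section Approximate

variable {V H : Type*} [NormedAddCommGroup V] [InnerProductSpace ℝ V]
  [NormedAddCommGroup H] [InnerProductSpace ℝ H]

/-- An approximate solution of the time discrete problem: nodal values `θ n`, `φ n`, `v n`, and on
the interval number `n` a temperature `m n`, a displacement `p n` and a nonlinear force `f n`,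
which satisfy the equations of the scheme exactly and are within `K h` of the values at the right
endpoint (in square mean for the temperature). Discrete solutions are of this kind, with `m n`,
`p n` and `f n` equal to the values at the right endpoint, and so are exact solutions, with their
mean values over the interval. -/
structure IsApproxSolution (D : Data V H) (N : ℕ) (h K : ℝ) (θ φ : ℕ → V) (v : ℕ → H)
    (m p : ℕ → V) (f : ℕ → H) : Prop where
  θ_zero : θ 0 = D.θ₀
  φ_zero : φ 0 = D.φ₀
  v_zero : v 0 = D.emb D.v₀
  m_mem : ∀ n < N, D.emb (m n) ∈ D.A₁.domain
  eq₁ : ∀ n < N, D.emb (diffQuot h θ n + D.η • diffQuot h φ n) + ev D.A₁ (D.emb (m n)) = 0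
  eq₂ : ∀ n < N, ∀ ζ : V, inner ℝ (D.L (h⁻¹ • (v (n + 1) - v n))) (D.emb ζ)
    + D.B₁s (diffQuot h φ n) ζ + D.A₂s (p n) ζ + inner ℝ (f n) (D.emb ζ) = D.B₂s (m n) ζ
  v_near : ∀ n < N, ‖D.emb (diffQuot h φ n) - v (n + 1)‖ ≤ K * h
  p_near : ∀ n < N, ‖p n - φ (n + 1)‖ ≤ K * h
  m_near : ∑ n ∈ Finset.range N, ‖m n - θ (n + 1)‖ ^ 2 ≤ K * h
  f_near : ∀ n < N, ‖f n - (D.Φ (D.emb (φ (n + 1))) + D.ell (D.emb (φ (n + 1))))‖ ≤ K * h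
  φ_bound : ∀ n < N, ‖φ (n + 1)‖ ≤ K

theorem IsApproxSolution.mono {D : Data V H} {N : ℕ} {h K K' : ℝ} (hh : 0 ≤ h) (hK : K ≤ K')
    {θ φ : ℕ → V} {v : ℕ → H} {m p : ℕ → V} {f : ℕ → H}
    (S : IsApproxSolution D N h K θ φ v m p f) : IsApproxSolution D N h K' θ φ v m p f := by
  have hKh : K * h ≤ K' * h := by gcongr
  exact { S with
    v_near := fun n hn => (S.v_near n hn).trans hKh
    p_near := fun n hn => (S.p_near n hn).trans hKh
    m_near := S.m_near.trans hKh
    f_near := fun n hn => (S.f_near n hn).trans hKh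
    φ_bound := fun n hn => (S.φ_bound n hn).trans hK }

variable [CompleteSpace H]

/-- The nonlinear force is Lipschitz on bounded subsets of `V`. -/
theorem Assumptions.force_lipschitz {D : Data V H} (hD : Assumptions D) (K : ℝ) :
    ∃ C : ℝ, 0 < C ∧ ∀ x y : V, ‖x‖ ≤ K → ‖y‖ ≤ K →
      ‖D.Φ (D.emb x) - D.Φ (D.emb y)‖ ≤ C * ‖x - y‖ ∧
      ‖(D.Φ (D.emb x) + D.ell (D.emb x)) - (D.Φ (D.emb y) + D.ell (D.emb y))‖ ≤ C * ‖x - y‖ := by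
  obtain ⟨p, q, C, hp, hq, hC, h⟩ := hD.Φ_growth
  obtain ⟨C', hC', hl⟩ := hD.ell_lipschitz
  have hA : 0 ≤ C * (1 + |K| ^ p + |K| ^ q) := by positivity
  have hB : 0 ≤ (C' : ℝ) * ‖D.emb‖ := by positivity
  refine ⟨C * (1 + |K| ^ p + |K| ^ q) + C' * ‖D.emb‖ + 1, by positivity, fun x y hx hy => ?_⟩
  have h1 : ‖D.Φ (D.emb x) - D.Φ (D.emb y)‖ ≤ C * (1 + |K| ^ p + |K| ^ q) * ‖x - y‖ := by
    refine (h x y).trans ?_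
    gcongr
    · exact hx.trans (le_abs_self K)
    · exact hy.trans (le_abs_self K)
  have h2 : ‖D.ell (D.emb x) - D.ell (D.emb y)‖ ≤ C' * ‖D.emb‖ * ‖x - y‖ := by
    refine (hl.norm_sub_le _ _).trans ?_
    rw [← map_sub, mul_assoc]
    gcongr
    exact D.emb.le_opNorm _
  have h3 := norm_nonneg (x - y)
  constructor
  · refine h1.trans ?_
    nlinarith
  · rw [add_sub_add_comm]
    refine (norm_add_le _ _).trans ?_
    nlinarith

/-- Lower order terms of one step for the difference of two approximate solutions. -/
theorem lower_order_le {h K C G η Y E τ W F ε s₁ s₂ : ℝ} (hη : 0 ≤ η)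
    (hW0 : 0 ≤ W) (hW : W ≤ Y + 2 * K * h) (hF : F ≤ C * E + 2 * K * h)
    (hε : ε ≤ τ + G * (s₁ + s₂)) :
    W * (F + η * ε + G * E) ≤ (1 + 2 * (C + G) ^ 2 + 2 * η ^ 2) * (Y ^ 2 + E ^ 2 + τ ^ 2)
      + (12 * K ^ 2 + 4 * η ^ 2 * G ^ 2) * (h ^ 2 + s₁ ^ 2 + s₂ ^ 2) := by
  have a0 : W * (F + η * ε + G * E) ≤
      W * ((C + G) * E + 2 * K * h + η * τ + η * G * (s₁ + s₂)) := by
    refine mul_le_mul_of_nonneg_left ?_ hW0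
    have := mul_le_mul_of_nonneg_left hε hη
    linarith
  have a1 : W ^ 2 ≤ 2 * Y ^ 2 + 8 * (K ^ 2 * h ^ 2) := by
    have : W ^ 2 ≤ (Y + 2 * K * h) ^ 2 := pow_le_pow_left₀ hW0 hW 2
    nlinarith [sq_nonneg (Y - 2 * K * h)]
  have a2 : ∀ b₁ b₂ b₃ b₄ : ℝ,
      W * (b₁ + b₂ + b₃ + b₄) ≤ 2⁻¹ * W ^ 2 + 2 * (b₁ ^ 2 + b₂ ^ 2 + b₃ ^ 2 + b₄ ^ 2) := by
    intro b₁ b₂ b₃ b₄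
    nlinarith [sq_nonneg (W - (b₁ + b₂ + b₃ + b₄)), sq_nonneg (b₁ - b₂), sq_nonneg (b₁ - b₃),
      sq_nonneg (b₁ - b₄), sq_nonneg (b₂ - b₃), sq_nonneg (b₂ - b₄), sq_nonneg (b₃ - b₄)]
  have a3 := a2 ((C + G) * E) (2 * K * h) (η * τ) (η * G * (s₁ + s₂))
  have a4 : (η * G * (s₁ + s₂)) ^ 2 ≤ 2 * (η ^ 2 * G ^ 2) * (s₁ ^ 2 + s₂ ^ 2) := by
    have : 0 ≤ (η * G) ^ 2 * (s₁ - s₂) ^ 2 := by positivity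
    linarith
  have p1 : 0 ≤ (C + G) ^ 2 * Y ^ 2 := by positivity
  have p2 : 0 ≤ (C + G) ^ 2 * τ ^ 2 := by positivity
  have p3 : 0 ≤ η ^ 2 * Y ^ 2 := by positivity
  have p4 : 0 ≤ η ^ 2 * E ^ 2 := by positivity
  have p5 : 0 ≤ K ^ 2 * s₁ ^ 2 := by positivity
  have p6 : 0 ≤ K ^ 2 * s₂ ^ 2 := by positivity
  have p7 : 0 ≤ η ^ 2 * G ^ 2 * h ^ 2 := by positivity
  have p8 := sq_nonneg E
  have p9 := sq_nonneg τ
  nlinarith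

/-- Difference of two approximate solutions, one step: the energy balance. -/
theorem Assumptions.approx_energy_increment {D : Data V H} (hD : Assumptions D) {N : ℕ}
    {h K : ℝ} (hh : 0 < h) {θ φ : ℕ → V} {v : ℕ → H} {m p : ℕ → V} {f : ℕ → H}
    {θ' φ' : ℕ → V} {v' : ℕ → H} {m' p' : ℕ → V} {f' : ℕ → H}
    (S : IsApproxSolution D N h K θ φ v m p f) (S' : IsApproxSolution D N h K θ' φ' v' m' p' f')
    {n : ℕ} (hn : n < N) :
    energy D (v (n + 1) - v' (n + 1)) (φ (n + 1) - φ' (n + 1)) (θ (n + 1) - θ' (n + 1))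
      + h * dissipation D (diffQuot h φ n - diffQuot h φ' n) (m n - m' n)
      + h * inner ℝ (f n - f' n) (D.emb (diffQuot h φ n - diffQuot h φ' n))
    ≤ energy D (v n - v' n) (φ n - φ' n) (θ n - θ' n)
      + energy D (D.emb (diffQuot h φ n - diffQuot h φ' n) - (v (n + 1) - v' (n + 1)))
          (p n - p' n - (φ (n + 1) - φ' (n + 1))) (m n - m' n - (θ (n + 1) - θ' (n + 1)))
      + h * (‖D.emb (diffQuot h φ n - diffQuot h φ' n)‖ * (D.η * ‖D.emb (m n - m' n)‖
          + ‖D.emb (φ (n + 1) - φ' (n + 1))‖)) := by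
  refine hD.energy_increment hh ?_ ?_ ?_ ?_
  · rw [diffQuot, diffQuot, ← smul_sub]; congr 1; abel
  · rw [map_sub]; exact D.A₁.domain.sub_mem (S.m_mem n hn) (S'.m_mem n hn)
  · have e1 : h⁻¹ • (θ (n + 1) - θ' (n + 1) - (θ n - θ' n))
        + D.η • (diffQuot h φ n - diffQuot h φ' n) = (diffQuot h θ n + D.η • diffQuot h φ n)
        - (diffQuot h θ' n + D.η • diffQuot h φ' n) := by
      rw [add_sub_add_comm, ← smul_sub]
      congr 1
      rw [diffQuot, diffQuot, ← smul_sub]; congr 1; abel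
    rw [e1, map_sub D.emb (m n), map_sub, ev_sub (S.m_mem n hn) (S'.m_mem n hn),
      sub_add_sub_comm, S.eq₁ n hn, S'.eq₁ n hn, sub_zero]
  · generalize hw : diffQuot h φ n - diffQuot h φ' n = w
    have e1 : h⁻¹ • (v (n + 1) - v' (n + 1) - (v n - v' n))
        = h⁻¹ • (v (n + 1) - v n) - h⁻¹ • (v' (n + 1) - v' n) := by
      rw [← smul_sub]; congr 1; abel
    have e2 : D.B₁s w w = D.B₁s (diffQuot h φ n) w - D.B₁s (diffQuot h φ' n) w := by
      conv_lhs => rw [show D.B₁s w = D.B₁s (diffQuot h φ n) - D.B₁s (diffQuot h φ' n) by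
        rw [← hw, map_sub]]
      rfl
    have h1 := S.eq₂ n hn w
    have h2 := S'.eq₂ n hn w
    rw [e1, e2, map_sub D.L, map_sub D.A₂s, map_sub D.B₂s, inner_sub_left, inner_sub_left,
      sub_apply, sub_apply]
    linarith

/-- Difference of two approximate solutions, one step: the residuals and the lower order terms
are estimated by the energy, by `h²`, and by the residuals of the temperature. -/
theorem Assumptions.approx_step {D : Data V H} (hD : Assumptions D) {K : ℝ} (hK : 0 < K) :
    ∃ a C : ℝ, 0 < a ∧ 0 < C ∧ ∀ (N : ℕ) (h : ℝ), 0 < h → h ≤ 1 →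
      ∀ (θ φ : ℕ → V) (v : ℕ → H) (m p : ℕ → V) (f : ℕ → H)
        (θ' φ' : ℕ → V) (v' : ℕ → H) (m' p' : ℕ → V) (f' : ℕ → H),
      IsApproxSolution D N h K θ φ v m p f → IsApproxSolution D N h K θ' φ' v' m' p' f' →
      ∀ n < N,
        energy D (v (n + 1) - v' (n + 1)) (φ (n + 1) - φ' (n + 1)) (θ (n + 1) - θ' (n + 1))
          + h * dissipation D (diffQuot h φ n - diffQuot h φ' n) (m n - m' n)
        ≤ energy D (v n - v' n) (φ n - φ' n) (θ n - θ' n)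
          + a * h * energy D (v (n + 1) - v' (n + 1)) (φ (n + 1) - φ' (n + 1))
              (θ (n + 1) - θ' (n + 1))
          + C * (h ^ 2 + ‖m n - θ (n + 1)‖ ^ 2 + ‖m' n - θ' (n + 1)‖ ^ 2) := by
  obtain ⟨c, hc, hcoer⟩ := hD.energy_coercive
  obtain ⟨C₁, hC₁, hle⟩ := hD.energy_le
  obtain ⟨C₂, hC₂, hlip⟩ := hD.force_lipschitz K
  have hη : 0 < D.η := hD.η_pos
  have hG0 : 0 ≤ ‖D.emb‖ := norm_nonneg _
  refine ⟨(1 + 2 * (C₂ + ‖D.emb‖) ^ 2 + 2 * D.η ^ 2) / c,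
    8 * C₁ * (1 + K ^ 2) + (12 * K ^ 2 + 4 * D.η ^ 2 * ‖D.emb‖ ^ 2), by positivity,
    by positivity, ?_⟩
  intro N h hh hh1 θ φ v m p f θ' φ' v' m' p' f' S S' n hn
  have main := hD.approx_energy_increment hh S S' hn
  have r1 : ‖D.emb (diffQuot h φ n - diffQuot h φ' n) - (v (n + 1) - v' (n + 1))‖
      ≤ 2 * K * h := by
    have e : D.emb (diffQuot h φ n - diffQuot h φ' n) - (v (n + 1) - v' (n + 1)) =
        (D.emb (diffQuot h φ n) - v (n + 1)) - (D.emb (diffQuot h φ' n) - v' (n + 1)) := by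
      rw [map_sub]; abel
    rw [e]
    have := S.v_near n hn
    have := S'.v_near n hn
    exact (norm_sub_le _ _).trans (by linarith)
  have r2 : ‖p n - p' n - (φ (n + 1) - φ' (n + 1))‖ ≤ 2 * K * h := by
    rw [sub_sub_sub_comm]
    have := S.p_near n hn
    have := S'.p_near n hn
    exact (norm_sub_le _ _).trans (by linarith)
  have r3 : ‖m n - m' n - (θ (n + 1) - θ' (n + 1))‖
      ≤ ‖m n - θ (n + 1)‖ + ‖m' n - θ' (n + 1)‖ := by
    rw [sub_sub_sub_comm]
    exact norm_sub_le _ _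
  have r4 : ‖f n - f' n‖ ≤ C₂ * ‖φ (n + 1) - φ' (n + 1)‖ + 2 * K * h := by
    have h1 := S.f_near n hn
    have h2 := S'.f_near n hn
    have h3 := (hlip _ _ (S.φ_bound n hn) (S'.φ_bound n hn)).2
    generalize D.Φ (D.emb (φ (n + 1))) + D.ell (D.emb (φ (n + 1))) = g at *
    generalize D.Φ (D.emb (φ' (n + 1))) + D.ell (D.emb (φ' (n + 1))) = g' at *
    have e : f n - f' n = (f n - g) - (f' n - g') + (g - g') := by abel
    rw [e]
    have h4 := norm_add_le ((f n - g) - (f' n - g')) (g - g')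
    have h5 := norm_sub_le (f n - g) (f' n - g')
    linarith
  generalize hw : diffQuot h φ n - diffQuot h φ' n = w at *
  generalize hy : v (n + 1) - v' (n + 1) = y at *
  generalize he : φ (n + 1) - φ' (n + 1) = e at *
  generalize hτ : θ (n + 1) - θ' (n + 1) = τ at *
  generalize hε : m n - m' n = ε at *
  generalize hP : p n - p' n = P at *
  generalize hF : f n - f' n = F at *
  generalize hs₁ : ‖m n - θ (n + 1)‖ = s₁ at *
  generalize hs₂ : ‖m' n - θ' (n + 1)‖ = s₂ at *
  have r5 : ‖D.emb w‖ ≤ ‖y‖ + 2 * K * h := by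
    have h1 := norm_add_le (D.emb w - y) y
    rw [sub_add_cancel] at h1
    linarith
  have r6 : ‖D.emb ε‖ ≤ ‖D.emb τ‖ + ‖D.emb‖ * (s₁ + s₂) := by
    have h1 := norm_add_le (D.emb (ε - τ)) (D.emb τ)
    rw [← map_add, sub_add_cancel] at h1
    have h2 : ‖D.emb (ε - τ)‖ ≤ ‖D.emb‖ * (s₁ + s₂) :=
      (D.emb.le_opNorm _).trans (mul_le_mul_of_nonneg_left r3 hG0)
    linarith
  have r7 : ‖D.emb e‖ ≤ ‖D.emb‖ * ‖e‖ := D.emb.le_opNorm e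
  have r8 : -inner ℝ F (D.emb w) ≤ ‖F‖ * ‖D.emb w‖ :=
    (neg_le_abs _).trans (abs_real_inner_le_norm _ _)
  have r9 := hle (D.emb w - y) (P - e) (ε - τ)
  have r10 := hcoer y e τ
  have k1 : energy D (D.emb w - y) (P - e) (ε - τ) ≤
      8 * C₁ * (1 + K ^ 2) * (h ^ 2 + s₁ ^ 2 + s₂ ^ 2) := by
    refine r9.trans ?_
    have a1 : ‖D.emb w - y‖ ^ 2 ≤ (2 * K * h) ^ 2 := pow_le_pow_left₀ (norm_nonneg _) r1 2
    have a2 : ‖P - e‖ ^ 2 ≤ (2 * K * h) ^ 2 := pow_le_pow_left₀ (norm_nonneg _) r2 2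
    have a3 : ‖ε - τ‖ ^ 2 ≤ (s₁ + s₂) ^ 2 := pow_le_pow_left₀ (norm_nonneg _) r3 2
    have a4 : ‖D.emb w - y‖ ^ 2 + ‖P - e‖ ^ 2 + ‖ε - τ‖ ^ 2 ≤
        8 * (1 + K ^ 2) * (h ^ 2 + s₁ ^ 2 + s₂ ^ 2) := by
      have p1 : 0 ≤ K ^ 2 * s₁ ^ 2 := by positivity
      have p2 : 0 ≤ K ^ 2 * s₂ ^ 2 := by positivity
      nlinarith [sq_nonneg (s₁ - s₂), sq_nonneg h, sq_nonneg s₁, sq_nonneg s₂]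
    calc _ ≤ C₁ * (8 * (1 + K ^ 2) * (h ^ 2 + s₁ ^ 2 + s₂ ^ 2)) :=
          mul_le_mul_of_nonneg_left a4 hC₁.le
      _ = _ := by ring
  have k2 := lower_order_le hη.le (norm_nonneg (D.emb w)) r5 r4 r6
  generalize hX : ‖y‖ ^ 2 + ‖e‖ ^ 2 + ‖D.emb τ‖ ^ 2 = X at *
  generalize hR : h ^ 2 + s₁ ^ 2 + s₂ ^ 2 = R at *
  have hR0 : 0 ≤ R := by rw [← hR]; positivity
  have k3 : ‖D.emb w‖ * (D.η * ‖D.emb ε‖ + ‖D.emb e‖) - inner ℝ F (D.emb w) ≤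
      ‖D.emb w‖ * (‖F‖ + D.η * ‖D.emb ε‖ + ‖D.emb‖ * ‖e‖) := by
    have := mul_le_mul_of_nonneg_left r7 (norm_nonneg (D.emb w))
    linarith
  have k4 : (1 + 2 * (C₂ + ‖D.emb‖) ^ 2 + 2 * D.η ^ 2) * X ≤
      (1 + 2 * (C₂ + ‖D.emb‖) ^ 2 + 2 * D.η ^ 2) / c * energy D y e τ := by
    rw [div_mul_eq_mul_div, le_div_iff₀ hc, mul_assoc]
    refine mul_le_mul_of_nonneg_left ?_ (by positivity)
    rwa [mul_comm]
  have k5 := mul_le_mul_of_nonneg_left ((k3.trans k2).trans (add_le_add_left k4 _)) hh.le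
  have k6 : h * ((12 * K ^ 2 + 4 * D.η ^ 2 * ‖D.emb‖ ^ 2) * R) ≤
      1 * ((12 * K ^ 2 + 4 * D.η ^ 2 * ‖D.emb‖ ^ 2) * R) := by gcongr
  linarith

end Approximate

/-! ### Stability of the scheme, a priori bound -/

section StabilityTheorem

variable {V H : Type*} [NormedAddCommGroup V] [InnerProductSpace ℝ V]
  [NormedAddCommGroup H] [InnerProductSpace ℝ H] [CompleteSpace H]

/-- Stability of the scheme: two approximate solutions differ by `O(h)` in energy. -/
theorem Assumptions.stability {D : Data V H} (hD : Assumptions D) {K : ℝ} (hK : 0 < K) :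
    ∃ h₁ M : ℝ, 0 < h₁ ∧ 0 < M ∧ ∀ (N : ℕ) (h : ℝ), 0 < N → h = D.T / N → h ≤ h₁ →
      ∀ (θ φ : ℕ → V) (v : ℕ → H) (m p : ℕ → V) (f : ℕ → H)
        (θ' φ' : ℕ → V) (v' : ℕ → H) (m' p' : ℕ → V) (f' : ℕ → H),
      IsApproxSolution D N h K θ φ v m p f → IsApproxSolution D N h K θ' φ' v' m' p' f' →
      (∀ n ≤ N, energy D (v n - v' n) (φ n - φ' n) (θ n - θ' n) ≤ M * h) ∧
      ∑ n ∈ Finset.range N, h * dissipation D (diffQuot h φ n - diffQuot h φ' n) (m n - m' n)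
        ≤ M * h := by
  obtain ⟨a, C, ha, hC, hstep⟩ := hD.approx_step hK
  have hT := hD.T_pos
  refine ⟨min 1 (1 / (2 * a)), Real.exp (2 * a * D.T) * (C * (D.T + 2 * K)), by positivity,
    by positivity, ?_⟩
  intro N h hN hh hh1 θ φ v m p f θ' φ' v' m' p' f' S S'
  have hN' : (0 : ℝ) < N := Nat.cast_pos.2 hN
  have hh0 : 0 < h := by rw [hh]; positivity
  have hhN : h * N = D.T := by rw [hh]; field_simp
  have hah : a * h ≤ 1 / 2 := by
    have := mul_le_mul_of_nonneg_left (hh1.trans (min_le_right _ _)) ha.le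
    rwa [show a * (1 / (2 * a)) = 1 / 2 by field_simp] at this
  have hdiss : ∀ n < N, 0 ≤ dissipation D (diffQuot h φ n - diffQuot h φ' n) (m n - m' n) :=
    fun n hn => hD.dissipation_nonneg _
      (by rw [map_sub]; exact D.A₁.domain.sub_mem (S.m_mem n hn) (S'.m_mem n hn))
  have hg := discrete_gronwall (E := fun n => energy D (v n - v' n) (φ n - φ' n) (θ n - θ' n))
    (D := fun n => h * dissipation D (diffQuot h φ n - diffQuot h φ' n) (m n - m' n))
    (ρ := fun n => C * (h ^ 2 + ‖m n - θ (n + 1)‖ ^ 2 + ‖m' n - θ' (n + 1)‖ ^ 2))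
    (a := a * h) (by positivity) hah (N := N) (fun n => hD.energy_nonneg _ _ _)
    (fun n hn => mul_nonneg hh0.le (hdiss n hn)) (fun n hn => by positivity)
    (fun n hn =>
      hstep N h hh0 (hh1.trans (min_le_left _ _)) θ φ v m p f θ' φ' v' m' p' f' S S' n hn)
  have hbound : ∀ n ≤ N, energy D (v n - v' n) (φ n - φ' n) (θ n - θ' n)
      + ∑ k ∈ Finset.range n, h * dissipation D (diffQuot h φ k - diffQuot h φ' k) (m k - m' k)
      ≤ Real.exp (2 * a * D.T) * (C * (D.T + 2 * K)) * h := by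
    intro n hn
    refine (hg n hn).trans ?_
    have e0 : energy D (v 0 - v' 0) (φ 0 - φ' 0) (θ 0 - θ' 0) = 0 := by
      rw [S.v_zero, S'.v_zero, S.φ_zero, S'.φ_zero, S.θ_zero, S'.θ_zero]
      simp [energy]
    have e1 : ∑ k ∈ Finset.range n,
        C * (h ^ 2 + ‖m k - θ (k + 1)‖ ^ 2 + ‖m' k - θ' (k + 1)‖ ^ 2) ≤ C * (D.T + 2 * K) * h := by
      calc _ ≤ ∑ k ∈ Finset.range N,
            C * (h ^ 2 + ‖m k - θ (k + 1)‖ ^ 2 + ‖m' k - θ' (k + 1)‖ ^ 2) :=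
            Finset.sum_le_sum_of_subset_of_nonneg (Finset.range_mono hn)
              fun k _ _ => by positivity
        _ = C * (N * h ^ 2 + ∑ k ∈ Finset.range N, ‖m k - θ (k + 1)‖ ^ 2
              + ∑ k ∈ Finset.range N, ‖m' k - θ' (k + 1)‖ ^ 2) := by
            rw [← Finset.mul_sum, Finset.sum_add_distrib, Finset.sum_add_distrib]
            simp
        _ ≤ C * (D.T * h + K * h + K * h) := by
            refine mul_le_mul_of_nonneg_left (add_le_add (add_le_add ?_ S.m_near) S'.m_near) hC.le
            rw [← hhN]
            exact le_of_eq (by ring)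
        _ = _ := by ring
    have e2 : Real.exp (2 * (a * h) * n) ≤ Real.exp (2 * a * D.T) := by
      apply Real.exp_le_exp.2
      rw [← hhN]
      have : (n : ℝ) ≤ N := Nat.cast_le.2 hn
      calc 2 * (a * h) * n ≤ 2 * (a * h) * N := by gcongr
        _ = _ := by ring
    rw [e0, zero_add, mul_assoc _ _ h]
    exact mul_le_mul e2 e1 (Finset.sum_nonneg fun k _ => by positivity) (Real.exp_pos _).le
  constructor
  · intro n hn
    have h1 := hbound n hn
    have h2 := Finset.sum_nonneg fun k (hk : k ∈ Finset.range n) =>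
      mul_nonneg hh0.le (hdiss k ((Finset.mem_range.1 hk).trans_le hn))
    linarith
  · have h1 := hbound N le_rfl
    have h2 := hD.energy_nonneg (v N - v' N) (φ N - φ' N) (θ N - θ' N)
    linarith

theorem IsDiscreteSolution.emb_φ_mem {D : Data V H} (hD : Assumptions D) {N : ℕ} {h : ℝ}
    {θ φ : ℕ → V} (S : IsDiscreteSolution D N h θ φ) {n : ℕ} (hn : n ≤ N) :
    D.emb (φ n) ∈ D.B₁.domain := by
  rcases n with _ | n
  · rw [S.φ_zero]; exact hD.φ₀_mem_B₁
  · exact S.φ_mem_B₁ n hn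

theorem IsDiscreteSolution.emb_θ_mem {D : Data V H} (hD : Assumptions D) {N : ℕ} {h : ℝ}
    {θ φ : ℕ → V} (S : IsDiscreteSolution D N h θ φ) {n : ℕ} (hn : n ≤ N) :
    D.emb (θ n) ∈ D.A₁.domain := by
  rcases n with _ | n
  · rw [S.θ_zero]; exact hD.θ₀_mem
  · exact S.θ_mem n hn

theorem IsDiscreteSolution.emb_diffQuot_mem {D : Data V H} (hD : Assumptions D) {N : ℕ} {h : ℝ}
    {θ φ : ℕ → V} (S : IsDiscreteSolution D N h θ φ) {n : ℕ} (hn : n < N) :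
    D.emb (diffQuot h φ n) ∈ D.B₁.domain := by
  rw [diffQuot, map_smul, map_sub]
  exact D.B₁.domain.smul_mem _
    (D.B₁.domain.sub_mem (S.emb_φ_mem hD hn) (S.emb_φ_mem hD hn.le))

/-- A discrete solution is an approximate solution without residuals. -/
theorem IsDiscreteSolution.isApproxSolution {D : Data V H} (hD : Assumptions D) {N : ℕ} {h K : ℝ}
    (hh : 0 < h) {θ φ : ℕ → V} (S : IsDiscreteSolution D N h θ φ) (hK : 0 ≤ K)
    (hφ : ∀ n < N, ‖φ (n + 1)‖ ≤ K) :
    IsApproxSolution D N h K θ φ (fun n => D.emb (discreteV h D.v₀ φ n)) (fun n => θ (n + 1))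
      (fun n => φ (n + 1)) (fun n => D.Φ (D.emb (φ (n + 1))) + D.ell (D.emb (φ (n + 1)))) where
  θ_zero := S.θ_zero
  φ_zero := S.φ_zero
  v_zero := rfl
  m_mem := S.θ_mem
  eq₁ := fun n hn => by
    have := S.eq₁ n hn
    rwa [← map_smul, ← map_add] at this
  eq₂ := fun n hn ζ => by
    have h1 := congrArg (fun x => inner ℝ x (D.emb ζ)) (S.eq₂ n hn)
    simp only [inner_add_left] at h1
    rw [← hD.B₂_ext.2.2 _ (hD.A₁_le_B₂ (S.θ_mem n hn)),
      ← hD.A₂_ext.2.2 _ (S.φ_mem_A₂ n hn),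
      ← hD.B₁_ext.2.2 _ (by exact S.emb_diffQuot_mem hD hn)] at h1
    rw [← h1, inner_add_left, ← map_sub, ← map_smul]
    simp only [discreteZ, diffQuot, discreteV]
    ring
  v_near := fun n hn => by simp only [discreteV, sub_self, norm_zero]; positivity
  p_near := fun n hn => by simp only [sub_self, norm_zero]; positivity
  m_near := by simp only [sub_self, norm_zero]; simp; positivity
  f_near := fun n hn => by simp only [sub_self, norm_zero]; positivity
  φ_bound := hφ

/-- A priori estimate: discrete displacements are bounded in `V`, uniformly in the step size. The
potential `i` turns the nonlinear term into an increment: `h (Φ φₙ₊₁, δφₙ) ≥ i φₙ₊₁ - i φₙ`, so that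
no Lipschitz bound for `Φ` is needed. -/
theorem Assumptions.discrete_bound {D : Data V H} (hD : Assumptions D) :
    ∃ h₁ R : ℝ, 0 < h₁ ∧ 0 < R ∧ ∀ (N : ℕ) (h : ℝ), 0 < N → h = D.T / N → h ≤ h₁ →
      ∀ θ φ : ℕ → V, IsDiscreteSolution D N h θ φ → ∀ n < N, ‖φ (n + 1)‖ ≤ R := by
  obtain ⟨c, hc, hcoer⟩ := hD.energy_coercive
  obtain ⟨Cl, hCl, hl⟩ := hD.ell_lipschitz
  obtain ⟨i, -, -, hi0, hi⟩ := hD.Φ_potential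
  have hT := hD.T_pos
  have hη := hD.η_pos
  have hG0 : 0 ≤ ‖D.emb‖ := norm_nonneg _
  set a := (1 + 2 * (Cl * ‖D.emb‖ + ‖D.emb‖) ^ 2 + 2 * D.η ^ 2) / c with ha'
  have ha : 0 < a := by positivity
  set C := 12 * (‖D.ell 0‖ / 2) ^ 2 + 4 * D.η ^ 2 * ‖D.emb‖ ^ 2 with hC'
  have hC : 0 ≤ C := by positivity
  set E₀ := energy D (D.emb D.v₀) D.φ₀ D.θ₀ + i D.φ₀ with hE₀'
  have hE₀ : 0 ≤ E₀ := add_nonneg (hD.energy_nonneg _ _ _) (hi0 _)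
  set B := Real.exp (2 * a * D.T) * (E₀ + C * D.T) with hB'
  have hB : 0 ≤ B := by positivity
  refine ⟨1 / (2 * a), 1 + B / c, by positivity, by positivity, ?_⟩
  intro N h hN hh hh1 θ φ S n hn
  have hN' : (0 : ℝ) < N := Nat.cast_pos.2 hN
  have hh0 : 0 < h := by rw [hh]; positivity
  have hhN : h * N = D.T := by rw [hh]; field_simp
  have hah : a * h ≤ 1 / 2 := by
    have := mul_le_mul_of_nonneg_left hh1 ha.le
    rwa [show a * (1 / (2 * a)) = 1 / 2 by field_simp] at this
  -- only the equations in `A` are used, so the bound that enters it need not be uniform in `N`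
  have A := S.isApproxSolution hD hh0 (K := ∑ k ∈ Finset.range N, ‖φ (k + 1)‖)
    (Finset.sum_nonneg fun _ _ => norm_nonneg _) fun k hk =>
      Finset.single_le_sum (f := fun k => ‖φ (k + 1)‖) (fun _ _ => norm_nonneg _)
        (Finset.mem_range.2 hk)
  have hstep : ∀ k < N, energy D (D.emb (discreteV h D.v₀ φ (k + 1))) (φ (k + 1)) (θ (k + 1))
      + i (φ (k + 1)) + 0 ≤ energy D (D.emb (discreteV h D.v₀ φ k)) (φ k) (θ k) + i (φ k)
      + a * h * (energy D (D.emb (discreteV h D.v₀ φ (k + 1))) (φ (k + 1)) (θ (k + 1))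
        + i (φ (k + 1))) + h * C := by
    intro k hk
    have main := hD.energy_increment hh0 (w := diffQuot h φ k) rfl (A.m_mem k hk) (A.eq₁ k hk)
      (A.eq₂ k hk (diffQuot h φ k))
    have hd := hD.dissipation_nonneg (diffQuot h φ k) (A.m_mem k hk)
    have e0 : energy D (D.emb (diffQuot h φ k) - D.emb (discreteV h D.v₀ φ (k + 1)))
        (φ (k + 1) - φ (k + 1)) (θ (k + 1) - θ (k + 1)) = 0 := by
      simp [energy, discreteV]
    rw [e0, inner_add_left] at main
    have hpot : i (φ (k + 1)) - i (φ k) ≤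
        h * inner ℝ (D.Φ (D.emb (φ (k + 1)))) (D.emb (diffQuot h φ k)) := by
      refine (hi _ _).trans_eq ?_
      rw [diffQuot, ← map_sub, map_smul, real_inner_smul_right, mul_inv_cancel_left₀ hh0.ne']
    have hcw : discreteV h D.v₀ φ (k + 1) = diffQuot h φ k := rfl
    rw [hcw] at main ⊢
    have hφi := hi0 (φ (k + 1))
    generalize diffQuot h φ k = w at *
    generalize φ (k + 1) = e at *
    generalize θ (k + 1) = τ at *
    have r1 : ‖D.ell (D.emb e)‖ ≤ Cl * ‖D.emb‖ * ‖e‖ + 2 * (‖D.ell 0‖ / 2) * 1 := by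
      have h1 := hl.norm_sub_le (D.emb e) 0
      have h2 := norm_add_le (D.ell (D.emb e) - D.ell 0) (D.ell 0)
      rw [sub_add_cancel] at h2
      rw [sub_zero] at h1
      have h3 : (Cl : ℝ) * ‖D.emb e‖ ≤ Cl * (‖D.emb‖ * ‖e‖) := by
        gcongr; exact D.emb.le_opNorm e
      linarith
    have r2 := lower_order_le (h := 1) (K := ‖D.ell 0‖ / 2) (s₁ := 0) (s₂ := 0) (G := ‖D.emb‖)
      hη.le (norm_nonneg (D.emb w)) (Y := ‖D.emb w‖) (by linarith [norm_nonneg (D.ell 0)]) r1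
      (ε := ‖D.emb τ‖) (τ := ‖D.emb τ‖) (by simp)
    have r3 : -inner ℝ (D.ell (D.emb e)) (D.emb w) ≤ ‖D.ell (D.emb e)‖ * ‖D.emb w‖ :=
      (neg_le_abs _).trans (abs_real_inner_le_norm _ _)
    have r4 : ‖D.emb w‖ * ‖D.emb e‖ ≤ ‖D.emb w‖ * (‖D.emb‖ * ‖e‖) :=
      mul_le_mul_of_nonneg_left (D.emb.le_opNorm e) (norm_nonneg _)
    have r5 := hcoer (D.emb w) e τ
    have r6 : (1 + 2 * (Cl * ‖D.emb‖ + ‖D.emb‖) ^ 2 + 2 * D.η ^ 2)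
        * (‖D.emb w‖ ^ 2 + ‖e‖ ^ 2 + ‖D.emb τ‖ ^ 2) ≤ a * (energy D (D.emb w) e τ + i e) := by
      rw [ha', div_mul_eq_mul_div, le_div_iff₀ hc, mul_assoc]
      refine mul_le_mul_of_nonneg_left ?_ (by positivity)
      linarith
    have r7 : ‖D.emb w‖ * (D.η * ‖D.emb τ‖ + ‖D.emb e‖) - inner ℝ (D.ell (D.emb e)) (D.emb w)
        ≤ a * (energy D (D.emb w) e τ + i e) + C := by
      have : C * (1 ^ 2 + 0 ^ 2 + 0 ^ 2) = C := by ring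
      rw [← hC', this] at r2
      linarith
    have r8 := mul_le_mul_of_nonneg_left r7 hh0.le
    have r9 := mul_nonneg hh0.le hd
    linarith
  have hg := discrete_gronwall
    (E := fun k => energy D (D.emb (discreteV h D.v₀ φ k)) (φ k) (θ k) + i (φ k))
    (D := fun _ => 0) (ρ := fun _ => h * C) (a := a * h) (by positivity) hah (N := N)
    (fun k => add_nonneg (hD.energy_nonneg _ _ _) (hi0 _)) (fun _ _ => le_rfl)
    (fun _ _ => by positivity) hstep (n + 1) hn
  have h0 : energy D (D.emb (discreteV h D.v₀ φ 0)) (φ 0) (θ 0) + i (φ 0) = E₀ := by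
    rw [S.φ_zero, S.θ_zero]; rfl
  simp only [h0, Finset.sum_const, smul_zero, add_zero, Finset.card_range, nsmul_eq_mul] at hg
  have hn' : ((n + 1 : ℕ) : ℝ) ≤ N := Nat.cast_le.2 hn
  have hfin : energy D (D.emb (discreteV h D.v₀ φ (n + 1))) (φ (n + 1)) (θ (n + 1))
      + i (φ (n + 1)) ≤ B := by
    refine hg.trans ?_
    have e1 : h * ((n + 1 : ℕ) : ℝ) ≤ D.T := by rw [← hhN]; gcongr
    have e2 : 2 * (a * h) * ((n + 1 : ℕ) : ℝ) ≤ 2 * a * D.T := by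
      calc _ = 2 * a * (h * ((n + 1 : ℕ) : ℝ)) := by ring
        _ ≤ _ := by gcongr
    have e3 : ((n + 1 : ℕ) : ℝ) * (h * C) ≤ C * D.T := by
      calc _ = C * (h * ((n + 1 : ℕ) : ℝ)) := by ring
        _ ≤ _ := by gcongr
    rw [hB']
    gcongr
  have h1 := hcoer (D.emb (discreteV h D.v₀ φ (n + 1))) (φ (n + 1)) (θ (n + 1))
  have h2 : ‖φ (n + 1)‖ ^ 2 ≤ B / c := by
    rw [le_div_iff₀ hc]
    have := hi0 (φ (n + 1))
    nlinarith [mul_nonneg hc.le (sq_nonneg ‖D.emb (discreteV h D.v₀ φ (n + 1))‖),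
      mul_nonneg hc.le (sq_nonneg ‖D.emb (θ (n + 1))‖)]
  nlinarith [sq_nonneg (‖φ (n + 1)‖ - 1)]

end StabilityTheorem

/-! ### Cells of the time grid, mean values, primitives -/

section Cells

/-- The cell number `n` of the time grid of step size `h`. -/
def cell (h : ℝ) (n : ℕ) : Set ℝ := Ioo (n * h) (((n + 1 : ℕ) : ℝ) * h)

theorem grid_le {T h : ℝ} {N n : ℕ} (hh : 0 < h) (hN : h * N = T) (hn : n ≤ N) : n * h ≤ T := by
  rw [← hN, mul_comm h]
  have : (n : ℝ) ≤ N := Nat.cast_le.2 hn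
  gcongr

theorem grid_mem_Icc {T h : ℝ} {N n : ℕ} (hh : 0 < h) (hN : h * N = T) (hn : n ≤ N) :
    n * h ∈ Icc 0 T := ⟨by positivity, grid_le hh hN hn⟩

theorem grid_lt {h : ℝ} (hh : 0 < h) (n : ℕ) : n * h < ((n + 1 : ℕ) : ℝ) * h := by
  push_cast; linarith

theorem cell_subset {T h : ℝ} {N n : ℕ} (hh : 0 < h) (hN : h * N = T) (hn : n < N) :
    cell h n ⊆ Ioo 0 T :=
  Ioo_subset_Ioo (by positivity) (grid_le hh hN hn)

theorem measurableSet_cell (h : ℝ) (n : ℕ) : MeasurableSet (cell h n) := measurableSet_Ioo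

theorem volume_cell {h : ℝ} (hh : 0 < h) (n : ℕ) : volume.real (cell h n) = h := by
  rw [cell, Real.volume_real_Ioo_of_le (grid_lt hh n).le]; push_cast; ring

theorem volume_cell_lt_top (h : ℝ) (n : ℕ) : volume (cell h n) < ⊤ := by
  simp [cell]

theorem floor_eq_of_mem_cell {h t : ℝ} (hh : 0 < h) {n : ℕ} (ht : t ∈ cell h n) : ⌊t / h⌋₊ = n := by
  rw [Nat.floor_eq_iff (div_nonneg ((by positivity : 0 ≤ n * h).trans ht.1.le) hh.le),
    le_div_iff₀ hh, div_lt_iff₀ hh]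
  have := ht.2
  push_cast at this
  exact ⟨ht.1.le, this⟩

theorem floor_bounds {T h t : ℝ} {N : ℕ} (hh : 0 < h) (hN : h * N = T) (ht : t ∈ Ioo 0 T) :
    ⌊t / h⌋₊ < N ∧ t ∈ Icc (⌊t / h⌋₊ * h) (((⌊t / h⌋₊ + 1 : ℕ) : ℝ) * h) := by
  have h0 : 0 ≤ t / h := div_nonneg ht.1.le hh.le
  refine ⟨?_, ?_, ?_⟩
  · rw [Nat.floor_lt h0, div_lt_iff₀ hh, mul_comm, hN]; exact ht.2
  · rw [← le_div_iff₀ hh]; exact Nat.floor_le h0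
  · rw [← div_le_iff₀ hh]; push_cast; exact (Nat.lt_floor_add_one _).le

theorem setIntegral_Ioo_eq_intervalIntegral {X : Type*} [NormedAddCommGroup X] [NormedSpace ℝ X]
    (f : ℝ → X) {a b : ℝ} (hab : a ≤ b) : ∫ t in Ioo a b, f t = ∫ t in a..b, f t := by
  rw [intervalIntegral.integral_of_le hab, integral_Ioc_eq_integral_Ioo]

theorem intervalIntegrable_of_integrableOn_Ioo {X : Type*} [NormedAddCommGroup X]
    {f : ℝ → X} {T a b : ℝ} (hf : IntegrableOn f (Ioo 0 T)) (ha : a ∈ Icc 0 T) (hb : b ∈ Icc 0 T) :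
    IntervalIntegrable f volume a b := by
  have h1 : IntegrableOn f (Icc 0 T) := by rwa [integrableOn_Icc_iff_integrableOn_Ioo]
  exact (h1.mono_set (uIcc_subset_Icc ha hb)).intervalIntegrable

/-- An integral over `(0, T)` is the sum of the integrals over the cells. -/
theorem sum_integral_cell {X : Type*} [NormedAddCommGroup X] [NormedSpace ℝ X] {f : ℝ → X}
    {T h : ℝ} {N : ℕ} (hh : 0 < h) (hN : h * N = T) (hf : IntegrableOn f (Ioo 0 T)) :
    ∑ n ∈ Finset.range N, ∫ t in cell h n, f t = ∫ t in Ioo 0 T, f t := by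
  have h1 : ∀ n ∈ Finset.range N, ∫ t in cell h n, f t =
      ∫ t in ((n : ℝ) * h)..(((n + 1 : ℕ) : ℝ) * h), f t := fun n _ =>
    setIntegral_Ioo_eq_intervalIntegral f (grid_lt hh n).le
  rw [Finset.sum_congr rfl h1, intervalIntegral.sum_integral_adjacent_intervals
    (a := fun n : ℕ => (n : ℝ) * h) fun n hn => intervalIntegrable_of_integrableOn_Ioo hf
      (grid_mem_Icc hh hN hn.le) (grid_mem_Icc hh hN hn)]
  have hT : 0 ≤ T := by rw [← hN]; positivity
  rw [setIntegral_Ioo_eq_intervalIntegral f hT, ← hN]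
  simp [mul_comm]

theorem setIntegral_cell_le_of_le {f : ℝ → ℝ} {h C : ℝ} (hh : 0 < h) {n : ℕ}
    (hf : IntegrableOn f (cell h n)) (hC : ∀ᵐ t ∂volume.restrict (cell h n), f t ≤ C) :
    ∫ t in cell h n, f t ≤ C * h := by
  refine (integral_mono_ae hf (integrableOn_const (volume_cell_lt_top h n).ne) hC).trans_eq ?_
  rw [setIntegral_const, volume_cell hh, smul_eq_mul, mul_comm]

/-- Cauchy-Schwarz inequality on a cell. -/
theorem sq_setIntegral_cell_le {f : ℝ → ℝ} {h : ℝ} (hh : 0 < h) {n : ℕ}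
    (hf : IntegrableOn f (cell h n)) (hf2 : IntegrableOn (fun t => f t ^ 2) (cell h n)) :
    (∫ t in cell h n, f t) ^ 2 ≤ h * ∫ t in cell h n, f t ^ 2 := by
  set c := h⁻¹ * ∫ t in cell h n, f t with hc
  have h0 : 0 ≤ ∫ t in cell h n, (f t - c) ^ 2 := integral_nonneg fun t => sq_nonneg _
  have h1 : ∫ t in cell h n, (f t - c) ^ 2 =
      (∫ t in cell h n, f t ^ 2) - 2 * c * (∫ t in cell h n, f t) + c ^ 2 * h := by
    have e : ∀ t, (f t - c) ^ 2 = f t ^ 2 - 2 * c * f t + c ^ 2 := fun t => by ring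
    simp only [e]
    have i1 : Integrable (fun t => 2 * c * f t) (volume.restrict (cell h n)) := hf.const_mul _
    have i2 : Integrable (fun t => f t ^ 2 - 2 * c * f t) (volume.restrict (cell h n)) :=
      hf2.sub i1
    have i3 : Integrable (fun _ => c ^ 2) (volume.restrict (cell h n)) :=
      integrableOn_const (volume_cell_lt_top h n).ne
    rw [integral_add i2 i3, integral_sub hf2 i1, integral_const_mul, setIntegral_const,
      volume_cell hh, smul_eq_mul, mul_comm h]
  have h2 : (∫ t in cell h n, f t) = h * c := by rw [hc, mul_inv_cancel_left₀ hh.ne']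
  rw [h1, h2] at h0
  rw [h2]
  nlinarith

theorem InLp.exists_bound {T : ℝ} {X : Type*} [NormedAddCommGroup X] {f : ℝ → X} (hf : InLp T ⊤ f) :
    ∃ C : ℝ, 0 ≤ C ∧ ∀ᵐ t ∂volume.restrict (Ioo 0 T), ‖f t‖ ≤ C := by
  have hfin : eLpNormEssSup f (volume.restrict (Ioo 0 T)) ≠ ⊤ := by
    rw [← eLpNorm_exponent_top]; exact hf.2.ne
  refine ⟨_, ENNReal.toReal_nonneg (a := eLpNormEssSup f (volume.restrict (Ioo 0 T))), ?_⟩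
  filter_upwards [ae_le_eLpNormEssSup (f := f) (μ := volume.restrict (Ioo 0 T))] with t ht
  rw [← toReal_enorm]
  exact ENNReal.toReal_mono hfin ht

variable {X : Type*} [NormedAddCommGroup X] [NormedSpace ℝ X]

/-- The mean value of `f` over the cell number `n`. -/
noncomputable def cellMean (h : ℝ) (f : ℝ → X) (n : ℕ) : X := h⁻¹ • ∫ t in cell h n, f t

theorem smul_cellMean {h : ℝ} (hh : 0 < h) (f : ℝ → X) (n : ℕ) :
    h • cellMean h f n = ∫ t in cell h n, f t := smul_inv_smul₀ hh.ne' _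

theorem cellMean_clm_comp [CompleteSpace X] {Y : Type*} [NormedAddCommGroup Y]
    [NormedSpace ℝ Y] [CompleteSpace Y] (A : X →L[ℝ] Y) {h : ℝ} {f : ℝ → X} {n : ℕ}
    (hf : IntegrableOn f (cell h n)) : cellMean h (fun t => A (f t)) n = A (cellMean h f n) := by
  rw [cellMean, cellMean, map_smul, A.integral_comp_comm hf]

theorem norm_cellMean_sub_le [CompleteSpace X] {f : ℝ → X} {h B : ℝ} (hh : 0 < h) {n : ℕ} {x : X}
    (hf : IntegrableOn f (cell h n)) (hB : ∀ᵐ t ∂volume.restrict (cell h n), ‖f t - x‖ ≤ B) :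
    ‖cellMean h f n - x‖ ≤ B := by
  have h1 : cellMean h f n - x = h⁻¹ • ∫ t in cell h n, (f t - x) := by
    rw [integral_sub hf (integrableOn_const (volume_cell_lt_top h n).ne), setIntegral_const,
      volume_cell hh, smul_sub, inv_smul_smul₀ hh.ne', cellMean]
  rw [h1, norm_smul, norm_inv, Real.norm_of_nonneg hh.le, inv_mul_le_iff₀ hh]
  refine (norm_setIntegral_le_of_norm_le_const_ae (volume_cell_lt_top h n) hB).trans_eq ?_
  rw [volume_cell hh, mul_comm]

/-- The function with the derivative `g` and the value `x` at `0`. -/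
noncomputable def primitive (x : X) (g : ℝ → X) (t : ℝ) : X := x + ∫ s in (0 : ℝ)..t, g s

theorem primitive_zero (x : X) (g : ℝ → X) : primitive x g 0 = x := by simp [primitive]

theorem primitive_sub {x : X} {g : ℝ → X} {T a b : ℝ} (hg : IntegrableOn g (Ioo 0 T))
    (ha : a ∈ Icc 0 T) (hb : b ∈ Icc 0 T) :
    primitive x g b - primitive x g a = ∫ s in a..b, g s := by
  have h0 : (0 : ℝ) ∈ Icc 0 T := ⟨le_rfl, ha.1.trans ha.2⟩
  rw [primitive, primitive, add_sub_add_left_eq_sub, intervalIntegral.integral_interval_sub_left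
    (intervalIntegrable_of_integrableOn_Ioo hg h0 hb)
    (intervalIntegrable_of_integrableOn_Ioo hg h0 ha)]

theorem primitive_grid_sub {x : X} {g : ℝ → X} {T h : ℝ} {N n : ℕ} (hh : 0 < h)
    (hN : h * N = T) (hg : IntegrableOn g (Ioo 0 T)) (hn : n < N) :
    primitive x g ((n + 1 : ℕ) * h) - primitive x g (n * h) = ∫ s in cell h n, g s := by
  rw [primitive_sub hg (grid_mem_Icc hh hN hn.le) (grid_mem_Icc hh hN hn), cell,
    setIntegral_Ioo_eq_intervalIntegral g (grid_lt hh n).le]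

/-- Oscillation of a primitive on a closed cell. -/
theorem norm_primitive_sub_le {x : X} {g : ℝ → X} {T h : ℝ} {N n : ℕ} (hh : 0 < h)
    (hN : h * N = T) (hg : IntegrableOn g (Ioo 0 T)) (hn : n < N) {s t : ℝ}
    (hs : s ∈ Icc (n * h) ((n + 1 : ℕ) * h)) (ht : t ∈ Icc (n * h) ((n + 1 : ℕ) * h)) :
    ‖primitive x g t - primitive x g s‖ ≤ ∫ r in cell h n, ‖g r‖ := by
  have hsub : Icc (n * h) ((n + 1 : ℕ) * h) ⊆ Icc 0 T :=
    Icc_subset_Icc (grid_mem_Icc hh hN hn.le).1 (grid_mem_Icc hh hN hn).2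
  rw [primitive_sub hg (hsub hs) (hsub ht)]
  refine intervalIntegral.norm_integral_le_integral_norm_uIoc.trans ?_
  rw [cell, ← integral_Ioc_eq_integral_Ioo]
  have h1 : IntegrableOn (fun r => ‖g r‖) (Ioc (n * h) ((n + 1 : ℕ) * h)) := by
    rw [integrableOn_Ioc_iff_integrableOn_Ioo]
    exact (hg.mono_set (cell_subset hh hN hn)).norm
  refine setIntegral_mono_set h1 (Eventually.of_forall fun _ => norm_nonneg _) ?_
  exact (Ioc_subset_Ioc (le_min hs.1 ht.1) (max_le hs.2 ht.2)).eventuallyLE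

/-- The mean value of a primitive over a cell differs from its values there by its variation. -/
theorem norm_cellMean_sub_primitive_le [CompleteSpace X] {x : X} {f g : ℝ → X} {T h : ℝ} {N n : ℕ}
    (hh : 0 < h) (hN : h * N = T) (hg : IntegrableOn g (Ioo 0 T)) (hf : IntegrableOn f (Ioo 0 T))
    (hfg : f =ᵐ[volume.restrict (Ioo 0 T)] primitive x g) (hn : n < N) {t : ℝ}
    (ht : t ∈ Icc (n * h) ((n + 1 : ℕ) * h)) :
    ‖cellMean h f n - primitive x g t‖ ≤ ∫ r in cell h n, ‖g r‖ := by
  refine norm_cellMean_sub_le hh (hf.mono_set (cell_subset hh hN hn)) ?_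
  have h1 := ae_restrict_of_ae_restrict_of_subset (cell_subset hh hN hn) hfg
  filter_upwards [h1, ae_restrict_mem (measurableSet_cell h n)] with s hs hsc
  rw [hs]
  exact norm_primitive_sub_le hh hN hg hn ht (Ioo_subset_Icc_self hsc)

theorem ae_cell {T h : ℝ} {N n : ℕ} (hh : 0 < h) (hN : h * N = T) (hn : n < N) {p : ℝ → Prop}
    (hp : ∀ᵐ t ∂volume.restrict (Ioo 0 T), p t) : ∀ᵐ t ∂volume.restrict (cell h n), p t :=
  ae_restrict_of_ae_restrict_of_subset (cell_subset hh hN hn) hp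

/-- A selfadjoint operator commutes with integration, since membership in its graph is tested with
continuous functionals. -/
theorem integral_mem_graph {H : Type*} [NormedAddCommGroup H] [InnerProductSpace ℝ H]
    [CompleteSpace H] {A : H →ₗ.[ℝ] H} (hA : IsSelfAdjoint A) {μ : Measure ℝ} {f g : ℝ → H}
    (hf : Integrable f μ) (hg : Integrable g μ) (h : ∀ᵐ t ∂μ, (f t, g t) ∈ A.graph) :
    (∫ t, f t ∂μ, ∫ t, g t ∂μ) ∈ A.graph := by
  rw [mem_graph_iff_of_isSelfAdjoint hA]
  intro a ha
  rw [← integral_inner hf, ← integral_inner hg]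
  refine integral_congr_ae ?_
  filter_upwards [h] with t ht
  exact (mem_graph_iff_of_isSelfAdjoint hA).1 ht a ha

end Cells

/-! ### Samples of the exact solution -/

section Sampling

variable {V H : Type*} [NormedAddCommGroup V] [InnerProductSpace ℝ V]
  [NormedAddCommGroup H] [InnerProductSpace ℝ H]
  {D : Data V H} {θ φ θt v : ℝ → V} {z : ℝ → H}

/-- An initial value that is attained in a larger space determines the constant of integration. -/
theorem ae_eq_primitive_of_initialValue {X Y : Type*} [NormedAddCommGroup X] [NormedSpace ℝ X]
    [CompleteSpace X] [NormedAddCommGroup Y] [NormedSpace ℝ Y] {T : ℝ} (hT : 0 < T)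
    {p : ℝ≥0∞} (hp : 1 ≤ p) {f g : ℝ → X} (h : InW1p T p f g) (A : X →L[ℝ] Y)
    (hA : Function.Injective A) {x : X} (hi : HasInitialValue T (fun t => A (f t)) (A x)) :
    f =ᵐ[volume.restrict (Ioo 0 T)] primitive x g := by
  obtain ⟨x', hx'⟩ := h.exists_ae_eq_primitive hT hp
  have hc := continuousOn_primitive hT (h.2.1.integrableOn hp) x'
  have h1 := hi.eq_of_ae_eq hT (A.continuous.comp_continuousOn hc)
    (by filter_upwards [hx'] with t ht; simp [ht])
  have h2 : x' = x := hA (by simpa using h1)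
  filter_upwards [hx'] with t ht
  rw [ht, h2]; rfl

theorem IsSolution.integrableOn_θt (S : IsSolution D θ φ θt v z) : IntegrableOn θt (Ioo 0 D.T) :=
  S.θ_H1.2.1.integrableOn (by norm_num)

theorem IsSolution.integrableOn_θ (S : IsSolution D θ φ θt v z) : IntegrableOn θ (Ioo 0 D.T) :=
  S.θ_Linfty.integrableOn le_top

theorem IsSolution.integrableOn_φ (S : IsSolution D θ φ θt v z) : IntegrableOn φ (Ioo 0 D.T) :=
  S.φ_W1V.1.integrableOn le_top

theorem IsSolution.integrableOn_v (S : IsSolution D θ φ θt v z) : IntegrableOn v (Ioo 0 D.T) :=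
  S.φ_W1V.2.1.integrableOn le_top

theorem IsSolution.integrableOn_z (S : IsSolution D θ φ θt v z) : IntegrableOn z (Ioo 0 D.T) :=
  S.v_W1H.2.1.integrableOn le_top

theorem IsSolution.integrableOn_sq_θt (S : IsSolution D θ φ θt v z) :
    IntegrableOn (fun t => ‖θt t‖ ^ 2) (Ioo 0 D.T) :=
  MemLp.integrable_norm_pow (p := 2) S.θ_H1.2.1 (by norm_num)

/-- Along a solution `A₁ θ = -(θₜ + η v)` takes its values in `V`. -/
theorem IsSolution.A₁_θ_graph (S : IsSolution D θ φ θt v z) :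
    ∀ᵐ t ∂volume.restrict (Ioo 0 D.T),
      (D.emb (θ t), -D.emb (θt t + D.η • v t)) ∈ D.A₁.graph := by
  filter_upwards [S.θ_A₁.1, S.eq₁] with t h1 h2
  rw [mem_graph_iff_ev]
  refine ⟨h1, ?_⟩
  rw [map_add, map_smul]
  exact eq_neg_of_add_eq_zero_right h2

theorem primitive_bound {X : Type*} [NormedAddCommGroup X] [NormedSpace ℝ X] {T C : ℝ} (hC : 0 ≤ C)
    (x : X) {g : ℝ → X} (hg : ∀ᵐ t ∂volume.restrict (Ioo 0 T), ‖g t‖ ≤ C) {t : ℝ}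
    (ht : t ∈ Icc 0 T) : ‖primitive x g t‖ ≤ ‖x‖ + C * T := by
  refine (norm_add_le _ _).trans (add_le_add_right ?_ _)
  rw [← setIntegral_Ioo_eq_intervalIntegral g ht.1]
  refine (norm_setIntegral_le_of_norm_le_const_ae (by simp) (ae_restrict_of_ae_restrict_of_subset
    (Ioo_subset_Ioo_right ht.2) hg)).trans ?_
  rw [Real.volume_real_Ioo_of_le ht.1, sub_zero]
  exact mul_le_mul_of_nonneg_left ht.2 hC

variable [CompleteSpace H]

theorem IsSolution.v_ae_eq (S : IsSolution D θ φ θt v z) (hD : Assumptions D) :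
    (fun t => D.emb (v t)) =ᵐ[volume.restrict (Ioo 0 D.T)] primitive (D.emb D.v₀) z :=
  ae_eq_primitive_of_initialValue hD.T_pos le_top S.v_W1H (ContinuousLinearMap.id ℝ H)
    Function.injective_id S.v_init

theorem IsSolution.integrableOn_force (S : IsSolution D θ φ θt v z) (hD : Assumptions D) :
    IntegrableOn (fun t => D.Φ (D.emb (φ t)) + D.ell (D.emb (φ t))) (Ioo 0 D.T) := by
  obtain ⟨C, -, hC⟩ := hD.ell_lipschitz
  refine Integrable.add (S.Φφ.integrableOn le_top) ?_
  have h1 : IntegrableOn (fun t => D.emb (φ t)) (Ioo 0 D.T) := S.φ_W1H.1.integrableOn le_top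
  have hm : AEStronglyMeasurable (fun t => D.ell (D.emb (φ t))) (volume.restrict (Ioo 0 D.T)) :=
    hC.continuous.comp_aestronglyMeasurable h1.aestronglyMeasurable
  have h2 : IntegrableOn (fun t => C * ‖D.emb (φ t)‖ + ‖D.ell 0‖) (Ioo 0 D.T) :=
    (h1.norm.const_mul _).add (integrableOn_const (by simp))
  refine Integrable.mono' h2 hm (Eventually.of_forall fun t => ?_)
  have h3 := hC.norm_sub_le (D.emb (φ t)) 0
  have h4 := norm_add_le (D.ell (D.emb (φ t)) - D.ell 0) (D.ell 0)
  rw [sub_add_cancel] at h4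
  rw [sub_zero] at h3
  linarith

/-- The wave equation in variational form; all terms are bounded functionals of `z`, `v`, `φ`, `θ`
and of the force, which commute with taking means. -/
theorem IsSolution.weak_eq₂ (S : IsSolution D θ φ θt v z) (hD : Assumptions D) :
    ∀ᵐ t ∂volume.restrict (Ioo 0 D.T), ∀ ζ : V,
      inner ℝ (D.emb ζ) (D.L (z t)) + D.B₁s.flip ζ (v t) + D.A₂s.flip ζ (φ t)
        + inner ℝ (D.emb ζ) (D.Φ (D.emb (φ t)) + D.ell (D.emb (φ t))) = D.B₂s.flip ζ (θ t) := by
  filter_upwards [S.eq₂, S.v_B₁.1, S.φ_A₂.1, S.θ_A₁.1] with t h1 h2 h3 h4 ζ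
  have h5 := congrArg (fun x => inner ℝ (D.emb ζ) x) h1
  simp only [inner_add_right] at h5
  simp only [ContinuousLinearMap.flip_apply]
  rw [hD.B₁_ext.2.2 _ h2, hD.A₂_ext.2.2 _ h3, hD.B₂_ext.2.2 _ (hD.A₁_le_B₂ h4), inner_add_right]
  rw [real_inner_comm (D.emb ζ) (ev D.B₁ _), real_inner_comm (D.emb ζ) (ev D.A₂ _),
    real_inner_comm (D.emb ζ) (ev D.B₂ _)]
  linarith

/-- The difference quotient of a primitive is the mean value of the derivative. -/
theorem diffQuot_primitive {x : V} {g : ℝ → V} {T h : ℝ} {N n : ℕ} (hh : 0 < h) (hN : h * N = T)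
    (hg : IntegrableOn g (Ioo 0 T)) (hn : n < N) :
    diffQuot h (fun n => primitive x g (n * h)) n = cellMean h g n := by
  rw [diffQuot, primitive_grid_sub hh hN hg hn, cellMean]

variable [CompleteSpace V]

theorem IsSolution.θ_ae_eq (S : IsSolution D θ φ θt v z) (hD : Assumptions D) :
    θ =ᵐ[volume.restrict (Ioo 0 D.T)] primitive D.θ₀ θt :=
  ae_eq_primitive_of_initialValue hD.T_pos (by norm_num) S.θ_H1 D.emb hD.emb_injective S.θ_init

theorem IsSolution.φ_ae_eq (S : IsSolution D θ φ θt v z) (hD : Assumptions D) :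
    φ =ᵐ[volume.restrict (Ioo 0 D.T)] primitive D.φ₀ v :=
  ae_eq_primitive_of_initialValue hD.T_pos le_top S.φ_W1V D.emb hD.emb_injective S.φ_init

/-- The averaged heat equation: the mean value of `θ` lies in `D(A₁)`. -/
theorem IsSolution.cellMean_A₁ (S : IsSolution D θ φ θt v z) (hD : Assumptions D) {N n : ℕ} {h : ℝ}
    (hh : 0 < h) (hN : h * N = D.T) (hn : n < N) :
    (D.emb (cellMean h θ n), -D.emb (cellMean h θt n + D.η • cellMean h v n)) ∈ D.A₁.graph := by
  have hs := cell_subset hh hN hn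
  have i1 := S.integrableOn_θ.mono_set hs
  have i2 := S.integrableOn_θt.mono_set hs
  have i3 := S.integrableOn_v.mono_set hs
  have i4 : Integrable (fun t => θt t + D.η • v t) (volume.restrict (cell h n)) :=
    i2.add (i3.smul D.η)
  have h1 := integral_mem_graph hD.A₁_selfAdjoint (D.emb.integrable_comp i1)
    (D.emb.integrable_comp i4).neg (ae_cell hh hN hn S.A₁_θ_graph)
  have h2 := D.A₁.graph.smul_mem h⁻¹ h1
  simp only [Pi.neg_apply] at h2
  rw [integral_neg, D.emb.integral_comp_comm i1, D.emb.integral_comp_comm i4,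
    integral_add i2 (by exact i3.smul D.η), integral_smul, Prod.smul_mk, smul_neg, ← map_smul,
    ← map_smul, smul_add, smul_comm h⁻¹ D.η] at h2
  exact h2

/-- The averaged wave equation. -/
theorem IsSolution.cellMean_eq₂ (S : IsSolution D θ φ θt v z) (hD : Assumptions D) {N n : ℕ}
    {h : ℝ} (hh : 0 < h) (hN : h * N = D.T) (hn : n < N) (ζ : V) :
    inner ℝ (D.L (cellMean h z n)) (D.emb ζ) + D.B₁s (cellMean h v n) ζ
      + D.A₂s (cellMean h φ n) ζ
      + inner ℝ (cellMean h (fun t => D.Φ (D.emb (φ t)) + D.ell (D.emb (φ t))) n) (D.emb ζ)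
      = D.B₂s (cellMean h θ n) ζ := by
  have hs := cell_subset hh hN hn
  have i1 := S.integrableOn_θ.mono_set hs
  have i2 := S.integrableOn_z.mono_set hs
  have i3 := S.integrableOn_v.mono_set hs
  have i4 := S.integrableOn_φ.mono_set hs
  have i5 := (S.integrableOn_force hD).mono_set hs
  let ι : H →L[ℝ] ℝ := innerSL ℝ (D.emb ζ)
  have hι : ∀ x, ι x = inner ℝ x (D.emb ζ) := fun x => real_inner_comm _ _
  have j1 : Integrable (fun t => ι (D.L (z t))) (volume.restrict (cell h n)) :=
    (ι.comp D.L).integrable_comp i2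
  have j2 : Integrable (fun t => D.B₁s.flip ζ (v t)) (volume.restrict (cell h n)) :=
    (D.B₁s.flip ζ).integrable_comp i3
  have j3 : Integrable (fun t => D.A₂s.flip ζ (φ t)) (volume.restrict (cell h n)) :=
    (D.A₂s.flip ζ).integrable_comp i4
  have j4 : Integrable (fun t => ι (D.Φ (D.emb (φ t)) + D.ell (D.emb (φ t))))
    (volume.restrict (cell h n)) := ι.integrable_comp i5
  have key : ∫ t in cell h n, (ι (D.L (z t)) + D.B₁s.flip ζ (v t) + D.A₂s.flip ζ (φ t)
      + ι (D.Φ (D.emb (φ t)) + D.ell (D.emb (φ t)))) = ∫ t in cell h n, D.B₂s.flip ζ (θ t) := by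
    refine integral_congr_ae ?_
    filter_upwards [ae_cell hh hN hn (S.weak_eq₂ hD)] with t ht
    exact ht ζ
  have j12 : Integrable (fun t => ι (D.L (z t)) + D.B₁s.flip ζ (v t))
    (volume.restrict (cell h n)) := j1.add j2
  have j123 : Integrable (fun t => ι (D.L (z t)) + D.B₁s.flip ζ (v t) + D.A₂s.flip ζ (φ t))
    (volume.restrict (cell h n)) := j12.add j3
  have e1 : ∫ t in cell h n, ι (D.L (z t)) = ι (D.L (∫ t in cell h n, z t)) :=
    (ι.comp D.L).integral_comp_comm i2
  rw [integral_add j123 j4, integral_add j12 j3, integral_add j1 j2, e1,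
    (D.B₁s.flip ζ).integral_comp_comm i3, (D.A₂s.flip ζ).integral_comp_comm i4,
    ι.integral_comp_comm i5, (D.B₂s.flip ζ).integral_comp_comm i1] at key
  have k2 := congrArg (fun x => h⁻¹ * x) key
  simp only [mul_add] at k2
  simp only [← smul_eq_mul, ← map_smul] at k2
  simp only [ContinuousLinearMap.flip_apply, hι] at k2
  exact k2

/-- The grid values and the cell means of an exact solution form an approximate solution, with a
constant that does not depend on the grid. -/
theorem IsSolution.exists_isApproxSolution (S : IsSolution D θ φ θt v z) (hD : Assumptions D) :
    ∃ K : ℝ, 0 < K ∧ ∀ (N : ℕ) (h : ℝ), 0 < h → h * N = D.T →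
      IsApproxSolution D N h K (fun n => primitive D.θ₀ θt (n * h))
        (fun n => primitive D.φ₀ v (n * h)) (fun n => primitive (D.emb D.v₀) z (n * h))
        (cellMean h θ) (cellMean h φ)
        (cellMean h fun t => D.Φ (D.emb (φ t)) + D.ell (D.emb (φ t))) := by
  have hT := hD.T_pos
  obtain ⟨Kv, hKv, hv⟩ := S.φ_W1V.2.1.exists_bound
  obtain ⟨Kz, hKz, hz⟩ := S.v_W1H.2.1.exists_bound
  set Kφ := ‖D.φ₀‖ + Kv * D.T with hKφ
  obtain ⟨C, hC, hlip⟩ := hD.force_lipschitz Kφ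
  set J := ∫ t in Ioo 0 D.T, ‖θt t‖ ^ 2 with hJ
  have hJ0 : 0 ≤ J := integral_nonneg fun t => by positivity
  have hKφ0 : 0 ≤ Kφ := by positivity
  refine ⟨Kz + Kv + J + C * Kv + Kφ + 1, by positivity, fun N h hh hN => ?_⟩
  have hCKv : 0 ≤ C * Kv := by positivity
  have hbound : ∀ t ∈ Icc 0 D.T, ‖primitive D.φ₀ v t‖ ≤ Kφ := fun t ht =>
    primitive_bound hKv _ hv ht
  have hcell : ∀ n < N, ∫ t in cell h n, ‖v t‖ ≤ Kv * h := fun n hn =>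
    setIntegral_cell_le_of_le hh (S.integrableOn_v.mono_set (cell_subset hh hN hn)).norm
      (ae_cell hh hN hn hv)
  have hdq : ∀ n < N, diffQuot h (fun n => primitive D.φ₀ v (n * h)) n = cellMean h v n :=
    fun n hn => diffQuot_primitive hh hN S.integrableOn_v hn
  have hdqθ : ∀ n < N, diffQuot h (fun n => primitive D.θ₀ θt (n * h)) n = cellMean h θt n :=
    fun n hn => diffQuot_primitive hh hN S.integrableOn_θt hn
  have hr : ∀ n : ℕ, ((n + 1 : ℕ) : ℝ) * h ∈ Icc (n * h) ((n + 1 : ℕ) * h) := fun n =>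
    ⟨(grid_lt hh n).le, le_rfl⟩
  constructor
  · simp [primitive_zero]
  · simp [primitive_zero]
  · simp [primitive_zero]
  · intro n hn
    exact (mem_graph_iff_ev.1 (S.cellMean_A₁ hD hh hN hn)).1
  · intro n hn
    rw [(mem_graph_iff_ev.1 (S.cellMean_A₁ hD hh hN hn)).2, hdq n hn, hdqθ n hn, add_neg_cancel]
  · intro n hn ζ
    rw [hdq n hn, primitive_grid_sub hh hN S.integrableOn_z hn]
    exact S.cellMean_eq₂ hD hh hN hn ζ
  · intro n hn
    rw [hdq n hn, ← cellMean_clm_comp D.emb (S.integrableOn_v.mono_set (cell_subset hh hN hn))]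
    refine (norm_cellMean_sub_primitive_le hh hN S.integrableOn_z
      (D.emb.integrable_comp S.integrableOn_v) (S.v_ae_eq hD) hn (hr n)).trans ?_
    refine (setIntegral_cell_le_of_le hh (S.integrableOn_z.mono_set (cell_subset hh hN hn)).norm
      (ae_cell hh hN hn hz)).trans ?_
    gcongr; linarith
  · intro n hn
    refine (norm_cellMean_sub_primitive_le hh hN S.integrableOn_v
      S.integrableOn_φ (S.φ_ae_eq hD) hn (hr n)).trans ((hcell n hn).trans ?_)
    gcongr; linarith
  · calc ∑ n ∈ Finset.range N, ‖cellMean h θ n - primitive D.θ₀ θt ((n + 1 : ℕ) * h)‖ ^ 2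
        ≤ ∑ n ∈ Finset.range N, h * ∫ t in cell h n, ‖θt t‖ ^ 2 := by
          refine Finset.sum_le_sum fun n hn => ?_
          have hn := Finset.mem_range.1 hn
          refine (pow_le_pow_left₀ (norm_nonneg _) (norm_cellMean_sub_primitive_le hh hN
            S.integrableOn_θt S.integrableOn_θ (S.θ_ae_eq hD) hn (hr n)) 2).trans ?_
          exact sq_setIntegral_cell_le hh
            (S.integrableOn_θt.mono_set (cell_subset hh hN hn)).norm
            (S.integrableOn_sq_θt.mono_set (cell_subset hh hN hn))
      _ = J * h := by
          rw [← Finset.mul_sum, sum_integral_cell hh hN S.integrableOn_sq_θt, mul_comm]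
      _ ≤ _ := by gcongr; linarith
  · intro n hn
    refine (norm_cellMean_sub_le (B := C * (Kv * h)) hh
      ((S.integrableOn_force hD).mono_set (cell_subset hh hN hn)) ?_).trans ?_
    · filter_upwards [ae_cell hh hN hn (S.φ_ae_eq hD), ae_restrict_mem (measurableSet_cell h n)]
        with t ht htc
      rw [ht]
      refine (hlip _ _ (hbound t (Ioo_subset_Icc_self (cell_subset hh hN hn htc)))
        (hbound _ (grid_mem_Icc hh hN hn))).2.trans ?_
      refine mul_le_mul_of_nonneg_left ?_ hC.le
      exact (norm_primitive_sub_le hh hN S.integrableOn_v hn (hr n)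
        (Ioo_subset_Icc_self htc)).trans (hcell n hn)
    · rw [← mul_assoc]
      gcongr; linarith
  · intro n hn
    refine (hbound _ (grid_mem_Icc hh hN hn)).trans ?_
    linarith

end Sampling

/-! ### Uniqueness, errors at the grid points -/

section Uniqueness

/-- Continuous functions whose grid values agree up to `o(1)` as the grid is refined coincide. -/
theorem eqOn_of_grid_close {Y : Type*} [NormedAddCommGroup Y] {T : ℝ} (hT : 0 < T) {F G : ℝ → Y}
    (hF : ContinuousOn F (Icc 0 T)) (hG : ContinuousOn G (Icc 0 T)) {C h₁ : ℝ} (hh₁ : 0 < h₁)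
    (h : ∀ (N : ℕ) (h : ℝ), 0 < N → h = T / N → h ≤ h₁ → ∀ n ≤ N,
      ‖F (n * h) - G (n * h)‖ ^ 2 ≤ C * h) : EqOn F G (Icc 0 T) := by
  intro t ht
  -- the grid points `⌊N t / T⌋ T / N` tend to `t`
  have hd : ContinuousOn (fun t => ‖F t - G t‖ ^ 2) (Icc 0 T) := (hF.sub hG).norm.pow 2
  have h0 : Tendsto (fun N : ℕ => T / (N : ℝ)) atTop (nhds 0) :=
    tendsto_const_div_atTop_nhds_zero_nat T
  have hfl : ∀ N : ℕ, ⌊t / T * (N : ℝ)⌋₊ ≤ N := fun N => by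
    refine Nat.floor_le_of_le ?_
    have : t / T ≤ 1 := (div_le_one hT).2 ht.2
    have hN : (0 : ℝ) ≤ N := Nat.cast_nonneg N
    nlinarith
  have hmem : ∀ N : ℕ, 0 < N → (⌊t / T * (N : ℝ)⌋₊ : ℝ) * (T / N) ∈ Icc 0 T := fun N hN => by
    have hN' : (0 : ℝ) < N := Nat.cast_pos.2 hN
    exact grid_mem_Icc (N := N) (by positivity) (by field_simp) (hfl N)
  have hlim : Tendsto (fun N : ℕ => (⌊t / T * (N : ℝ)⌋₊ : ℝ) * (T / N)) atTop (nhds t) := by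
    have h1 := (tendsto_nat_floor_mul_div_atTop (R := ℝ) (div_nonneg ht.1 hT.le)).comp
      tendsto_natCast_atTop_atTop
    have h2 := h1.mul_const T
    rw [div_mul_cancel₀ _ hT.ne'] at h2
    refine h2.congr fun N => ?_
    simp only [Function.comp]
    ring
  have hlim' : Tendsto (fun N : ℕ => ‖F ((⌊t / T * (N : ℝ)⌋₊ : ℝ) * (T / N))
      - G ((⌊t / T * (N : ℝ)⌋₊ : ℝ) * (T / N))‖ ^ 2) atTop (nhds (‖F t - G t‖ ^ 2)) := by
    refine (hd t ht).tendsto.comp (tendsto_nhdsWithin_iff.2 ⟨hlim, ?_⟩)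
    filter_upwards [eventually_gt_atTop 0] with N hN using hmem N hN
  have hle : ‖F t - G t‖ ^ 2 ≤ C * 0 := by
    refine le_of_tendsto_of_tendsto hlim' (h0.const_mul C) ?_
    filter_upwards [eventually_gt_atTop 0, h0.eventually (gt_mem_nhds hh₁)] with N hN hN'
    exact h N _ hN rfl hN'.le _ (hfl N)
  rw [mul_zero] at hle
  have h3 : ‖F t - G t‖ = 0 := by nlinarith [norm_nonneg (F t - G t)]
  exact sub_eq_zero.1 (norm_eq_zero.1 h3)

variable {V H : Type*} [NormedAddCommGroup V] [InnerProductSpace ℝ V]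
  [NormedAddCommGroup H] [InnerProductSpace ℝ H] [CompleteSpace H]
  {D : Data V H}

/-- The energy estimate in terms of norms. -/
theorem Assumptions.exists_energy_bounds (hD : Assumptions D) :
    ∃ C : ℝ, 0 < C ∧ ∀ y e τ, ‖y‖ ^ 2 ≤ C * energy D y e τ ∧ ‖e‖ ^ 2 ≤ C * energy D y e τ ∧
      ‖D.emb τ‖ ^ 2 ≤ C * energy D y e τ ∧ D.B₂s τ τ ≤ C * energy D y e τ := by
  obtain ⟨c, hc, h⟩ := hD.energy_coercive
  have hη := hD.η_pos
  refine ⟨c⁻¹ + 2 * D.η, by positivity, fun y e τ => ?_⟩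
  have h1 := h y e τ
  have h0 := hD.energy_nonneg y e τ
  have h2 := hD.B₂s_le_energy y e τ
  have h3 : ‖y‖ ^ 2 + ‖e‖ ^ 2 + ‖D.emb τ‖ ^ 2 ≤ c⁻¹ * energy D y e τ := by
    rwa [le_inv_mul_iff₀ hc]
  have h4 : 0 ≤ 2 * D.η * energy D y e τ := by positivity
  have h5 : 0 ≤ c⁻¹ * energy D y e τ := by positivity
  have p1 := sq_nonneg ‖y‖
  have p2 := sq_nonneg ‖e‖
  have p3 := sq_nonneg ‖D.emb τ‖
  rw [add_mul]
  refine ⟨?_, ?_, ?_, ?_⟩ <;> linarith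

variable [CompleteSpace V]

/-- The exact solution is unique: the samples of two solutions are approximate solutions for every
step size, so that the stability of the scheme applies, and `h → 0`. -/
theorem IsSolution.unique (hD : Assumptions D) {θ φ θt v θ' φ' θt' v' : ℝ → V} {z z' : ℝ → H}
    (S : IsSolution D θ φ θt v z) (S' : IsSolution D θ' φ' θt' v' z') :
    θ =ᵐ[volume.restrict (Ioo 0 D.T)] θ' ∧ φ =ᵐ[volume.restrict (Ioo 0 D.T)] φ' ∧
      v =ᵐ[volume.restrict (Ioo 0 D.T)] v' := by
  have hT := hD.T_pos
  obtain ⟨K, hK, A⟩ := S.exists_isApproxSolution hD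
  obtain ⟨K', hK', A'⟩ := S'.exists_isApproxSolution hD
  obtain ⟨h₁, M, hh₁, hM, hst⟩ := hD.stability (K := max K K') (by positivity)
  obtain ⟨C, hC, hen⟩ := hD.exists_energy_bounds
  have key : ∀ (N : ℕ) (h : ℝ), 0 < N → h = D.T / N → h ≤ h₁ → ∀ n ≤ N,
      C * energy D (primitive (D.emb D.v₀) z (n * h) - primitive (D.emb D.v₀) z' (n * h))
        (primitive D.φ₀ v (n * h) - primitive D.φ₀ v' (n * h))
        (primitive D.θ₀ θt (n * h) - primitive D.θ₀ θt' (n * h)) ≤ C * M * h := by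
    intro N h hN hh hhh n hn
    have hN' : (0 : ℝ) < N := Nat.cast_pos.2 hN
    have hh0 : 0 < h := by rw [hh]; positivity
    have hhN : h * N = D.T := by rw [hh]; field_simp
    rw [mul_assoc]
    exact mul_le_mul_of_nonneg_left ((hst N h hN hh hhh _ _ _ _ _ _ _ _ _ _ _ _
      ((A N h hh0 hhN).mono hh0.le (le_max_left _ _))
      ((A' N h hh0 hhN).mono hh0.le (le_max_right _ _))).1 n hn) hC.le
  have e1 := eqOn_of_grid_close hT (continuousOn_primitive hT S.integrableOn_v D.φ₀)
    (continuousOn_primitive hT S'.integrableOn_v D.φ₀) hh₁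
    fun N h hN hh hhh n hn => (hen _ _ _).2.1.trans (key N h hN hh hhh n hn)
  have e2 := eqOn_of_grid_close hT (continuousOn_primitive hT S.integrableOn_z (D.emb D.v₀))
    (continuousOn_primitive hT S'.integrableOn_z (D.emb D.v₀)) hh₁
    fun N h hN hh hhh n hn => (hen _ _ _).1.trans (key N h hN hh hhh n hn)
  have e3 := eqOn_of_grid_close hT
    (D.emb.continuous.comp_continuousOn (continuousOn_primitive hT S.integrableOn_θt D.θ₀))
    (D.emb.continuous.comp_continuousOn (continuousOn_primitive hT S'.integrableOn_θt D.θ₀)) hh₁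
    fun N h hN hh hhh n hn => by
      refine le_trans ?_ ((hen _ _ _).2.2.1.trans (key N h hN hh hhh n hn))
      rw [map_sub]; rfl
  refine ⟨?_, ?_, ?_⟩
  · filter_upwards [S.θ_ae_eq hD, S'.θ_ae_eq hD, ae_restrict_mem measurableSet_Ioo] with t h h' ht
    rw [h, h']
    exact hD.emb_injective (e3 (Ioo_subset_Icc_self ht))
  · filter_upwards [S.φ_ae_eq hD, S'.φ_ae_eq hD, ae_restrict_mem measurableSet_Ioo] with t h h' ht
    rw [h, h']
    exact e1 (Ioo_subset_Icc_self ht)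
  · filter_upwards [S.v_ae_eq hD, S'.v_ae_eq hD, ae_restrict_mem measurableSet_Ioo] with t h h' ht
    refine hD.emb_injective ?_
    rw [h, h']
    exact e2 (Ioo_subset_Icc_self ht)

/-- Bounds of order `h` for the squared errors at the grid points, and for the squared errors of
the cell means. -/
structure NodalBounds (D : Data V H) (N : ℕ) (h C : ℝ) (θd φd : ℕ → V) (θ θt v : ℝ → V)
    (z : ℝ → H) : Prop where
  v_node : ∀ n ≤ N,
    ‖D.emb (discreteV h D.v₀ φd n) - primitive (D.emb D.v₀) z (n * h)‖ ^ 2 ≤ C * h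
  φ_node : ∀ n ≤ N, ‖φd n - primitive D.φ₀ v (n * h)‖ ^ 2 ≤ C * h
  θ_node : ∀ n ≤ N, ‖D.emb (θd n - primitive D.θ₀ θt (n * h))‖ ^ 2 ≤ C * h
  B₂_node : ∀ n ≤ N, D.B₂s (θd n - primitive D.θ₀ θt (n * h))
    (θd n - primitive D.θ₀ θt (n * h)) ≤ C * h
  sum_B₁ : ∑ n ∈ Finset.range N, h * D.B₁s (diffQuot h φd n - cellMean h v n)
    (diffQuot h φd n - cellMean h v n) ≤ C * h
  sum_θ : ∑ n ∈ Finset.range N, h * ‖θd (n + 1) - cellMean h θ n‖ ^ 2 ≤ C * h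
  sum_BA : ∑ n ∈ Finset.range N, h * inner ℝ (ev D.B₂ (D.emb (θd (n + 1) - cellMean h θ n)))
    (ev D.A₁ (D.emb (θd (n + 1) - cellMean h θ n))) ≤ C * h

/-- The error estimate at the grid points, from the stability of the scheme, applied to the discrete
solution and to the samples of the exact one. -/
theorem IsSolution.exists_nodalBounds (hD : Assumptions D) {θ φ θt v : ℝ → V} {z : ℝ → H}
    (S : IsSolution D θ φ θt v z) : ∃ h₁ C : ℝ, 0 < h₁ ∧ 0 < C ∧ ∀ (N : ℕ) (h : ℝ), 0 < N →
      h = D.T / N → h ≤ h₁ → ∀ θd φd : ℕ → V, IsDiscreteSolution D N h θd φd →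
      NodalBounds D N h C θd φd θ θt v z := by
  have hT := hD.T_pos
  have hη := hD.η_pos
  obtain ⟨K, hK, A⟩ := S.exists_isApproxSolution hD
  obtain ⟨h₂, R, hh₂, hR, hdis⟩ := hD.discrete_bound
  obtain ⟨h₁, M, hh₁, hM, hst⟩ := hD.stability (K := max K R) (by positivity)
  obtain ⟨C, hC, hen⟩ := hD.exists_energy_bounds
  obtain ⟨κ, hκ, hA₁⟩ := hD.A₁_coercive 1 one_pos
  set G := ‖D.emb‖ with hG
  have hG0 : 0 ≤ G := norm_nonneg _
  set C₂ := κ⁻¹ * (M + D.T * (2 * (C * M)) + 2 * G ^ 2 * K * D.T) with hC₂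
  have hC₂0 : 0 ≤ C₂ := by positivity
  refine ⟨min h₁ h₂, C * M + M + C₂ + D.η * M, by positivity, by positivity, ?_⟩
  intro N h hN hh hhh θd φd S'
  have hN' : (0 : ℝ) < N := Nat.cast_pos.2 hN
  have hh0 : 0 < h := by rw [hh]; positivity
  have hhN : h * N = D.T := by rw [hh]; field_simp
  have hhT : h ≤ D.T := by
    have := grid_le (n := 1) hh0 hhN hN
    simpa using this
  have B := S'.isApproxSolution hD hh0 hR.le
    (hdis N h hN hh (hhh.trans (min_le_right _ _)) θd φd S')
  have A := A N h hh0 hhN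
  have st := hst N h hN hh (hhh.trans (min_le_left _ _)) _ _ _ _ _ _ _ _ _ _ _ _
    (B.mono hh0.le (le_max_right _ _)) (A.mono hh0.le (le_max_left _ _))
  have hMh : 0 ≤ M * h := by positivity
  have hCMh : 0 ≤ C * M * h := by positivity
  have hCh : 0 ≤ C₂ * h := by positivity
  have hηh : 0 ≤ D.η * M * h := by positivity
  have expand : (C * M + M + C₂ + D.η * M) * h = C * M * h + M * h + C₂ * h + D.η * M * h := by
    ring
  have node : ∀ n ≤ N, C * energy D
      (D.emb (discreteV h D.v₀ φd n) - primitive (D.emb D.v₀) z (n * h))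
      (φd n - primitive D.φ₀ v (n * h)) (θd n - primitive D.θ₀ θt (n * h)) ≤ C * M * h :=
    fun n hn => by
      rw [mul_assoc]; exact mul_le_mul_of_nonneg_left (st.1 n hn) hC.le
  have hmem : ∀ n < N, D.emb (θd (n + 1) - cellMean h θ n) ∈ D.A₁.domain := fun n hn => by
    rw [map_sub]; exact D.A₁.domain.sub_mem (S'.θ_mem n hn) (A.m_mem n hn)
  have hdq : ∀ n < N, diffQuot h (fun n => primitive D.φ₀ v (n * h)) n = cellMean h v n :=
    fun n hn => diffQuot_primitive hh0 hhN S.integrableOn_v hn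
  have hsum : ∑ n ∈ Finset.range N, h * dissipation D (diffQuot h φd n - cellMean h v n)
      (θd (n + 1) - cellMean h θ n) ≤ M * h := by
    refine le_trans (le_of_eq ?_) st.2
    refine Finset.sum_congr rfl fun n hn => ?_
    rw [hdq n (Finset.mem_range.1 hn)]
  refine ⟨fun n hn => ?_, fun n hn => ?_, fun n hn => ?_, fun n hn => ?_, ?_, ?_, ?_⟩
  · have := (hen _ _ _).1.trans (node n hn); linarith
  · have := (hen _ _ _).2.1.trans (node n hn); linarith
  · have := (hen _ _ _).2.2.1.trans (node n hn); linarith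
  · have := (hen _ _ _).2.2.2.trans (node n hn); linarith
  · have h1 : ∑ n ∈ Finset.range N, h * D.B₁s (diffQuot h φd n - cellMean h v n)
        (diffQuot h φd n - cellMean h v n) ≤ M * h := by
      refine le_trans (Finset.sum_le_sum fun n hn => ?_) hsum
      obtain ⟨p1, p2, p3⟩ := hD.dissipation_terms_nonneg (diffQuot h φd n - cellMean h v n)
        (hmem n (Finset.mem_range.1 hn))
      have p4 := mul_nonneg (inv_nonneg.2 hη.le) p2
      refine mul_le_mul_of_nonneg_left ?_ hh0.le
      unfold dissipation; linarith
    linarith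
  -- `A₁` is coercive up to the norm of `H`, which is controlled at the right endpoint of the cell
  · have h1 : ∀ n ∈ Finset.range N, h * ‖θd (n + 1) - cellMean h θ n‖ ^ 2 ≤
        κ⁻¹ * (h * dissipation D (diffQuot h φd n - cellMean h v n) (θd (n + 1) - cellMean h θ n)
          + h * (2 * (C * M * h))
          + 2 * G ^ 2 * h * ‖cellMean h θ n - primitive D.θ₀ θt ((n + 1 : ℕ) * h)‖ ^ 2) := by
      intro n hn
      have hn := Finset.mem_range.1 hn
      obtain ⟨p1, p2, p3⟩ := hD.dissipation_terms_nonneg (diffQuot h φd n - cellMean h v n)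
        (hmem n hn)
      have p4 := mul_nonneg (inv_nonneg.2 hη.le) p2
      have q1 := hA₁ (θd (n + 1) - cellMean h θ n)
      have q2 := (hen _ _ _).2.2.1.trans (node (n + 1) hn)
      have q3 : ‖D.emb (θd (n + 1) - cellMean h θ n)‖ ≤
          ‖D.emb (θd (n + 1) - primitive D.θ₀ θt ((n + 1 : ℕ) * h))‖
          + G * ‖cellMean h θ n - primitive D.θ₀ θt ((n + 1 : ℕ) * h)‖ := by
        have e : D.emb (θd (n + 1) - cellMean h θ n) =
            D.emb (θd (n + 1) - primitive D.θ₀ θt ((n + 1 : ℕ) * h))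
            - D.emb (cellMean h θ n - primitive D.θ₀ θt ((n + 1 : ℕ) * h)) := by
          rw [← map_sub]; congr 1; abel
        rw [e]
        exact (norm_sub_le _ _).trans (add_le_add_right (D.emb.le_opNorm _) _)
      have q4 : ‖D.emb (θd (n + 1) - cellMean h θ n)‖ ^ 2 ≤ 2 * (C * M * h)
          + 2 * G ^ 2 * ‖cellMean h θ n - primitive D.θ₀ θt ((n + 1 : ℕ) * h)‖ ^ 2 := by
        generalize ‖D.emb (θd (n + 1) - primitive D.θ₀ θt ((n + 1 : ℕ) * h))‖ = x at *
        generalize ‖cellMean h θ n - primitive D.θ₀ θt ((n + 1 : ℕ) * h)‖ = y at *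
        have := pow_le_pow_left₀ (norm_nonneg _) q3 2
        nlinarith [sq_nonneg (x - G * y)]
      have q5 : κ * ‖θd (n + 1) - cellMean h θ n‖ ^ 2 ≤
          dissipation D (diffQuot h φd n - cellMean h v n) (θd (n + 1) - cellMean h θ n)
          + 2 * (C * M * h)
          + 2 * G ^ 2 * ‖cellMean h θ n - primitive D.θ₀ θt ((n + 1 : ℕ) * h)‖ ^ 2 := by
        have : D.A₁s (θd (n + 1) - cellMean h θ n) (θd (n + 1) - cellMean h θ n) ≤
          dissipation D (diffQuot h φd n - cellMean h v n) (θd (n + 1) - cellMean h θ n) := by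
          unfold dissipation; linarith
        linarith
      rw [le_inv_mul_iff₀ hκ]
      have := mul_le_mul_of_nonneg_left q5 hh0.le
      linarith
    have h2 : ∑ n ∈ Finset.range N, h * ‖θd (n + 1) - cellMean h θ n‖ ^ 2 ≤ C₂ * h := by
      refine (Finset.sum_le_sum h1).trans ?_
      rw [← Finset.mul_sum, Finset.sum_add_distrib, Finset.sum_add_distrib,
        ← Finset.mul_sum (f := fun n =>
          ‖cellMean h θ n - primitive D.θ₀ θt ((n + 1 : ℕ) * h)‖ ^ 2), hC₂,
        mul_assoc κ⁻¹]
      refine mul_le_mul_of_nonneg_left ?_ (by positivity)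
      simp only [Finset.sum_const, Finset.card_range, nsmul_eq_mul]
      have r1 : (N : ℝ) * (h * (2 * (C * M * h))) = D.T * (2 * (C * M)) * h := by
        rw [← hhN]; ring
      have r2 : 2 * G ^ 2 * h * ∑ n ∈ Finset.range N,
          ‖cellMean h θ n - primitive D.θ₀ θt ((n + 1 : ℕ) * h)‖ ^ 2 ≤
          2 * G ^ 2 * K * D.T * h := by
        calc _ ≤ 2 * G ^ 2 * h * (K * h) := by gcongr; exact A.m_near
          _ = 2 * G ^ 2 * K * h * h := by ring
          _ ≤ 2 * G ^ 2 * K * D.T * h := by gcongr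
      linarith
    linarith
  · have h1 : ∑ n ∈ Finset.range N, h * inner ℝ (ev D.B₂ (D.emb (θd (n + 1) - cellMean h θ n)))
        (ev D.A₁ (D.emb (θd (n + 1) - cellMean h θ n))) ≤ D.η * M * h := by
      rw [mul_assoc]
      refine le_trans ?_ (mul_le_mul_of_nonneg_left hsum hη.le)
      rw [Finset.mul_sum]
      refine Finset.sum_le_sum fun n hn => ?_
      obtain ⟨p1, p2, p3⟩ := hD.dissipation_terms_nonneg (diffQuot h φd n - cellMean h v n)
        (hmem n (Finset.mem_range.1 hn))
      unfold dissipation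
      have : D.η * (h * (D.η⁻¹ * inner ℝ (ev D.B₂ (D.emb (θd (n + 1) - cellMean h θ n)))
        (ev D.A₁ (D.emb (θd (n + 1) - cellMean h θ n))))) =
        h * inner ℝ (ev D.B₂ (D.emb (θd (n + 1) - cellMean h θ n)))
        (ev D.A₁ (D.emb (θd (n + 1) - cellMean h θ n))) := by
        field_simp
      have r1 : 0 ≤ D.η * (h * D.B₁s (diffQuot h φd n - cellMean h v n)
        (diffQuot h φd n - cellMean h v n)) := by positivity
      have r2 : 0 ≤ D.η * (h * D.A₁s (θd (n + 1) - cellMean h θ n)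
        (θd (n + 1) - cellMean h θ n)) := by positivity
      linarith
    linarith

end Uniqueness

/-! ### Norms over the time interval, oscillation over a cell -/

section Norms

variable {X : Type*} [NormedAddCommGroup X]

theorem inLp_top_of_sq_le {T Q : ℝ} {f : ℝ → X}
    (hf : AEStronglyMeasurable f (volume.restrict (Ioo 0 T)))
    (h : ∀ᵐ t ∂volume.restrict (Ioo 0 T), ‖f t‖ ^ 2 ≤ Q) :
    InLp T ⊤ f ∧ normLp T ⊤ f ≤ √Q := by
  have h1 : ∀ᵐ t ∂volume.restrict (Ioo 0 T), ‖f t‖ ≤ √Q := by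
    filter_upwards [h] with t ht using Real.le_sqrt_of_sq_le ht
  refine ⟨memLp_top_of_bound hf _ h1, ?_⟩
  refine ENNReal.toReal_le_of_le_ofReal (Real.sqrt_nonneg Q) ?_
  rw [eLpNorm_exponent_top]
  exact eLpNormEssSup_le_of_ae_bound h1

theorem normLp_two_le {T Q : ℝ} {f : ℝ → X} (hf : InLp T 2 f)
    (h : ∫ t in Ioo 0 T, ‖f t‖ ^ 2 ≤ Q) : normLp T 2 f ≤ √Q := by
  refine ENNReal.toReal_le_of_le_ofReal (Real.sqrt_nonneg Q) ?_
  rw [MemLp.eLpNorm_eq_integral_rpow_norm (by norm_num) (by norm_num) hf]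
  refine ENNReal.ofReal_le_ofReal ?_
  rw [Real.sqrt_eq_rpow]
  simp only [ENNReal.toReal_ofNat, Real.rpow_two]
  rw [one_div]
  exact Real.rpow_le_rpow (integral_nonneg fun t => by positivity) h (by norm_num)

theorem stronglyMeasurable_step (h : ℝ) (u : ℕ → X) :
    StronglyMeasurable fun t : ℝ => u ⌊t / h⌋₊ :=
  (StronglyMeasurable.of_discrete (f := u)).comp_measurable
    (Nat.measurable_floor.comp (measurable_id.div_const h))

theorem stronglyMeasurable_affine [NormedSpace ℝ X] (h : ℝ) (u w : ℕ → X) :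
    StronglyMeasurable fun t : ℝ => u ⌊t / h⌋₊ + (t - ⌊t / h⌋₊ * h) • w ⌊t / h⌋₊ := by
  refine (stronglyMeasurable_step h u).add
    (StronglyMeasurable.smul ?_ (stronglyMeasurable_step h w))
  exact stronglyMeasurable_id.sub ((stronglyMeasurable_step h fun n => (n : ℝ)).mul_const h)

theorem sq_norm_sub_le {a b c : X} {P r : ℝ} (h1 : ‖a - b‖ ^ 2 ≤ P) (h2 : ‖b - c‖ ^ 2 ≤ r) :
    ‖a - c‖ ^ 2 ≤ 2 * P + 2 * r := by
  have h3 := norm_add_le (a - b) (b - c)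
  rw [sub_add_sub_cancel] at h3
  have := pow_le_pow_left₀ (norm_nonneg _) h3 2
  nlinarith [sq_nonneg (‖a - b‖ - ‖b - c‖)]

variable [NormedSpace ℝ X]

theorem form_add_le (b : X →L[ℝ] StrongDual ℝ X) (hb : ∀ x, 0 ≤ b x x)
    (hs : ∀ x y, b x y = b y x) (x y : X) : b (x + y) (x + y) ≤ 2 * b x x + 2 * b y y := by
  have h := hb (x - y)
  have h1 := hs x y
  simp only [map_add, map_sub, add_apply, sub_apply] at h ⊢
  linarith

theorem form_convex_le (b : X →L[ℝ] StrongDual ℝ X) (hb : ∀ x, 0 ≤ b x x)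
    (hs : ∀ x y, b x y = b y x) {x y : X} {s Q : ℝ} (hs0 : 0 ≤ s) (hs1 : s ≤ 1)
    (hx : b x x ≤ Q) (hy : b y y ≤ Q) : b ((1 - s) • x + s • y) ((1 - s) • x + s • y) ≤ Q := by
  have h := hb (x - y)
  have h1 := hs x y
  simp only [map_add, map_sub, map_smul, add_apply, sub_apply, smul_apply, smul_eq_mul] at h ⊢
  nlinarith [mul_nonneg (mul_nonneg hs0 (sub_nonneg.2 hs1)) h,
    mul_nonneg hs0 (sub_nonneg.2 hy), mul_nonneg (sub_nonneg.2 hs1) (sub_nonneg.2 hx)]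

theorem sq_norm_convex_le {x y : X} {s Q : ℝ} (hs0 : 0 ≤ s) (hs1 : s ≤ 1)
    (hx : ‖x‖ ^ 2 ≤ Q) (hy : ‖y‖ ^ 2 ≤ Q) : ‖(1 - s) • x + s • y‖ ^ 2 ≤ Q := by
  have hQ : 0 ≤ Q := (sq_nonneg _).trans hx
  have h1 : ‖(1 - s) • x + s • y‖ ≤ √Q := by
    refine (norm_add_le _ _).trans ?_
    rw [norm_smul, norm_smul, Real.norm_of_nonneg hs0, Real.norm_of_nonneg (sub_nonneg.2 hs1)]
    have a1 := Real.le_sqrt_of_sq_le hx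
    have a2 := Real.le_sqrt_of_sq_le hy
    nlinarith [mul_le_mul_of_nonneg_left a1 (sub_nonneg.2 hs1), mul_le_mul_of_nonneg_left a2 hs0]
  calc _ ≤ √Q ^ 2 := by gcongr
    _ = Q := Real.sq_sqrt hQ

/-- Oscillation over a cell of the primitive of a bounded function. -/
theorem sq_norm_primitive_sub_le_of_bound {x : X} {g : ℝ → X} {T h K : ℝ} {N : ℕ}
    (hh : 0 < h) (hN : h * N = T) (hg : IntegrableOn g (Ioo 0 T))
    (hgK : ∀ᵐ t ∂volume.restrict (Ioo 0 T), ‖g t‖ ≤ K) {n : ℕ} (hn : n < N) {s t : ℝ}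
    (hs : s ∈ Icc (n * h) ((n + 1 : ℕ) * h)) (ht : t ∈ Icc (n * h) ((n + 1 : ℕ) * h)) :
    ‖primitive x g t - primitive x g s‖ ^ 2 ≤ K ^ 2 * T * h := by
  have h1 := norm_primitive_sub_le (x := x) hh hN hg hn hs ht
  have h2 := setIntegral_cell_le_of_le hh (hg.mono_set (cell_subset hh hN hn)).norm
    (ae_cell hh hN hn hgK)
  have hhT : h ≤ T := by
    have := grid_le (n := 1) hh hN (by lia)
    simpa using this
  calc _ ≤ (K * h) ^ 2 := pow_le_pow_left₀ (norm_nonneg _) (h1.trans h2) 2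
    _ = K ^ 2 * h * h := by ring
    _ ≤ K ^ 2 * T * h := by gcongr

/-- Oscillation over a cell of the primitive of a square integrable function. -/
theorem sq_norm_primitive_sub_le_of_sq {x : X} {g : ℝ → X} {T h : ℝ} {N : ℕ}
    (hh : 0 < h) (hN : h * N = T) (hg : IntegrableOn g (Ioo 0 T))
    (hg2 : IntegrableOn (fun t => ‖g t‖ ^ 2) (Ioo 0 T)) {n : ℕ} (hn : n < N) {s t : ℝ}
    (hs : s ∈ Icc (n * h) ((n + 1 : ℕ) * h)) (ht : t ∈ Icc (n * h) ((n + 1 : ℕ) * h)) :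
    ‖primitive x g t - primitive x g s‖ ^ 2 ≤ (∫ r in Ioo 0 T, ‖g r‖ ^ 2) * h := by
  have h1 := norm_primitive_sub_le (x := x) hh hN hg hn hs ht
  have h2 := sq_setIntegral_cell_le hh (hg.mono_set (cell_subset hh hN hn)).norm
    (hg2.mono_set (cell_subset hh hN hn))
  have h3 : ∫ r in cell h n, ‖g r‖ ^ 2 ≤ ∫ r in Ioo 0 T, ‖g r‖ ^ 2 :=
    setIntegral_mono_set hg2 (Eventually.of_forall fun _ => by positivity)
      (cell_subset hh hN hn).eventuallyLE
  calc _ ≤ (∫ r in cell h n, ‖g r‖) ^ 2 := pow_le_pow_left₀ (norm_nonneg _) h1 2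
    _ ≤ h * ∫ r in cell h n, ‖g r‖ ^ 2 := h2
    _ ≤ h * ∫ r in Ioo 0 T, ‖g r‖ ^ 2 := by gcongr
    _ = _ := mul_comm _ _

end Norms

/-! ### Errors in `L^∞` in time -/

section UniformErrors

variable {V H : Type*} [NormedAddCommGroup V] [InnerProductSpace ℝ V]

theorem stronglyMeasurable_hatInterp (h : ℝ) (u : ℕ → V) : StronglyMeasurable (hatInterp h u) :=
  stronglyMeasurable_affine h u (diffQuot h u)

/-- The affine interpolant is a convex combination of the two adjacent grid values. -/
theorem exists_hatInterp_eq {T h t : ℝ} {N : ℕ} (hh : 0 < h) (hN : h * N = T) (ht : t ∈ Ioo 0 T)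
    (u : ℕ → V) : ∃ s : ℝ, 0 ≤ s ∧ s ≤ 1 ∧
      ∀ y, hatInterp h u t - y = (1 - s) • (u ⌊t / h⌋₊ - y) + s • (u (⌊t / h⌋₊ + 1) - y) := by
  obtain ⟨-, h1, h2⟩ := floor_bounds hh hN ht
  refine ⟨(t - ⌊t / h⌋₊ * h) / h, by apply div_nonneg _ hh.le; linarith, ?_, fun y => ?_⟩
  · rw [div_le_one hh]; push_cast at h2; linarith
  · rw [hatInterp, diffQuot, smul_smul, ← div_eq_mul_inv]
    module

theorem sq_norm_hatInterp_sub_le {Y : Type*} [NormedAddCommGroup Y] [NormedSpace ℝ Y]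
    (A : V →L[ℝ] Y) {T h t : ℝ} {N : ℕ} (hh : 0 < h) (hN : h * N = T) (ht : t ∈ Ioo 0 T)
    {u : ℕ → V} {y : Y} {Q : ℝ}
    (h1 : ‖A (u ⌊t / h⌋₊) - y‖ ^ 2 ≤ Q) (h2 : ‖A (u (⌊t / h⌋₊ + 1)) - y‖ ^ 2 ≤ Q) :
    ‖A (hatInterp h u t) - y‖ ^ 2 ≤ Q := by
  obtain ⟨s, hs0, hs1, hs⟩ := exists_hatInterp_eq hh hN ht u
  have e : A (hatInterp h u t) - y = (1 - s) • (A (u ⌊t / h⌋₊) - y)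
      + s • (A (u (⌊t / h⌋₊ + 1)) - y) := by
    have := congrArg A (hs 0)
    simp only [sub_zero, map_add, map_smul] at this
    rw [this]
    module
  rw [e]
  exact sq_norm_convex_le hs0 hs1 h1 h2

variable [NormedAddCommGroup H] [InnerProductSpace ℝ H] [CompleteSpace H]
  {D : Data V H} {θ φ θt v : ℝ → V} {z : ℝ → H}

theorem left_mem_cell {h : ℝ} (hh : 0 < h) (n : ℕ) :
    (n : ℝ) * h ∈ Icc (n * h) ((n + 1 : ℕ) * h) := ⟨le_rfl, (grid_lt hh n).le⟩

theorem right_mem_cell {h : ℝ} (hh : 0 < h) (n : ℕ) :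
    ((n + 1 : ℕ) : ℝ) * h ∈ Icc (n * h) ((n + 1 : ℕ) * h) := ⟨(grid_lt hh n).le, le_rfl⟩

/-- The velocity error in `L^∞(0, T; H)`, weighted with `L^{1/2}`. -/
theorem IsSolution.velocity_error (S : IsSolution D θ φ θt v z) (hD : Assumptions D) {C : ℝ}
    (hC : 0 < C) : ∃ M : ℝ, 0 ≤ M ∧ ∀ (N : ℕ) (h : ℝ) (θd φd : ℕ → V), 0 < h → h * N = D.T →
      NodalBounds D N h C θd φd θ θt v z →
      InLp D.T ⊤ (fun t => ev (posSqrt ((D.L : H →ₗ[ℝ] H).toPMap ⊤))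
        (D.emb (hatInterp h (discreteV h D.v₀ φd) t - v t))) ∧
      normLp D.T ⊤ (fun t => ev (posSqrt ((D.L : H →ₗ[ℝ] H).toPMap ⊤))
        (D.emb (hatInterp h (discreteV h D.v₀ φd) t - v t))) ≤ √(M * h) := by
  obtain ⟨K, hK, hz⟩ := S.v_W1H.2.1.exists_bound
  have hT := hD.T_pos
  have hLs := isSelfAdjoint_toPMap_top hD.L_symm
  have hLp : ∀ x ∈ ((D.L : H →ₗ[ℝ] H).toPMap ⊤).domain,
      0 ≤ inner ℝ (ev ((D.L : H →ₗ[ℝ] H).toPMap ⊤) x) x := fun x _ => by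
    rw [ev_toPMap_top]; exact hD.L_nonneg x
  obtain ⟨A, hA⟩ := exists_clm_ev_posSqrt hLs hLp
  refine ⟨‖D.L‖ * (2 * C + 2 * (K ^ 2 * D.T)), by positivity, fun N h θd φd hh hN B => ?_⟩
  refine inLp_top_of_sq_le ?_ ?_
  · have h1 : AEStronglyMeasurable (fun t => D.emb (hatInterp h (discreteV h D.v₀ φd) t - v t))
        (volume.restrict (Ioo 0 D.T)) :=
      D.emb.continuous.comp_aestronglyMeasurable
        ((stronglyMeasurable_hatInterp h _).aestronglyMeasurable.sub
          S.integrableOn_v.aestronglyMeasurable)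
    refine (A.continuous.comp_aestronglyMeasurable
      (h1.add (D.L.continuous.comp_aestronglyMeasurable h1))).congr
      (Eventually.of_forall fun t => ?_)
    have := hA (D.emb (hatInterp h (discreteV h D.v₀ φd) t - v t)) Submodule.mem_top
    rw [ev_toPMap_top] at this
    exact this
  · filter_upwards [S.v_ae_eq hD, ae_restrict_mem measurableSet_Ioo] with t hvt ht
    obtain ⟨hn, hmem⟩ := floor_bounds hh hN ht
    rw [(norm_ev_posSqrt_sq hLs hLp Submodule.mem_top).2, ev_toPMap_top]
    have h1 : ‖D.emb (hatInterp h (discreteV h D.v₀ φd) t - v t)‖ ^ 2 ≤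
        2 * (C * h) + 2 * (K ^ 2 * D.T * h) := by
      rw [map_sub, hvt]
      refine sq_norm_hatInterp_sub_le D.emb hh hN ht ?_ ?_
      · exact sq_norm_sub_le (B.v_node _ hn.le) (sq_norm_primitive_sub_le_of_bound hh hN
          S.integrableOn_z hz hn hmem (left_mem_cell hh _))
      · exact sq_norm_sub_le (B.v_node _ hn) (sq_norm_primitive_sub_le_of_bound hh hN
          S.integrableOn_z hz hn hmem (right_mem_cell hh _))
    generalize D.emb (hatInterp h (discreteV h D.v₀ φd) t - v t) = x at h1
    calc inner ℝ (D.L x) x ≤ ‖D.L‖ * ‖x‖ * ‖x‖ :=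
          (real_inner_le_norm _ _).trans (by gcongr; exact D.L.le_opNorm x)
      _ = ‖D.L‖ * ‖x‖ ^ 2 := by ring
      _ ≤ ‖D.L‖ * (2 * (C * h) + 2 * (K ^ 2 * D.T * h)) := by gcongr
      _ = _ := by ring

/-- `B₂^{1/2}` is bounded relative to `A₁`. -/
theorem Assumptions.exists_clm_sqrt_B₂ (hD : Assumptions D) : ∃ A : H →L[ℝ] H,
    ∀ x ∈ D.A₁.domain, A (x + ev D.A₁ x) = ev (posSqrt D.B₂) x := by
  obtain ⟨C, hC, hB⟩ := hD.B₂_bound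
  have hB₂p : ∀ x ∈ D.B₂.domain, 0 ≤ inner ℝ (ev D.B₂ x) x := fun x hx =>
    inner_ev_nonneg hD.B₂_maxMonotone hx
  have hA₁p : ∀ x ∈ D.A₁.domain, 0 ≤ inner ℝ (ev D.A₁ x) x := fun x hx =>
    inner_ev_nonneg hD.A₁_maxMonotone hx
  refine exists_clm_ev_eq hD.A₁_selfAdjoint hA₁p
    (fun x hx => (norm_ev_posSqrt_sq hD.B₂_selfAdjoint hB₂p (hD.A₁_le_B₂ hx)).1)
    (M := 2 * C + 1) fun x hx => ?_
  have h1 := (norm_ev_posSqrt_sq hD.B₂_selfAdjoint hB₂p (hD.A₁_le_B₂ hx)).2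
  have h2 := real_inner_le_norm (ev D.B₂ x) x
  have h3 := hB x hx
  obtain ⟨h4, h5⟩ := norm_le_norm_add_of_inner_nonneg (hA₁p x hx)
  have h6 : ‖ev D.B₂ x‖ ≤ 2 * C * ‖x + ev D.A₁ x‖ := by
    refine h3.trans ?_
    rw [mul_comm 2 C, mul_assoc]
    gcongr
    linarith
  refine abs_le_of_sq_le_sq' ?_ (by positivity) |>.2
  rw [h1]
  refine h2.trans ?_
  have h7 := mul_le_mul h6 h4 (norm_nonneg _) (by positivity)
  have h8 : 0 ≤ (4 * C ^ 2 + 2 * C + 1) * ‖x + ev D.A₁ x‖ ^ 2 := by positivity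
  nlinarith

variable [CompleteSpace V]

/-- The displacement error in `L^∞(0, T; V)`. -/
theorem IsSolution.displacement_error (S : IsSolution D θ φ θt v z) (hD : Assumptions D) {C : ℝ}
    (hC : 0 < C) : ∃ M : ℝ, 0 ≤ M ∧ ∀ (N : ℕ) (h : ℝ) (θd φd : ℕ → V), 0 < h → h * N = D.T →
      NodalBounds D N h C θd φd θ θt v z →
      InLp D.T ⊤ (fun t => hatInterp h φd t - φ t) ∧
      normLp D.T ⊤ (fun t => hatInterp h φd t - φ t) ≤ √(M * h) := by
  obtain ⟨K, hK, hv⟩ := S.φ_W1V.2.1.exists_bound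
  have hT := hD.T_pos
  refine ⟨2 * C + 2 * (K ^ 2 * D.T), by positivity, fun N h θd φd hh hN B => ?_⟩
  refine inLp_top_of_sq_le ((stronglyMeasurable_hatInterp h _).aestronglyMeasurable.sub
    S.integrableOn_φ.aestronglyMeasurable) ?_
  filter_upwards [S.φ_ae_eq hD, ae_restrict_mem measurableSet_Ioo] with t hφt ht
  obtain ⟨hn, hmem⟩ := floor_bounds hh hN ht
  rw [hφt]
  have e : (2 * C + 2 * (K ^ 2 * D.T)) * h = 2 * (C * h) + 2 * (K ^ 2 * D.T * h) := by ring
  rw [e]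
  refine sq_norm_hatInterp_sub_le (ContinuousLinearMap.id ℝ V) hh hN ht ?_ ?_
  · exact sq_norm_sub_le (B.φ_node _ hn.le) (sq_norm_primitive_sub_le_of_bound hh hN
      S.integrableOn_v hv hn hmem (left_mem_cell hh _))
  · exact sq_norm_sub_le (B.φ_node _ hn) (sq_norm_primitive_sub_le_of_bound hh hN
      S.integrableOn_v hv hn hmem (right_mem_cell hh _))

/-- The temperature error in `L^∞(0, T; H)`. -/
theorem IsSolution.temperature_error (S : IsSolution D θ φ θt v z) (hD : Assumptions D) {C : ℝ}
    (hC : 0 < C) : ∃ M : ℝ, 0 ≤ M ∧ ∀ (N : ℕ) (h : ℝ) (θd φd : ℕ → V), 0 < h → h * N = D.T →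
      NodalBounds D N h C θd φd θ θt v z →
      InLp D.T ⊤ (fun t => D.emb (hatInterp h θd t - θ t)) ∧
      normLp D.T ⊤ (fun t => D.emb (hatInterp h θd t - θ t)) ≤ √(M * h) := by
  set J := ∫ r in Ioo 0 D.T, ‖θt r‖ ^ 2 with hJ
  have hJ0 : 0 ≤ J := integral_nonneg fun t => by positivity
  have hT := hD.T_pos
  refine ⟨2 * C + 2 * (‖D.emb‖ ^ 2 * J), by positivity, fun N h θd φd hh hN B => ?_⟩
  refine inLp_top_of_sq_le (D.emb.continuous.comp_aestronglyMeasurable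
    ((stronglyMeasurable_hatInterp h _).aestronglyMeasurable.sub
      S.integrableOn_θ.aestronglyMeasurable)) ?_
  filter_upwards [S.θ_ae_eq hD, ae_restrict_mem measurableSet_Ioo] with t hθt ht
  obtain ⟨hn, hmem⟩ := floor_bounds hh hN ht
  rw [hθt, map_sub]
  have e : (2 * C + 2 * (‖D.emb‖ ^ 2 * J)) * h = 2 * (C * h) + 2 * (‖D.emb‖ ^ 2 * (J * h)) := by
    ring
  rw [e]
  have osc : ∀ s ∈ Icc (⌊t / h⌋₊ * h) ((⌊t / h⌋₊ + 1 : ℕ) * h),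
      ‖D.emb (primitive D.θ₀ θt s) - D.emb (primitive D.θ₀ θt t)‖ ^ 2 ≤
        ‖D.emb‖ ^ 2 * (J * h) := by
    intro s hs
    rw [← map_sub]
    calc _ ≤ (‖D.emb‖ * ‖primitive D.θ₀ θt s - primitive D.θ₀ θt t‖) ^ 2 :=
          pow_le_pow_left₀ (norm_nonneg _) (D.emb.le_opNorm _) 2
      _ = ‖D.emb‖ ^ 2 * ‖primitive D.θ₀ θt s - primitive D.θ₀ θt t‖ ^ 2 := by ring
      _ ≤ _ := by
        gcongr
        exact sq_norm_primitive_sub_le_of_sq hh hN S.integrableOn_θt S.integrableOn_sq_θt hn hmem hs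
  refine sq_norm_hatInterp_sub_le D.emb hh hN ht
    (sq_norm_sub_le ?_ (osc _ (left_mem_cell hh _)))
    (sq_norm_sub_le ?_ (osc _ (right_mem_cell hh _)))
  · rw [← map_sub]; exact B.θ_node _ hn.le
  · rw [← map_sub]; exact B.θ_node _ hn

/-- The temperature error in `L^∞(0, T; H)`, weighted with `B₂^{1/2}`. On the domain of `A₁` this
norm is given by the form `B₂s`, which is bounded on `V`. -/
theorem IsSolution.weighted_temperature_error (S : IsSolution D θ φ θt v z) (hD : Assumptions D)
    {C : ℝ} (hC : 0 < C) : ∃ M : ℝ, 0 ≤ M ∧ ∀ (N : ℕ) (h : ℝ) (θd φd : ℕ → V), 0 < h →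
      h * N = D.T → IsDiscreteSolution D N h θd φd → NodalBounds D N h C θd φd θ θt v z →
      InLp D.T ⊤ (fun t => ev (posSqrt D.B₂) (D.emb (hatInterp h θd t - θ t))) ∧
      normLp D.T ⊤ (fun t => ev (posSqrt D.B₂) (D.emb (hatInterp h θd t - θ t))) ≤ √(M * h) := by
  obtain ⟨A, hA⟩ := hD.exists_clm_sqrt_B₂
  set J := ∫ r in Ioo 0 D.T, ‖θt r‖ ^ 2 with hJ
  have hJ0 : 0 ≤ J := integral_nonneg fun t => by positivity
  have hT := hD.T_pos
  have hB₂p : ∀ x ∈ D.B₂.domain, 0 ≤ inner ℝ (ev D.B₂ x) x := fun x hx =>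
    inner_ev_nonneg hD.B₂_maxMonotone hx
  refine ⟨2 * C + 2 * (‖D.B₂s‖ * J), by positivity, fun N h θd φd hh hN Sd B => ?_⟩
  have hdq : ∀ n < N, D.emb (diffQuot h θd n) ∈ D.A₁.domain := fun n hn => by
    rw [diffQuot, map_smul, map_sub]
    exact D.A₁.domain.smul_mem _
      (D.A₁.domain.sub_mem (Sd.emb_θ_mem hD hn) (Sd.emb_θ_mem hD hn.le))
  have hhat : ∀ t ∈ Ioo 0 D.T, D.emb (hatInterp h θd t) ∈ D.A₁.domain ∧
      ev D.A₁ (D.emb (hatInterp h θd t)) = ev D.A₁ (D.emb (θd ⌊t / h⌋₊))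
        + (t - ⌊t / h⌋₊ * h) • ev D.A₁ (D.emb (diffQuot h θd ⌊t / h⌋₊)) := by
    intro t ht
    obtain ⟨hn, -⟩ := floor_bounds hh hN ht
    have h1 := Sd.emb_θ_mem hD hn.le
    have h2 := D.A₁.domain.smul_mem (t - ⌊t / h⌋₊ * h) (hdq _ hn)
    rw [hatInterp, map_add, map_smul, ev_add h1 h2, ev_smul _ (hdq _ hn)]
    exact ⟨D.A₁.domain.add_mem h1 h2, rfl⟩
  refine inLp_top_of_sq_le ?_ ?_
  · have h1 : AEStronglyMeasurable (fun t => D.emb (hatInterp h θd t - θ t))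
        (volume.restrict (Ioo 0 D.T)) :=
      D.emb.continuous.comp_aestronglyMeasurable
        ((stronglyMeasurable_hatInterp h _).aestronglyMeasurable.sub
          S.integrableOn_θ.aestronglyMeasurable)
    have h2 := (stronglyMeasurable_affine h (fun n => ev D.A₁ (D.emb (θd n)))
      (fun n => ev D.A₁ (D.emb (diffQuot h θd n)))).aestronglyMeasurable
      (μ := volume.restrict (Ioo 0 D.T))
    refine (A.continuous.comp_aestronglyMeasurable
      (h1.add (h2.sub S.θ_A₁.2.2.aestronglyMeasurable))).congr ?_
    filter_upwards [S.θ_A₁.1, ae_restrict_mem measurableSet_Ioo] with t hθ ht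
    obtain ⟨h3, h4⟩ := hhat t ht
    have h5 := hA _ (D.A₁.domain.sub_mem h3 hθ)
    rw [ev_sub h3 hθ, h4] at h5
    rw [map_sub, ← h5]
    simp only [Pi.add_apply, Pi.sub_apply, map_sub]
  · filter_upwards [S.θ_ae_eq hD, S.θ_A₁.1, ae_restrict_mem measurableSet_Ioo] with t hθt hθ ht
    obtain ⟨hn, hmem⟩ := floor_bounds hh hN ht
    have hx : D.emb (hatInterp h θd t - θ t) ∈ D.B₂.domain := by
      rw [map_sub]; exact hD.A₁_le_B₂ (D.A₁.domain.sub_mem (hhat t ht).1 hθ)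
    rw [(norm_ev_posSqrt_sq hD.B₂_selfAdjoint hB₂p hx).2, ← hD.B₂_ext.2.2 _ hx, hθt]
    obtain ⟨s, hs0, hs1, hs⟩ := exists_hatInterp_eq hh hN ht θd
    rw [hs]
    have osc : ∀ n, D.B₂s (θd n - primitive D.θ₀ θt (n * h))
          (θd n - primitive D.θ₀ θt (n * h)) ≤ C * h →
        (n : ℝ) * h ∈ Icc (⌊t / h⌋₊ * h) ((⌊t / h⌋₊ + 1 : ℕ) * h) →
        D.B₂s (θd n - primitive D.θ₀ θt t) (θd n - primitive D.θ₀ θt t) ≤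
          (2 * C + 2 * (‖D.B₂s‖ * J)) * h := by
      intro n h1 h2
      have h3 := form_add_le D.B₂s hD.B₂_ext.1 hD.B₂_ext.2.1 (θd n - primitive D.θ₀ θt (n * h))
        (primitive D.θ₀ θt (n * h) - primitive D.θ₀ θt t)
      rw [sub_add_sub_cancel] at h3
      have h4 := sq_norm_primitive_sub_le_of_sq (x := D.θ₀) hh hN S.integrableOn_θt
        S.integrableOn_sq_θt hn hmem h2
      have h5 := form_le D.B₂s (primitive D.θ₀ θt (n * h) - primitive D.θ₀ θt t)
        (primitive D.θ₀ θt (n * h) - primitive D.θ₀ θt t)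
      have h6 := mul_le_mul_of_nonneg_left h4 (norm_nonneg D.B₂s)
      rw [mul_assoc, ← sq] at h5
      linarith
    exact form_convex_le D.B₂s hD.B₂_ext.1 hD.B₂_ext.2.1 hs0 hs1
      (osc _ (B.B₂_node _ hn.le) (left_mem_cell hh _))
      (osc _ (B.B₂_node _ hn) (right_mem_cell hh _))

end UniformErrors

/-! ### Errors in `L²` in time -/

section MeanErrors

theorem inLp_step {X : Type*} [NormedAddCommGroup X] {T h : ℝ} {N : ℕ} (hh : 0 < h)
    (hN : h * N = T) (w : ℕ → X) : InLp T ⊤ fun t => w ⌊t / h⌋₊ := by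
  refine memLp_top_of_bound (stronglyMeasurable_step h w).aestronglyMeasurable
    (∑ k ∈ Finset.range N, ‖w k‖) ?_
  filter_upwards [ae_restrict_mem measurableSet_Ioo] with t ht
  exact Finset.single_le_sum (f := fun k => ‖w k‖) (fun _ _ => norm_nonneg _)
    (Finset.mem_range.2 (floor_bounds hh hN ht).1)

theorem InLp.two_of_top {X : Type*} [NormedAddCommGroup X] {T : ℝ} {f : ℝ → X}
    (hf : InLp T ⊤ f) : InLp T 2 f :=
  MemLp.mono_exponent hf le_top

theorem InLp.integrableOn_sq {X : Type*} [NormedAddCommGroup X] {T : ℝ} {f : ℝ → X}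
    (hf : InLp T 2 f) : IntegrableOn (fun t => ‖f t‖ ^ 2) (Ioo 0 T) :=
  MemLp.integrable_norm_pow (p := 2) hf (by norm_num)

/-- Deviations from the mean value cancel under linear functionals. -/
theorem integral_cellMean_sub {X : Type*} [NormedAddCommGroup X] [NormedSpace ℝ X] [CompleteSpace X]
    (ℓ : X →L[ℝ] ℝ) {f : ℝ → X} {h : ℝ} (hh : 0 < h) {n : ℕ} (hf : IntegrableOn f (cell h n)) :
    IntegrableOn (fun t => ℓ (cellMean h f n - f t)) (cell h n) ∧
      ∫ t in cell h n, ℓ (cellMean h f n - f t) = 0 := by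
  have i1 : Integrable (fun _ : ℝ => cellMean h f n) (volume.restrict (cell h n)) :=
    integrableOn_const (volume_cell_lt_top h n).ne
  have i2 : Integrable (fun t => cellMean h f n - f t) (volume.restrict (cell h n)) := i1.sub hf
  refine ⟨ℓ.integrable_comp i2, ?_⟩
  rw [ℓ.integral_comp_comm i2, integral_sub i1 hf, setIntegral_const, volume_cell hh,
    smul_cellMean hh, sub_self, map_zero]

variable {V H : Type*} [NormedAddCommGroup V] [InnerProductSpace ℝ V]
  [NormedAddCommGroup H] [InnerProductSpace ℝ H] [CompleteSpace H] [CompleteSpace V]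
  {D : Data V H} {θ φ θt v : ℝ → V} {z : ℝ → H}

/-- The temperature error in `L²(0, T; V)`. -/
theorem IsSolution.mean_temperature_error (S : IsSolution D θ φ θt v z) (hD : Assumptions D)
    {C : ℝ} (hC : 0 < C) : ∃ M : ℝ, 0 ≤ M ∧ ∀ (N : ℕ) (h : ℝ) (θd φd : ℕ → V), 0 < h →
      h * N = D.T → NodalBounds D N h C θd φd θ θt v z →
      InLp D.T 2 (fun t => barInterp h θd t - θ t) ∧
      normLp D.T 2 (fun t => barInterp h θd t - θ t) ≤ √(M * h) := by
  set J := ∫ r in Ioo 0 D.T, ‖θt r‖ ^ 2 with hJ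
  have hJ0 : 0 ≤ J := integral_nonneg fun t => by positivity
  have hT := hD.T_pos
  refine ⟨2 * C + 2 * (D.T * J), by positivity, fun N h θd φd hh hN B => ?_⟩
  have hin : InLp D.T 2 (fun t => barInterp h θd t - θ t) :=
    InLp.two_of_top (MemLp.sub (inLp_step hh hN fun n => θd (n + 1)) S.θ_Linfty)
  refine ⟨hin, normLp_two_le hin ?_⟩
  have hhT : (N : ℝ) * h = D.T := by rw [← hN, mul_comm]
  rw [← sum_integral_cell hh hN hin.integrableOn_sq]
  have h1 : ∀ n ∈ Finset.range N, ∫ t in cell h n, ‖barInterp h θd t - θ t‖ ^ 2 ≤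
      2 * (h * ‖θd (n + 1) - cellMean h θ n‖ ^ 2)
        + 2 * (h * (h * ∫ t in cell h n, ‖θt t‖ ^ 2)) := by
    intro n hn
    have hn := Finset.mem_range.1 hn
    refine (setIntegral_cell_le_of_le (C := 2 * ‖θd (n + 1) - cellMean h θ n‖ ^ 2
        + 2 * (h * ∫ t in cell h n, ‖θt t‖ ^ 2)) hh
      (hin.integrableOn_sq.mono_set (cell_subset hh hN hn)) ?_).trans_eq (by ring)
    filter_upwards [ae_cell hh hN hn (S.θ_ae_eq hD), ae_restrict_mem (measurableSet_cell h n)]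
      with t hθt ht
    rw [barInterp, floor_eq_of_mem_cell hh ht]
    refine sq_norm_sub_le le_rfl ?_
    rw [hθt]
    refine (pow_le_pow_left₀ (norm_nonneg _) (norm_cellMean_sub_primitive_le hh hN
      S.integrableOn_θt S.integrableOn_θ (S.θ_ae_eq hD) hn (Ioo_subset_Icc_self ht)) 2).trans ?_
    exact sq_setIntegral_cell_le hh (S.integrableOn_θt.mono_set (cell_subset hh hN hn)).norm
      (S.integrableOn_sq_θt.mono_set (cell_subset hh hN hn))
  refine (Finset.sum_le_sum h1).trans ?_
  simp only [Finset.sum_add_distrib, ← Finset.mul_sum]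
  rw [sum_integral_cell hh hN S.integrableOn_sq_θt]
  have h2 := B.sum_θ
  have h3 : h ≤ D.T := by
    have hN0 : 1 ≤ N := Nat.one_le_iff_ne_zero.2 fun h0 => by
      rw [h0] at hN; simp at hN; linarith
    have := grid_le hh hN hN0
    simpa using this
  have h4 : h * (h * J) ≤ D.T * J * h := by
    calc h * (h * J) = h * J * h := by ring
      _ ≤ _ := by gcongr
  rw [← Finset.mul_sum] at h2
  linarith

/-- The velocity error in `L²(0, T; H)`, weighted with `B₁^{1/2}`. The deviation of `v` from its
mean value over a cell is of order `h^{1/2}` in this norm, because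
`∫ B₁ (v - m, v - m) = ∫ (B₁ v, v - m)` and `v` is Lipschitz continuous with values in `H`. -/
theorem IsSolution.mean_velocity_error (S : IsSolution D θ φ θt v z) (hD : Assumptions D) {C : ℝ}
    (hC : 0 < C) : ∃ M : ℝ, 0 ≤ M ∧ ∀ (N : ℕ) (h : ℝ) (θd φd : ℕ → V), 0 < h →
      h * N = D.T → IsDiscreteSolution D N h θd φd → NodalBounds D N h C θd φd θ θt v z →
      InLp D.T 2 (fun t => ev (posSqrt D.B₁)
        (D.emb (barInterp h (discreteV h D.v₀ φd) t - v t))) ∧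
      normLp D.T 2 (fun t => ev (posSqrt D.B₁)
        (D.emb (barInterp h (discreteV h D.v₀ φd) t - v t))) ≤ √(M * h) := by
  obtain ⟨K, hK, hz⟩ := S.v_W1H.2.1.exists_bound
  have hB₁p : ∀ x ∈ D.B₁.domain, 0 ≤ inner ℝ (ev D.B₁ x) x := fun x hx =>
    inner_ev_nonneg hD.B₁_maxMonotone hx
  obtain ⟨A, hA⟩ := exists_clm_ev_posSqrt hD.B₁_selfAdjoint hB₁p
  have hBi : IntegrableOn (fun t => ‖ev D.B₁ (D.emb (v t))‖) (Ioo 0 D.T) :=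
    (S.v_B₁.2.2.integrableOn (by norm_num)).norm
  set J := ∫ t in Ioo 0 D.T, ‖ev D.B₁ (D.emb (v t))‖ with hJ
  have hJ0 : 0 ≤ J := integral_nonneg fun t => norm_nonneg _
  refine ⟨C + K * J, by positivity, fun N h θd φd hh hN Sd B => ?_⟩
  set x : ℝ → V := fun t => barInterp h (discreteV h D.v₀ φd) t - v t with hx
  have hxt : InLp D.T ⊤ x :=
    MemLp.sub (inLp_step hh hN fun n => discreteV h D.v₀ φd (n + 1)) S.φ_W1V.2.1
  obtain ⟨R, hR, hxR⟩ := hxt.exists_bound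
  have hdom : ∀ᵐ t ∂volume.restrict (Ioo 0 D.T), D.emb (x t) ∈ D.B₁.domain ∧
      ev D.B₁ (D.emb (x t)) = ev D.B₁ (D.emb (diffQuot h φd ⌊t / h⌋₊)) - ev D.B₁ (D.emb (v t)) := by
    filter_upwards [S.v_B₁.1, ae_restrict_mem measurableSet_Ioo] with t h1 ht
    have h2 := Sd.emb_diffQuot_mem hD (floor_bounds hh hN ht).1
    have e : D.emb (x t) = D.emb (diffQuot h φd ⌊t / h⌋₊) - D.emb (v t) := map_sub _ _ _
    rw [e]
    exact ⟨D.B₁.domain.sub_mem h2 h1, ev_sub h2 h1⟩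
  have hsq : ∀ᵐ t ∂volume.restrict (Ioo 0 D.T),
      ‖ev (posSqrt D.B₁) (D.emb (x t))‖ ^ 2 = D.B₁s (x t) (x t) := by
    filter_upwards [hdom] with t ht
    rw [(norm_ev_posSqrt_sq hD.B₁_selfAdjoint hB₁p ht.1).2, hD.B₁_ext.2.2 _ ht.1]
  have hin : InLp D.T 2 (fun t => ev (posSqrt D.B₁) (D.emb (x t))) := by
    refine InLp.two_of_top (inLp_top_of_sq_le (Q := ‖D.B₁s‖ * R * R) ?_ ?_).1
    · have h2 := (stronglyMeasurable_step h
        (fun n => ev D.B₁ (D.emb (diffQuot h φd n)))).aestronglyMeasurable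
        (μ := volume.restrict (Ioo 0 D.T))
      refine (A.continuous.comp_aestronglyMeasurable
        ((D.emb.continuous.comp_aestronglyMeasurable hxt.1).add
          (h2.sub S.v_B₁.2.2.aestronglyMeasurable))).congr ?_
      filter_upwards [hdom] with t ht
      rw [← hA _ ht.1, ht.2]
      rfl
    · filter_upwards [hsq, hxR] with t h1 h2
      rw [h1]
      refine (form_le _ _ _).trans ?_
      gcongr
  refine ⟨hin, normLp_two_le hin ?_⟩
  rw [← sum_integral_cell hh hN hin.integrableOn_sq]
  have h1 : ∀ n ∈ Finset.range N, ∫ t in cell h n, ‖ev (posSqrt D.B₁) (D.emb (x t))‖ ^ 2 ≤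
      h * D.B₁s (diffQuot h φd n - cellMean h v n) (diffQuot h φd n - cellMean h v n)
        + K * h * ∫ t in cell h n, ‖ev D.B₁ (D.emb (v t))‖ := by
    intro n hn
    have hn := Finset.mem_range.1 hn
    have hs := cell_subset hh hN hn
    set m := cellMean h v n with hm
    set Δ := diffQuot h φd n - m with hΔ
    -- the part of the integrand that is linear in the deviation `m - v`
    set ℓ : V →L[ℝ] ℝ := (2 : ℝ) • D.B₁s Δ + D.B₁s m with hℓ
    obtain ⟨i1, e1⟩ := integral_cellMean_sub ℓ hh (S.integrableOn_v.mono_set hs)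
    have i2 : Integrable (fun _ : ℝ => D.B₁s Δ Δ) (volume.restrict (cell h n)) :=
      integrableOn_const (volume_cell_lt_top h n).ne
    have i3 : Integrable (fun t => K * h * ‖ev D.B₁ (D.emb (v t))‖) (volume.restrict (cell h n)) :=
      (hBi.mono_set hs).const_mul _
    have i4 : Integrable (fun t => D.B₁s Δ Δ + ℓ (m - v t)) (volume.restrict (cell h n)) :=
      i2.add i1
    have hle : ∫ t in cell h n, ‖ev (posSqrt D.B₁) (D.emb (x t))‖ ^ 2 ≤
        ∫ t in cell h n, (D.B₁s Δ Δ + ℓ (m - v t) + K * h * ‖ev D.B₁ (D.emb (v t))‖) := by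
      refine integral_mono_ae (hin.integrableOn_sq.mono_set hs) (i4.add i3) ?_
      filter_upwards [ae_cell hh hN hn hsq, ae_cell hh hN hn S.v_B₁.1,
        ae_cell hh hN hn (S.v_ae_eq hD), ae_restrict_mem (measurableSet_cell h n)]
        with t h1 h2 h3 ht
      rw [h1]
      have e2 : x t = Δ + (m - v t) := by
        simp only [hx, barInterp, floor_eq_of_mem_cell hh ht, hΔ]
        change diffQuot h φd n - v t = _
        abel
      have e3 : D.B₁s (x t) (x t) = D.B₁s Δ Δ + ℓ (m - v t)
          - inner ℝ (ev D.B₁ (D.emb (v t))) (D.emb (m - v t)) := by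
        rw [e2, ← hD.B₁_ext.2.2 _ h2, hℓ]
        simp only [map_add, map_sub, add_apply, sub_apply, smul_apply, smul_eq_mul]
        rw [hD.B₁_ext.2.1 m Δ, hD.B₁_ext.2.1 (v t) Δ]
        ring
      have e4 : ‖D.emb (m - v t)‖ ≤ K * h := by
        rw [map_sub, hm, ← cellMean_clm_comp D.emb (S.integrableOn_v.mono_set hs), h3]
        refine (norm_cellMean_sub_primitive_le hh hN S.integrableOn_z
          (D.emb.integrable_comp S.integrableOn_v) (S.v_ae_eq hD) hn
          (Ioo_subset_Icc_self ht)).trans ?_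
        exact setIntegral_cell_le_of_le hh (S.integrableOn_z.mono_set hs).norm
          (ae_cell hh hN hn hz)
      have e5 : -inner ℝ (ev D.B₁ (D.emb (v t))) (D.emb (m - v t)) ≤
          ‖ev D.B₁ (D.emb (v t))‖ * ‖D.emb (m - v t)‖ :=
        (neg_le_abs _).trans (abs_real_inner_le_norm _ _)
      have e6 := mul_le_mul_of_nonneg_left e4 (norm_nonneg (ev D.B₁ (D.emb (v t))))
      rw [e3]
      linarith
    refine hle.trans_eq ?_
    rw [integral_add i4 i3, integral_add i2 i1, e1, setIntegral_const, volume_cell hh,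
      integral_const_mul, smul_eq_mul, add_zero]
  refine (Finset.sum_le_sum h1).trans ?_
  rw [Finset.sum_add_distrib, ← Finset.mul_sum (f := fun n =>
    ∫ t in cell h n, ‖ev D.B₁ (D.emb (v t))‖), sum_integral_cell hh hN hBi]
  have := B.sum_B₁
  linarith

/-- The error in the mixed term. By the heat equation `A₁ (θ̄ - θ)` takes its values in `V`, so that
the form `B₂s` controls the product of the deviations from the mean values. -/
theorem IsSolution.mixed_error (S : IsSolution D θ φ θt v z) (hD : Assumptions D) {C : ℝ}
    (hC : 0 < C) : ∃ M : ℝ, 0 ≤ M ∧ ∀ (N : ℕ) (h : ℝ) (θd φd : ℕ → V), 0 < h →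
      h * N = D.T → IsDiscreteSolution D N h θd φd → NodalBounds D N h C θd φd θ θt v z →
      IntegrableOn (fun t => inner ℝ (ev D.B₂ (D.emb (barInterp h θd t - θ t)))
        (ev D.A₁ (D.emb (barInterp h θd t - θ t)))) (Ioo 0 D.T) ∧
      ∫ t in Ioo 0 D.T, inner ℝ (ev D.B₂ (D.emb (barInterp h θd t - θ t)))
        (ev D.A₁ (D.emb (barInterp h θd t - θ t))) ≤ M * h := by
  set g : ℝ → V := fun t => θt t + D.η • v t with hg
  have hg2 : InLp D.T 2 g := by
    exact MemLp.add S.θ_H1.2.1 ((InLp.two_of_top S.φ_W1V.2.1).const_smul D.η)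
  have hgi : IntegrableOn g (Ioo 0 D.T) := hg2.integrableOn (by norm_num)
  set J := ∫ r in Ioo 0 D.T, ‖θt r‖ ^ 2 with hJ
  have hJ0 : 0 ≤ J := integral_nonneg fun t => by positivity
  set J' := ∫ r in Ioo 0 D.T, ‖g r‖ ^ 2 with hJ'
  have hJ'0 : 0 ≤ J' := integral_nonneg fun t => by positivity
  refine ⟨C + ‖D.B₂s‖ * (J + J'), by positivity, fun N h θd φd hh hN Sd B => ?_⟩
  set a : ℕ → V := fun n => diffQuot h θd n + D.η • diffQuot h φd n with ha
  have hA₁d : ∀ n < N, D.emb (θd (n + 1)) ∈ D.A₁.domain ∧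
      ev D.A₁ (D.emb (θd (n + 1))) = -D.emb (a n) := fun n hn => by
    refine ⟨Sd.θ_mem n hn, ?_⟩
    rw [ha, map_add, map_smul]
    exact eq_neg_of_add_eq_zero_right (Sd.eq₁ n hn)
  set F : ℝ → ℝ := fun t => inner ℝ (ev D.B₂ (D.emb (barInterp h θd t - θ t)))
    (ev D.A₁ (D.emb (barInterp h θd t - θ t))) with hF
  set x : ℝ → V := fun t => barInterp h θd t - θ t with hx
  set y : ℝ → V := fun t => a ⌊t / h⌋₊ - g t with hy
  have hFe : ∀ᵐ t ∂volume.restrict (Ioo 0 D.T), F t = -D.B₂s (x t) (y t) := by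
    filter_upwards [S.A₁_θ_graph, ae_restrict_mem measurableSet_Ioo] with t h1 ht
    obtain ⟨h1, h2⟩ := mem_graph_iff_ev.1 h1
    obtain ⟨h3, h4⟩ := hA₁d _ (floor_bounds hh hN ht).1
    have e : D.emb (x t) = D.emb (θd (⌊t / h⌋₊ + 1)) - D.emb (θ t) := map_sub _ _ _
    have hd : D.emb (x t) ∈ D.A₁.domain := by rw [e]; exact D.A₁.domain.sub_mem h3 h1
    have e2 : ev D.A₁ (D.emb (x t)) = -D.emb (y t) := by
      rw [e, ev_sub h3 h1, h4, h2, hy, map_sub]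
      abel
    change inner ℝ (ev D.B₂ (D.emb (x t))) (ev D.A₁ (D.emb (x t))) = _
    rw [e2, inner_neg_right, hD.B₂_ext.2.2 _ (hD.A₁_le_B₂ hd)]
  have hxt : InLp D.T ⊤ x := MemLp.sub (inLp_step hh hN fun n => θd (n + 1)) S.θ_Linfty
  obtain ⟨R, hR, hxR⟩ := hxt.exists_bound
  have hyi : IntegrableOn y (Ioo 0 D.T) :=
    Integrable.sub ((inLp_step hh hN a).integrableOn le_top) hgi
  have hFi : IntegrableOn F (Ioo 0 D.T) := by
    have hm : AEStronglyMeasurable (fun t => -D.B₂s (x t) (y t)) (volume.restrict (Ioo 0 D.T)) :=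
      (D.B₂s.aestronglyMeasurable_comp₂ hxt.1 hyi.aestronglyMeasurable).neg
    have hm' : AEStronglyMeasurable F (volume.restrict (Ioo 0 D.T)) := by
      refine hm.congr ?_
      filter_upwards [hFe] with t ht using ht.symm
    refine Integrable.mono' (hyi.norm.const_mul (‖D.B₂s‖ * R)) hm' ?_
    filter_upwards [hFe, hxR] with t h1 h2
    rw [h1, norm_neg]
    refine (D.B₂s.le_opNorm₂ _ _).trans ?_
    gcongr
  refine ⟨hFi, ?_⟩
  rw [← sum_integral_cell hh hN hFi]
  have h1 : ∀ n ∈ Finset.range N, ∫ t in cell h n, F t ≤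
      h * inner ℝ (ev D.B₂ (D.emb (θd (n + 1) - cellMean h θ n)))
        (ev D.A₁ (D.emb (θd (n + 1) - cellMean h θ n)))
      + ‖D.B₂s‖ * (h * (∫ t in cell h n, ‖θt t‖ ^ 2) + h * ∫ t in cell h n, ‖g t‖ ^ 2) := by
    intro n hn
    have hn := Finset.mem_range.1 hn
    have hs := cell_subset hh hN hn
    set m := cellMean h θ n with hm
    set μ := cellMean h g n with hμ
    set ε := θd (n + 1) - m with hε
    set α := a n - μ with hα
    have hβ : inner ℝ (ev D.B₂ (D.emb ε)) (ev D.A₁ (D.emb ε)) = -D.B₂s ε α := by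
      obtain ⟨h1, h2⟩ := mem_graph_iff_ev.1 (S.cellMean_A₁ hD hh hN hn)
      obtain ⟨h3, h4⟩ := hA₁d n hn
      have e : D.emb ε = D.emb (θd (n + 1)) - D.emb m := map_sub _ _ _
      have hd : D.emb ε ∈ D.A₁.domain := by rw [e]; exact D.A₁.domain.sub_mem h3 h1
      have hμe : μ = cellMean h θt n + D.η • cellMean h v n := by
        rw [hμ, cellMean, cellMean, cellMean, integral_add (S.integrableOn_θt.mono_set hs)
          (by exact (S.integrableOn_v.mono_set hs).smul D.η), integral_smul, smul_add,
          smul_comm]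
      have e2 : ev D.A₁ (D.emb ε) = -D.emb α := by
        rw [e, ev_sub h3 h1, h4, h2, ← hμe, hα, map_sub]
        abel
      rw [e2, inner_neg_right, hD.B₂_ext.2.2 _ (hD.A₁_le_B₂ hd)]
    set I₁ := ∫ t in cell h n, ‖θt t‖ with hI₁
    set I₂ := ∫ t in cell h n, ‖g t‖ with hI₂
    have hI₁0 : 0 ≤ I₁ := integral_nonneg fun t => norm_nonneg _
    obtain ⟨i1, e1⟩ := integral_cellMean_sub (D.B₂s ε) hh (hgi.mono_set hs)
    obtain ⟨i2, e2⟩ := integral_cellMean_sub (D.B₂s α) hh (S.integrableOn_θ.mono_set hs)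
    have i0 : Integrable (fun _ : ℝ => -D.B₂s ε α) (volume.restrict (cell h n)) :=
      integrableOn_const (volume_cell_lt_top h n).ne
    have i01 : Integrable (fun t => -D.B₂s ε α - D.B₂s ε (μ - g t))
      (volume.restrict (cell h n)) := i0.sub i1
    have i012 : Integrable (fun t => -D.B₂s ε α - D.B₂s ε (μ - g t) - D.B₂s α (m - θ t))
      (volume.restrict (cell h n)) := i01.sub i2
    have i4 : Integrable (fun t => ‖g t‖) (volume.restrict (cell h n)) := (hgi.mono_set hs).norm
    have i5 : Integrable (fun _ : ℝ => ‖μ‖) (volume.restrict (cell h n)) :=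
      integrableOn_const (volume_cell_lt_top h n).ne
    have i3 : Integrable (fun t => ‖D.B₂s‖ * I₁ * (‖μ‖ + ‖g t‖)) (volume.restrict (cell h n)) :=
      (i5.add i4).const_mul _
    have hle : ∫ t in cell h n, F t ≤ ∫ t in cell h n,
        (-D.B₂s ε α - D.B₂s ε (μ - g t) - D.B₂s α (m - θ t)
          + ‖D.B₂s‖ * I₁ * (‖μ‖ + ‖g t‖)) := by
      refine integral_mono_ae (hFi.mono_set hs) (i012.add i3) ?_
      filter_upwards [ae_cell hh hN hn hFe, ae_cell hh hN hn (S.θ_ae_eq hD),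
        ae_restrict_mem (measurableSet_cell h n)] with t h1 h2 ht
      rw [h1]
      have e2 : x t = ε + (m - θ t) := by
        simp only [hx, barInterp, floor_eq_of_mem_cell hh ht, hε]
        abel
      have e3 : y t = α + (μ - g t) := by
        simp only [hy, floor_eq_of_mem_cell hh ht, hα]
        abel
      have e4 : -D.B₂s (x t) (y t) = -D.B₂s ε α - D.B₂s ε (μ - g t) - D.B₂s α (m - θ t)
          - D.B₂s (m - θ t) (μ - g t) := by
        rw [hD.B₂_ext.2.1 α (m - θ t), e2, e3]
        simp only [map_add, add_apply]
        ring
      have e5 : ‖m - θ t‖ ≤ I₁ := by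
        rw [hm, h2]
        exact norm_cellMean_sub_primitive_le hh hN S.integrableOn_θt S.integrableOn_θ
          (S.θ_ae_eq hD) hn (Ioo_subset_Icc_self ht)
      have e6 : -D.B₂s (m - θ t) (μ - g t) ≤ ‖D.B₂s‖ * I₁ * (‖μ‖ + ‖g t‖) := by
        refine (neg_le_abs _).trans ((D.B₂s.le_opNorm₂ _ _).trans ?_)
        gcongr
        exact norm_sub_le _ _
      rw [e4]
      linarith
    refine hle.trans ?_
    rw [integral_add i012 i3, integral_sub i01 i2, integral_sub i0 i1, e1, e2, setIntegral_const,
      volume_cell hh, integral_const_mul, integral_add i5 i4, setIntegral_const, volume_cell hh,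
      smul_eq_mul, smul_eq_mul, hβ, sub_zero, sub_zero]
    have hμn : h * ‖μ‖ ≤ I₂ := by
      have : ‖h • μ‖ ≤ I₂ := by
        rw [hμ, smul_cellMean hh]; exact norm_integral_le_integral_norm _
      rwa [norm_smul, Real.norm_of_nonneg hh.le] at this
    have q1 := sq_setIntegral_cell_le hh (S.integrableOn_θt.mono_set hs).norm
      (S.integrableOn_sq_θt.mono_set hs)
    have q2 := sq_setIntegral_cell_le hh (hgi.mono_set hs).norm (hg2.integrableOn_sq.mono_set hs)
    rw [add_le_add_iff_left, mul_assoc]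
    refine mul_le_mul_of_nonneg_left ?_ (norm_nonneg D.B₂s)
    calc I₁ * (h * ‖μ‖ + I₂) ≤ I₁ * (I₂ + I₂) := by gcongr
      _ ≤ I₁ ^ 2 + I₂ ^ 2 := by nlinarith [sq_nonneg (I₁ - I₂)]
      _ ≤ _ := add_le_add q1 q2
  refine (Finset.sum_le_sum h1).trans ?_
  rw [Finset.sum_add_distrib, ← Finset.mul_sum (f := fun n =>
      h * (∫ t in cell h n, ‖θt t‖ ^ 2) + h * ∫ t in cell h n, ‖g t‖ ^ 2), Finset.sum_add_distrib,
    ← Finset.mul_sum (f := fun n => ∫ t in cell h n, ‖θt t‖ ^ 2),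
    ← Finset.mul_sum (f := fun n => ∫ t in cell h n, ‖g t‖ ^ 2),
    sum_integral_cell hh hN S.integrableOn_sq_θt, sum_integral_cell hh hN hg2.integrableOn_sq]
  have := B.sum_BA
  linarith

end MeanErrors

/-! ### Independence of the choice of the solution -/

section Congruence

/-- A bound for a function of `u` carries over to every function that equals `u` almost
everywhere. -/
theorem InLp.congr_of_le {V X : Type*} [NormedAddCommGroup X] {T K : ℝ} {p : ℝ≥0∞} {u w : ℝ → V}
    (F : ℝ → V → X) (hf : InLp T p (fun t => F t (u t)) ∧ normLp T p (fun t => F t (u t)) ≤ K)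
    (h : u =ᵐ[volume.restrict (Ioo 0 T)] w) :
    InLp T p (fun t => F t (w t)) ∧ normLp T p (fun t => F t (w t)) ≤ K := by
  have e : (fun t => F t (u t)) =ᵐ[volume.restrict (Ioo 0 T)] fun t => F t (w t) :=
    h.mono fun t ht => by simp only [ht]
  refine ⟨(memLp_congr_ae e).1 hf.1, ?_⟩
  rw [normLp, ← eLpNorm_congr_ae e]
  exact hf.2

end Congruence

end AbstractSoundHeat

open AbstractSoundHeat in
theorem theorem1p3 {V H : Type*} [NormedAddCommGroup V] [InnerProductSpace ℝ V] [CompleteSpace V]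
    [NormedAddCommGroup H] [InnerProductSpace ℝ H] [CompleteSpace H]
    (D : Data V H) (hD : Assumptions D) (h₀ : ℝ) (hh₀ : 0 < h₀) :
    ∃ h₀₀ : ℝ, 0 < h₀₀ ∧ h₀₀ < h₀ ∧ ∃ M : ℝ, 0 < M ∧
      ∀ (N : ℕ) (h : ℝ), 0 < N → h = D.T / N → h < h₀₀ →
      -- the discrete solution
      ∀ θd φd : ℕ → V, IsDiscreteSolution D N h θd φd →
      -- the exact solution, `v` is the derivative of `φ`
      ∀ (θ φ θt v : ℝ → V) (z : ℝ → H), IsSolution D θ φ θt v z →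
      -- the seven error functions
      ∀ (eL eB₁ eθ eB₂ : ℝ → H) (eφ eθV : ℝ → V) (eBA : ℝ → ℝ),
      eL = (fun t => ev (posSqrt ((D.L : H →ₗ[ℝ] H).toPMap ⊤))
        (D.emb (hatInterp h (discreteV h D.v₀ φd) t - v t))) →
      eB₁ = (fun t => ev (posSqrt D.B₁)
        (D.emb (barInterp h (discreteV h D.v₀ φd) t - v t))) →
      eφ = (fun t => hatInterp h φd t - φ t) →
      eθ = (fun t => D.emb (hatInterp h θd t - θ t)) →
      eθV = (fun t => barInterp h θd t - θ t) →
      eB₂ = (fun t => ev (posSqrt D.B₂) (D.emb (hatInterp h θd t - θ t))) →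
      eBA = (fun t => inner ℝ (ev D.B₂ (D.emb (barInterp h θd t - θ t)))
        (ev D.A₁ (D.emb (barInterp h θd t - θ t)))) →
      InLp D.T ⊤ eL ∧ InLp D.T 2 eB₁ ∧ InLp D.T ⊤ eφ ∧ InLp D.T ⊤ eθ ∧ InLp D.T 2 eθV ∧
      InLp D.T ⊤ eB₂ ∧ MeasureTheory.IntegrableOn eBA (Set.Ioo 0 D.T) ∧
      normLp D.T ⊤ eL + normLp D.T 2 eB₁ + normLp D.T ⊤ eφ + normLp D.T ⊤ eθ
        + normLp D.T 2 eθV + normLp D.T ⊤ eB₂ + (∫ t in Set.Ioo 0 D.T, eBA t)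
        ≤ M * h ^ (1 / 2 : ℝ) := by
  by_cases hS : ∃ (θ φ θt v : ℝ → V) (z : ℝ → H), IsSolution D θ φ θt v z
  swap
  · -- without a solution of the continuous problem there is nothing to estimate
    exact ⟨h₀ / 2, by positivity, by linarith, 1, one_pos,
      fun _ _ _ _ _ _ _ _ θ φ θt v z S => absurd ⟨θ, φ, θt, v, z, S⟩ hS⟩
  obtain ⟨θ', φ', θt', v', z', S'⟩ := hS
  obtain ⟨h₁, C, hh₁, hC, hnode⟩ := S'.exists_nodalBounds hD
  obtain ⟨M₁, hM₁, H₁⟩ := S'.velocity_error hD hC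
  obtain ⟨M₂, hM₂, H₂⟩ := S'.mean_velocity_error hD hC
  obtain ⟨M₃, hM₃, H₃⟩ := S'.displacement_error hD hC
  obtain ⟨M₄, hM₄, H₄⟩ := S'.temperature_error hD hC
  obtain ⟨M₅, hM₅, H₅⟩ := S'.mean_temperature_error hD hC
  obtain ⟨M₆, hM₆, H₆⟩ := S'.weighted_temperature_error hD hC
  obtain ⟨M₇, hM₇, H₇⟩ := S'.mixed_error hD hC
  have hT := hD.T_pos
  refine ⟨min h₁ h₀ / 2, by positivity, ?_, √M₁ + √M₂ + √M₃ + √M₄ + √M₅ + √M₆ + M₇ * √D.T + 1,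
    by positivity, ?_⟩
  · have := min_le_right h₁ h₀
    linarith
  intro N h hN hhN hlt θd φd Sd θ φ θt v z S eL eB₁ eθ eB₂ eφ eθV eBA rfl rfl rfl rfl rfl rfl rfl
  have hNr : (1 : ℝ) ≤ N := Nat.one_le_cast.2 hN
  have hh : 0 < h := by rw [hhN]; positivity
  have hNT : h * N = D.T := by rw [hhN]; field_simp
  have hhT : h ≤ D.T := by rw [← hNT]; exact le_mul_of_one_le_right hh.le hNr
  have hle : h ≤ h₁ := by
    have h1 := min_le_left h₁ h₀
    have h2 : 0 < min h₁ h₀ := lt_min hh₁ hh₀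
    linarith
  have B := hnode N h hN hhN hle θd φd Sd
  -- the constants belong to one fixed solution, and every solution equals this one
  obtain ⟨uθ, uφ, uv⟩ := S'.unique hD S
  have c₁ := InLp.congr_of_le
    (fun t x => ev (posSqrt ((D.L : H →ₗ[ℝ] H).toPMap ⊤))
      (D.emb (hatInterp h (discreteV h D.v₀ φd) t - x)))
    (H₁ N h θd φd hh hNT B) uv
  have c₂ := InLp.congr_of_le
    (fun t x => ev (posSqrt D.B₁) (D.emb (barInterp h (discreteV h D.v₀ φd) t - x)))
    (H₂ N h θd φd hh hNT Sd B) uv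
  have c₃ := InLp.congr_of_le
    (fun t x => hatInterp h φd t - x)
    (H₃ N h θd φd hh hNT B) uφ
  have c₄ := InLp.congr_of_le
    (fun t x => D.emb (hatInterp h θd t - x))
    (H₄ N h θd φd hh hNT B) uθ
  have c₅ := InLp.congr_of_le
    (fun t x => barInterp h θd t - x)
    (H₅ N h θd φd hh hNT B) uθ
  have c₆ := InLp.congr_of_le
    (fun t x => ev (posSqrt D.B₂) (D.emb (hatInterp h θd t - x)))
    (H₆ N h θd φd hh hNT Sd B) uθ
  obtain ⟨i₇, l₇⟩ := H₇ N h θd φd hh hNT Sd B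
  have u₇ : (fun t => inner ℝ (ev D.B₂ (D.emb (barInterp h θd t - θ' t)))
      (ev D.A₁ (D.emb (barInterp h θd t - θ' t)))) =ᵐ[MeasureTheory.Measure.restrict
        MeasureTheory.volume (Set.Ioo 0 D.T)]
      fun t => inner ℝ (ev D.B₂ (D.emb (barInterp h θd t - θ t)))
        (ev D.A₁ (D.emb (barInterp h θd t - θ t))) := uθ.mono fun t ht => by simp only [ht]
  rw [MeasureTheory.integral_congr_ae u₇] at l₇
  refine ⟨c₁.1, c₂.1, c₃.1, c₄.1, c₅.1, c₆.1, i₇.congr u₇, ?_⟩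
  -- the mixed term is even of order `h`
  have hs : h ≤ √D.T * √h := by
    calc h = √h * √h := (Real.mul_self_sqrt hh.le).symm
      _ ≤ √D.T * √h := by gcongr
  have l₇' := l₇.trans (mul_le_mul_of_nonneg_left hs hM₇)
  have b₁ := c₁.2
  have b₂ := c₂.2
  have b₃ := c₃.2
  have b₄ := c₄.2
  have b₅ := c₅.2
  have b₆ := c₆.2
  rw [Real.sqrt_mul hM₁] at b₁
  rw [Real.sqrt_mul hM₂] at b₂
  rw [Real.sqrt_mul hM₃] at b₃
  rw [Real.sqrt_mul hM₄] at b₄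
  rw [Real.sqrt_mul hM₅] at b₅
  rw [Real.sqrt_mul hM₆] at b₆
  rw [← Real.sqrt_eq_rpow]
  have := Real.sqrt_nonneg h
  linarith
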